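/- **Pauli operators.** Let $n,k\ge 1$. An $XZ$-form Pauli operator on $n$ qubits is $P=\bigotimes_{u=1}^n D_u$ with each $D_u\in\{I,X,Z\}$; its weight is the number of non-identity factors. $\mathcal P_{n,k}$ is the set of those of weight at most $k$. $\mathcal Q_{n,k}$ is the collection of size-$k$ subsets $Q\subseteq\mathcal P_{n,k}$ of pairwise commuting operators, all supported inside a common set of $k$ qubits. $X_u,Z_u$ denote $X,Z$ on qubit $u$; $D_u,E_v$ stand for weight-one operators. **Constraint system.** Besides the symbols $P\in\mathcal P_{n,k}$ there are symbols $P|Q$ for $P\in Q\in\mathcal Q_{n,k}$. The $(n,k)$-constraint system $C_1,\dots,C_m$ (listed in any fixed order) consists of $D_uE_vD_uE_v=I$ ($u\neq v$, $D,E\in\{X,Z\}$); $X_uZ_uX_uZ_u=-I$; $E_vX_uZ_uX_uZ_uE_v=-I$ (all $u,v$ and $E\in\{X,Z\}$); $P\cdot\prod_{v\in\operatorname{supp}P}D_v=I$ for $P=\prod_{v}D_v\in\mathcal P_{n,k}$; and $(P|Q)\,P=I$ for $P\in Q\in\mathcal Q_{n,k}$. Write the right-hand side of $C_j$ as $(-1)^{\tau_j}I$,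 and let $\mathfrak V$ be the sequence of all symbols on the left-hand sides of $C_1,\dots,C_m$, in order. **Sequence.** There are $2n$ control qubits, named $(u,D)$ with $u\in[n]$, $D\in\{X,Z\}$, and $\Lambda_c(P)$ denotes $P$ controlled by qubit $c$. Let $\mathfrak W$ be the concatenation over $u=1,\dots,n$ of $\mathfrak V,\Lambda_{(u,X)}(X_u),\mathfrak V,\Lambda_{(u,Z)}(Z_u)$. Let $\mathfrak Q_1,\dots,\mathfrak Q_L$ list, in any fixed order with $\mathfrak Q_1$ empty, all concatenations of a sequence of at most $k$ weight-one Pauli operators followed by a sequence of at most $k$ symbols $P|Q$ with one common $Q$. Let $\mathfrak U=(U_1,\dots,U_N)$ be the concatenation over $l=1,\dots,L$ of $\mathfrak Q_l,\mathfrak W,\mathfrak W^*,\mathfrak Q_l^*$, where $^*$ reverses a sequence. For $0\le i<2n$, $l\in[L]$, $0\le j\le m$ let $N_j^{i,l}$ be the number of entries of $\mathfrak U$ up to the point in block $l$ where, within the $(i+1)$-th copy of $\mathfrak V$ in $\mathfrak W$, the first $j$ constraints have been completed. **Game.** The referee holds a clock register $\mathsf S$ with basis $|0\rangle,\dots,|N\rangle$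 and a register $\mathsf X$ of the $2n$ control qubits. For $0\le s<t\le N$ let $\Pi_{s,t}$ be the projective measurement with $\Pi^a_{s,t}$ ($a=0,1$) the projection onto $(|s\rangle+(-1)^a|t\rangle)/\sqrt2$ and $\Pi^2_{s,t}=I-\Pi^0_{s,t}-\Pi^1_{s,t}$. A strategy $(\rho,\{\hat P\},\{\hat Q\})$ consists of a finite-dimensional space $\mathcal R$, a density operator $\rho$ on $\mathcal S\otimes\mathcal X\otimes\mathcal R$, a reflection $\hat P$ (Hermitian, $\hat P^2=I$) on $\mathcal R$ for every $P\in\mathcal P_{n,k}$, and a projective measurement $\hat Q=\{\hat Q^b\}_{b:Q\to\{0,1\}}$ on $\mathcal R$ for every $Q\in\mathcal Q_{n,k}$. On question $P$ the player answers the outcome $a$ of $\{(I+(-1)^a\hat P)/2\}_{a}$, on question $Q$ the outcome $b$ of $\hat Q$. The referee does one of the following, each with probability $1/3$. 1. *Propagation check.* Sample $i\in[N]$ uniformly. If $U_i=P$, send $P$, receive $a$, measure $\Pi_{i-1,i}$ and accept iff the outcome $t$ is $2$ or $a$. If $U_i=P|Q$, send $Q$, receive $b$, and accept iff $t$ is $2$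 or $b(P)$. If $U_i=\Lambda_c(P)$, send $P$, receive $a$, and accept if $t=2$; otherwise measure $Z$ on control qubit $c$ and accept iff its outcome is $0$ and $t=0$, or its outcome is $1$ and $t=a$. 2. *Initialization check.* Measure $\mathsf S$; if the outcome is $0$, measure Pauli $X$ on a uniformly random control qubit and accept iff the outcome is $0$ (eigenvalue $+1$); otherwise accept. 3. *Constraint check.* Sample $0\le i<2n$, $l\in[L]$, $j\in[m]$ uniformly, measure $\Pi_{s,t}$ for $s=N_{j-1}^{i,l}$, $t=N_j^{i,l}$, and accept iff the outcome is $2$ or $\tau_j$. The value of a strategy is its acceptance probability; the value of the game is the supremum over all strategies. **Distances.** For operators $R_0,R_1$ put $d_\rho(R_0,R_1)=[1-\operatorname{Re}\operatorname{tr}(R_0R_1\rho)]^{1/2}$, and for POVMs $M_0,M_1$ with the same outcomes put $d_\rho(M_0,M_1)=\inf\bigl[\sum_a\operatorname{tr}\bigl((N_0^a-N_1^a)^*(N_0^a-N_1^a)\rho\bigr)\bigr]^{1/2}$, the infimum being over all operators $N_i^a$ with $(N_i^a)^*N_i^a=M_i^a$. **Theorem.** For every $k\ge1$ there are constants $\kappa,C>0$,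 depending only on $k$, such that for every $n\ge1$ the following holds. The $(n,k)$-constraint propagation game has value $1$. Moreover, let $\varepsilon\ge0$ and let $(\rho,\{\hat P\},\{\hat Q\})$ be a strategy with value at least $1-\varepsilon$. Let $p_0$ be the probability of outcome $0$ when $\mathsf S$ is measured in the computational basis on $\rho$, and, if $p_0>0$, let $\rho_0$ be the resulting reduced state on $\mathcal R$. Then there are a finite-dimensional space $\mathcal R'$ and an isometry $V:\mathcal R\to(\mathbb C^2)^{\otimes n}\otimes\mathcal R'$ such that, if $p_0>0$, $$d_{\rho_0}(\hat P,\check P)\le C N^{\kappa}\varepsilon^{1/\kappa}\ \text{ for all }P\in\mathcal P_{n,k},\qquad d_{\rho_0}(\hat Q,\check Q)\le C N^{\kappa}\varepsilon^{1/\kappa}\ \text{ for all }Q\in\mathcal Q_{n,k},$$ where $\check P=V^*(P\otimes I)V$ and $\check Q^b=V^*\bigl(\prod_{P\in Q}\tfrac{I+(-1)^{b(P)}P}{2}\otimes I\bigr)V$. Furthermore $$\Bigl|p_0-\frac1{N+1}\Bigr|\le C N^{\kappa}\varepsilon^{1/\kappa}.$$ -/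

import Mathlib

open scoped Matrix Kronecker ComplexOrder

noncomputable section

namespace PauliGame

/-! ## Pauli operators of `XZ`-form -/

/-- The two non-identity letters of an `XZ`-form Pauli operator. -/
inductive XZ where
  | X : XZ
  | Z : XZ
  deriving DecidableEq

instance : Fintype XZ := ⟨{XZ.X, XZ.Z}, fun x => by cases x <;> simp⟩

/-- An (unsigned) `XZ`-form Pauli operator on `n` qubits: one letter for each qubit,
`none` being the identity. -/
abbrev PauliString (n : ℕ) : Type := Fin n → Option XZ

/-- The set of qubits on which the operator acts non-trivially. -/
def support {n : ℕ} (P : PauliString n) : Finset (Fin n) :=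
  Finset.univ.filter fun u => P u ≠ none

/-- The single-qubit matrices `I`, `X`, `Z`. -/
def letterMatrix : Option XZ → Matrix (Fin 2) (Fin 2) ℂ
  | none => 1
  | some XZ.X => !![0, 1; 1, 0]
  | some XZ.Z => !![1, 0; 0, -1]

/-- The matrix of a Pauli string on `(ℂ²)^{⊗ n}` (with basis indexed by `Fin n → Fin 2`):
the tensor product of the matrices of its letters. -/
def pauliMatrix {n : ℕ} (P : PauliString n) : Matrix (Fin n → Fin 2) (Fin n → Fin 2) ℂ :=
  Matrix.of fun x y => ∏ u, letterMatrix (P u) (x u) (y u)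

/-- `Pauli_{n,k}`: the `XZ`-form Pauli operators on `n` qubits of weight at most `k`. -/
abbrev Pauli (n k : ℕ) : Type := {P : PauliString n // (support P).card ≤ k}

/-- `Power_{n,k}`: the sets of `k` pairwise commuting operators in `Pauli_{n,k}`, all of them
acting on a common set `J` of `k` qubits. -/
abbrev MultiPauli (n k : ℕ) : Type :=
  {Q : Finset (Pauli n k) // Q.card = k ∧
    (∀ P ∈ Q, ∀ P' ∈ Q, Commute (pauliMatrix P.1) (pauliMatrix P'.1)) ∧
    ∃ J : Finset (Fin n), J.card = k ∧ ∀ P ∈ Q, support P.1 ⊆ J}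

/-- The weight-one operator `D_u`. -/
def weightOne {n k : ℕ} [NeZero k] (u : Fin n) (D : XZ) : Pauli n k :=
  ⟨fun v => if v = u then some D else none, by
    have h : support (fun v : Fin n => if v = u then some D else none) ⊆ {u} := by
      intro v hv
      by_contra hne
      simp [support] at hv hne
      exact hne hv
    calc _ ≤ ({u} : Finset (Fin n)).card := Finset.card_le_card h
      _ = 1 := Finset.card_singleton u
      _ ≤ k := NeZero.one_le⟩

/-! ## Labels, the constraint system, and the sequence of reflections -/

/-- The labels of the edges of the propagation graph: a reflection `P`, a derived reflection
`P|Q` with `P ∈ Q`, or a controlled reflection `Λ_c(P)`. The `2n` control qubits are named by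
pairs `(u, D)` with `u` a qubit and `D ∈ {X, Z}`. -/
inductive Label (n k : ℕ) where
  | single (P : Pauli n k) : Label n k
  | derived (Q : MultiPauli n k) (P : Q.1) : Label n k
  | controlled (c : Fin n × XZ) (P : Pauli n k) : Label n k

/-- The label `D_u`. -/
def one {n k : ℕ} [NeZero k] (D : XZ) (u : Fin n) : Label n k := Label.single (weightOne u D)

/-- The factors `D_v`, for `v` in the support of `P` in increasing order, of
`P = ∏_v D_v`. -/
def factors {n k : ℕ} [NeZero k] (P : Pauli n k) : List (Label n k) :=
  (List.finRange n).filterMap fun v => (P.1 v).map fun D => one D v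

/-- A constraint `U₁ U₂ ⋯ U_r = (-1)^sign I`. -/
structure Constraint (n k : ℕ) where
  word : List (Label n k)
  sign : Fin 2

/-- The constraints of the `(n,k)`-constraint system. -/
inductive IsConstraint {n k : ℕ} [NeZero k] : Constraint n k → Prop
  | commute (u v : Fin n) (huv : u ≠ v) (D E : XZ) :
      IsConstraint ⟨[one D u, one E v, one D u, one E v], 0⟩
  | anticommute (u : Fin n) :
      IsConstraint ⟨[one XZ.X u, one XZ.Z u, one XZ.X u, one XZ.Z u], 1⟩
  | conjugate (u v : Fin n) (E : XZ) :
      IsConstraint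
        ⟨[one E v, one XZ.X u, one XZ.Z u, one XZ.X u, one XZ.Z u, one E v], 1⟩
  | product (P : Pauli n k) :
      IsConstraint ⟨Label.single P :: factors P, 0⟩
  | consistent (Q : MultiPauli n k) (P : Q.1) :
      IsConstraint ⟨[Label.derived Q P, Label.single P.1], 0⟩

/-- Primitive sequences: weight-one Pauli operators, length at most `k`. -/
def IsPrimitiveSeq {n k : ℕ} [NeZero k] (s : List (Label n k)) : Prop :=
  s.length ≤ k ∧ ∀ x ∈ s, ∃ D u, x = one D u

/-- Derived sequences: labels `P|Q` for one fixed `Q`, length at most `k`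
(the empty sequence included). -/
def IsDerivedSeq {n k : ℕ} (s : List (Label n k)) : Prop :=
  s.length ≤ k ∧ (s = [] ∨ ∃ Q : MultiPauli n k, ∀ x ∈ s, ∃ P : Q.1, x = Label.derived Q P)

/-- The concatenations of a primitive and a derived sequence. -/
def IsPrefixSeq {n k : ℕ} [NeZero k] (s : List (Label n k)) : Prop :=
  ∃ p d : List (Label n k), IsPrimitiveSeq p ∧ IsDerivedSeq d ∧ s = p ++ d

/-- An order in which the constraints `C_1, …, C_m` and the sequences `𝔔_1, …, 𝔔_L` are listed,
each exactly once, the empty sequence being `𝔔_1`. -/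
structure Listing (n k : ℕ) [NeZero k] where
  constraints : List (Constraint n k)
  constraints_nodup : constraints.Nodup
  mem_constraints : ∀ c, c ∈ constraints ↔ IsConstraint c
  seqs : List (List (Label n k))
  seqs_nodup : seqs.Nodup
  mem_seqs : ∀ s, s ∈ seqs ↔ IsPrefixSeq s
  head_seqs : seqs.head? = some []

namespace Listing

variable {n k : ℕ} [NeZero k] (E : Listing n k)

/-- The sequence `𝔙_{n,k}` of all reflections in `C_1, …, C_m`. -/
def seqV : List (Label n k) := E.constraints.flatMap Constraint.word

/-- The sequence `𝔚`: for each qubit `u`, the sequence `𝔙`, the controlled `X_u`, the sequence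
`𝔙`, the controlled `Z_u`. -/
def seqW : List (Label n k) :=
  (List.finRange n).flatMap fun u =>
    E.seqV ++ [Label.controlled (u, XZ.X) (weightOne u XZ.X)] ++
    E.seqV ++ [Label.controlled (u, XZ.Z) (weightOne u XZ.Z)]

/-- The sequence `𝔘`: the concatenation of `𝔔_l, 𝔚, 𝔚^*, 𝔔_l^*` over `l`. -/
def seqU : List (Label n k) :=
  E.seqs.flatMap fun q => q ++ E.seqW ++ E.seqW.reverse ++ q.reverse

/-- The length `N` of `𝔘`; the clock takes the values `0, …, N`. -/
def N : ℕ := E.seqU.length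

/-- The vertex `N_j^{i,l}` (with `l` counted from `0`), at which, in the `i`-th occurrence of `𝔙`
in the forward part of the `l`-th block of `𝔘`, the first `j` constraints have been applied. -/
def vertex (l i j : ℕ) : ℕ :=
  ((E.seqs.take l).map fun q => 2 * (E.seqW.length + q.length)).sum
    + ((E.seqs[l]?).getD []).length
    + i * (E.seqV.length + 1)
    + ((E.constraints.take j).map fun c => c.word.length).sum

end Listing

/-! ## Operators of the referee -/

/-- The clock basis vector `|t⟩`. -/
def ket (N t : ℕ) : Fin (N + 1) → ℂ := fun s => if (s : ℕ) = t then 1 else 0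

/-- `Π_e^a` for the edge `e = (u, v)` and `a ∈ {0, 1}`: the projection onto
`(|u⟩ + (-1)^a |v⟩) / √2`. -/
def edgeProj (N u v : ℕ) (a : Fin 2) : Matrix (Fin (N + 1)) (Fin (N + 1)) ℂ :=
  (1 / 2 : ℂ) • Matrix.vecMulVec (ket N u + (-1 : ℂ) ^ (a : ℕ) • ket N v)
    (star (ket N u + (-1 : ℂ) ^ (a : ℕ) • ket N v))

/-- `Π_e^2 = I - Π_e^0 - Π_e^1`. -/
def edgeRest (N u v : ℕ) : Matrix (Fin (N + 1)) (Fin (N + 1)) ℂ :=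
  1 - edgeProj N u v 0 - edgeProj N u v 1

/-- Basis of the control register of `2n` qubits. -/
abbrev Ctrl (n : ℕ) : Type := Fin n × XZ → Fin 2

/-- `|b⟩⟨b|` on the control qubit `c`. -/
def ctrlZ {n : ℕ} (c : Fin n × XZ) (b : Fin 2) : Matrix (Ctrl n) (Ctrl n) ℂ :=
  Matrix.diagonal fun x => if x c = b then 1 else 0

/-- Pauli `X` on the control qubit `c`. -/
def ctrlX {n : ℕ} (c : Fin n × XZ) : Matrix (Ctrl n) (Ctrl n) ℂ :=
  Matrix.of fun x y => if x = Function.update y c (1 - y c) then 1 else 0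

/-- The measurement operator `(I + (-1)^a R) / 2`. -/
def reflProj {ι : Type*} [DecidableEq ι] (R : Matrix ι ι ℂ) (a : Fin 2) : Matrix ι ι ℂ :=
  (1 / 2 : ℂ) • (1 + (-1 : ℂ) ^ (a : ℕ) • R)

/-! ## Strategies and their value -/

/-- A strategy of the player with private space `ℂ^d`: a state shared by the clock register, the
control register and the player, a reflection for each `P`, and a projective measurement with
outcomes `b : Q → {0, 1}` for each `Q`. -/
structure Strategy {n k : ℕ} [NeZero k] (E : Listing n k) (d : ℕ) where
  ρ : Matrix (Fin (E.N + 1) × Ctrl n × Fin d) (Fin (E.N + 1) × Ctrl n × Fin d) ℂ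
  ρ_pos : ρ.PosSemidef
  ρ_trace : ρ.trace = 1
  refl : Pauli n k → Matrix (Fin d) (Fin d) ℂ
  refl_herm : ∀ P, (refl P).IsHermitian
  refl_sq : ∀ P, refl P * refl P = 1
  meas : (Q : MultiPauli n k) → (Q.1 → Fin 2) → Matrix (Fin d) (Fin d) ℂ
  meas_herm : ∀ Q b, (meas Q b).IsHermitian
  meas_idem : ∀ Q b, meas Q b * meas Q b = meas Q b
  meas_sum : ∀ Q, ∑ b, meas Q b = 1

namespace Strategy

variable {n k : ℕ} [NeZero k] {E : Listing n k} {d : ℕ} (S : Strategy E d)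

/-- `tr_ρ (A ⊗ B ⊗ M)`, for `A` on the clock, `B` on the control register, `M` on the player. -/
def prob (A : Matrix (Fin (E.N + 1)) (Fin (E.N + 1)) ℂ) (B : Matrix (Ctrl n) (Ctrl n) ℂ)
    (M : Matrix (Fin d) (Fin d) ℂ) : ℝ :=
  ((A ⊗ₖ (B ⊗ₖ M)) * S.ρ).trace.re

/-- Acceptance probability of the propagation game when the edge `(u, v)`, with the given label,
has been sampled. For a controlled reflection the referee accepts if the outcome `t` of `Π_e` is
`2`, or the control bit is `0` and `t = 0`, or the control bit is `1` and `t` is the answer. -/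
def edgeAccept (u v : ℕ) : Label n k → ℝ
  | Label.single P =>
      ∑ a : Fin 2, S.prob (edgeRest E.N u v + edgeProj E.N u v a) 1 (reflProj (S.refl P) a)
  | Label.derived Q P =>
      ∑ b : Q.1 → Fin 2, S.prob (edgeRest E.N u v + edgeProj E.N u v (b P)) 1 (S.meas Q b)
  | Label.controlled c P =>
      ∑ a : Fin 2, (S.prob (edgeRest E.N u v) 1 (reflProj (S.refl P) a)
        + S.prob (edgeProj E.N u v 0) (ctrlZ c 0) (reflProj (S.refl P) a)
        + S.prob (edgeProj E.N u v a) (ctrlZ c 1) (reflProj (S.refl P) a))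

/-- Acceptance probability of the propagation check: a uniformly random edge `(i, i + 1)`. -/
def propagationCheck : ℝ :=
  (1 / (E.N : ℝ)) * ∑ i : Fin E.N, S.edgeAccept (i : ℕ) ((i : ℕ) + 1) (E.seqU.get i)

/-- Acceptance probability of the initialization check: accept if the clock is not `0`, otherwise
measure `X` on a uniformly random control qubit and accept on outcome `0`. -/
def initializationCheck : ℝ :=
  S.prob (1 - Matrix.vecMulVec (ket E.N 0) (star (ket E.N 0))) 1 1
    + (1 / (2 * n : ℝ)) * ∑ c : Fin n × XZ,
        S.prob (Matrix.vecMulVec (ket E.N 0) (star (ket E.N 0))) (reflProj (ctrlX c) 0) 1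

/-- Acceptance probability of the constraint check: uniformly random `i ∈ {0, …, 2n - 1}`,
sequence `l`, and edge `(N_j^{i,l}, N_{j+1}^{i,l})`. -/
def constraintCheck : ℝ :=
  (1 / ((2 * n) * E.seqs.length * E.constraints.length : ℝ)) *
    ∑ i : Fin (2 * n), ∑ l : Fin E.seqs.length, ∑ j : Fin E.constraints.length,
      S.prob (edgeRest E.N (E.vertex l i j) (E.vertex l i ((j : ℕ) + 1))
        + edgeProj E.N (E.vertex l i j) (E.vertex l i ((j : ℕ) + 1)) (E.constraints.get j).sign) 1 1

/-- The value of the strategy: each of the three checks is played with probability `1/3`. -/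
def value : ℝ :=
  (1 / 3) * (S.propagationCheck + S.initializationCheck + S.constraintCheck)

/-- The block `tr_X (⟨0| ρ |0⟩)` of the state at clock value `0`. -/
def zeroBlock : Matrix (Fin d) (Fin d) ℂ :=
  Matrix.of fun r s => ∑ x : Ctrl n, S.ρ (0, x, r) (0, x, s)

/-- The probability `p₀` that measuring the clock gives `0`. -/
def p₀ : ℝ := S.zeroBlock.trace.re

/-- The state `ρ₀` of the player after the clock has been measured with outcome `0`. -/
def ρ₀ : Matrix (Fin d) (Fin d) ℂ := ((S.p₀ : ℂ)⁻¹) • S.zeroBlock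

end Strategy

/-! ## Distances, and the honest measurements behind an isometry -/

/-- The distance `[1 - Re tr_ρ (R₀ R₁)]^{1/2}` of reflections. -/
def reflDist {d : ℕ} (ρ R₀ R₁ : Matrix (Fin d) (Fin d) ℂ) : ℝ :=
  √(1 - (R₀ * R₁ * ρ).trace.re)

/-- The distance of two POVMs: the infimum of `[∑_a ‖N₀^a - N₁^a‖_ρ²]^{1/2}` over all measurement
operators with `M_i^a = (N_i^a)^* N_i^a`, where `‖T‖_ρ² = tr_ρ (T^* T)`. -/
def povmDist {d : ℕ} {Ω : Type*} [Fintype Ω] (ρ : Matrix (Fin d) (Fin d) ℂ)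
    (M₀ M₁ : Ω → Matrix (Fin d) (Fin d) ℂ) : ℝ :=
  sInf {r : ℝ | ∃ (m : ℕ) (N₀ N₁ : Ω → Matrix (Fin m) (Fin d) ℂ),
    (∀ a, (N₀ a)ᴴ * N₀ a = M₀ a) ∧ (∀ a, (N₁ a)ᴴ * N₁ a = M₁ a) ∧
    r = √(∑ a, (((N₀ a - N₁ a)ᴴ * (N₀ a - N₁ a)) * ρ).trace.re)}

/-- `V^* (A ⊗ I) V` for `V : ℂ^d → (ℂ²)^{⊗ n} ⊗ ℂ^{d'}`. -/
def pullback {n d d' : ℕ} (V : Matrix ((Fin n → Fin 2) × Fin d') (Fin d) ℂ)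
    (A : Matrix (Fin n → Fin 2) (Fin n → Fin 2) ℂ) : Matrix (Fin d) (Fin d) ℂ :=
  Vᴴ * (A ⊗ₖ (1 : Matrix (Fin d') (Fin d') ℂ)) * V

/-- The joint measurement operator `∏_{P ∈ Q} (I + (-1)^{b_P} P) / 2` of the commuting Pauli
operators in `Q` (as they commute, the order of the factors plays no role). -/
def jointProj {n k : ℕ} (Q : MultiPauli n k) (b : Q.1 → Fin 2) :
    Matrix (Fin n → Fin 2) (Fin n → Fin 2) ℂ :=
  (Q.1.attach.toList.map fun P => reflProj (pauliMatrix P.1.1) (b P)).prod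

end PauliGame

end

noncomputable section
set_option linter.unusedSectionVars false

namespace PauliGame

/-! ## Tensor products of matrices -/

/-! Completeness. The honest player holds Pauli operators on `n` qubits, and the clock carries the
history state of the sequence `𝔘` started from a uniform control register. All constraints are
identities between Pauli matrices, so every check accepts (`honestStrategy_value`). No strategy
exceeds `1`, because one minus the value is a nonnegative combination of squared norms
(`Strategy.value_eq`).

Soundness. Write `ρ = G Gᴴ` and let `Ψ t` be the component of this purification at clock value `t`.
Each rejection probability is a multiple of some `‖Ψ s - U (Ψ t)‖ ^ 2`, so a value of at least `1 -
ε` bounds every such distance by `δ = √(12 N³ ε)` (`Strategy.approxClock`). The initialization check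
makes `Ψ 0` nearly a product `uniform ψ` of a uniform control register and a player vector `ψ`.
Propagation and constraint checks together show that every constraint word acts as its sign at the
start of each copy of `𝔙`. Earlier blocks of `𝔘` cancel, since each is a palindrome of involutions,
and a copy of `𝔙` acts as a sign. Hence the constraints hold approximately on `ψ`, after any prefix
`𝔔_l`, before and after every controlled reflection (`ApproxClock.exists_good`).

The isometry `spread` attaches a uniform control register and applies the controlled `X_u` and
`Z_u`. A letter `D_u` placed before these gates passes the other qubits by commutation. At its own
control bit it becomes a flip, which the uniform register absorbs; `Z_u` passing the controlled
`X_u` also leaves a phase. So it turns into an encoded letter `enc (D, u)` on the control register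
(`Good.lam_mem`). A Clifford operation decodes `enc` into honest Pauli operators.

Relations that hold on one vector cannot be multiplied freely, and this is why the prefixes are
there. A word of encoded letters on `k` qubits is, up to sign, a product of distinct `X`s after
distinct `Z`s. It is therefore attained behind the isometry by a vector reached from `ψ` through a
prefix: the `Z`s as primitive letters, the `X`s as symbols `X_u|Q` for a single `Q`
(`AllLegit.exists_near`). At that vector the relations hold again, so each further letter costs an
additive error depending on `k` times the basic one (`AllLegit.spread_letter`,
`AllLegit.spread_derived`). Expanding a product of spectral projections into words settles the
measurements (`AllLegit.spread_prod_eigenProj`).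

Both distances are norms of the defects of `P̂` and `Q̂` behind `V` on `Ψ 0`, divided by `√p₀`.
Propagation is by isometries, so all `‖Ψ t‖` nearly agree and `p₀` is near `1 / (N + 1)`. If the
error is too large for this to bound `p₀` below, the claimed bounds are trivial. -/

/-- The tensor product of a family of matrices. -/
def tens {ι α β : Type*} [Fintype ι] (m : ι → Matrix α β ℂ) : Matrix (ι → α) (ι → β) ℂ :=
  Matrix.of fun x y => ∏ u, m u (x u) (y u)

section Tens

variable {ι α β γ : Type*} [Fintype ι] [DecidableEq ι] [Fintype β]

theorem tens_mul (m : ι → Matrix α β ℂ) (m' : ι → Matrix β γ ℂ) :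
    tens m * tens m' = tens fun u => m u * m' u := by
  ext x y
  simp only [tens, Matrix.mul_apply, Matrix.of_apply, ← Finset.prod_mul_distrib]
  rw [Finset.prod_univ_sum, Fintype.piFinset_univ]

theorem tens_conjTranspose (m : ι → Matrix α β ℂ) : (tens m)ᴴ = tens fun u => (m u)ᴴ := by
  ext x y
  simp [tens, Matrix.conjTranspose_apply]

theorem tens_one [DecidableEq α] : tens (fun _ : ι => (1 : Matrix α α ℂ)) = 1 := by
  ext x y
  simp only [tens, Matrix.of_apply, Matrix.one_apply]
  by_cases h : x = y
  · simp [h]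
  · obtain ⟨u, hu⟩ := Function.ne_iff.mp h
    rw [if_neg h]
    exact Finset.prod_eq_zero (Finset.mem_univ u) (by simp [hu])

/-- A tensor product is linear in each factor, so a sign in one factor comes out. This lifts the
anticommutation of the letters `X` and `Z` to `n` qubits. -/
theorem tens_eq_neg {m m' : ι → Matrix α β ℂ} (u : ι) (hu : m u = -m' u)
    (h : ∀ v, v ≠ u → m v = m' v) : tens m = -tens m' := by
  ext x y
  simp only [tens, Matrix.of_apply, Matrix.neg_apply]
  rw [← Finset.mul_prod_erase _ _ (Finset.mem_univ u),
    ← Finset.mul_prod_erase _ (fun v => m' v (x v) (y v)) (Finset.mem_univ u), hu]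
  rw [Finset.prod_congr rfl fun v hv => by rw [h v (Finset.ne_of_mem_erase hv)]]
  simp

/-- The tensor product that acts as `m` on the site `u` and trivially elsewhere. -/
def site [DecidableEq α] (u : ι) (m : Matrix α α ℂ) : Matrix (ι → α) (ι → α) ℂ :=
  tens fun v => if v = u then m else 1

theorem site_mul_site [DecidableEq β] (u : ι) (m m' : Matrix β β ℂ) :
    site u m * site u m' = site u (m * m') := by
  unfold site
  rw [tens_mul]
  congr 1; funext v
  split_ifs <;> simp

theorem site_one [DecidableEq β] (u : ι) : site u (1 : Matrix β β ℂ) = 1 := by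
  unfold site
  simp [tens_one]

theorem site_neg [DecidableEq β] (u : ι) (m : Matrix β β ℂ) : site u (-m) = -site u m :=
  tens_eq_neg u (by simp) fun v hv => by simp [hv]

theorem site_comm [DecidableEq β] {u v : ι} (h : u ≠ v) (m m' : Matrix β β ℂ) :
    site u m * site v m' = site v m' * site u m := by
  unfold site
  rw [tens_mul, tens_mul]
  congr 1; funext w
  by_cases hu : w = u
  · subst hu; simp [h]
  · simp [hu]

end Tens

/-! ## Algebra of Pauli matrices -/

section Pauli

variable {n k : ℕ}

theorem letterMatrix_sq (o : Option XZ) : letterMatrix o * letterMatrix o = 1 := by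
  rcases o with _ | _ | _ <;> simp [letterMatrix, Matrix.one_fin_two]

theorem letterMatrix_herm (o : Option XZ) : (letterMatrix o)ᴴ = letterMatrix o := by
  rcases o with _ | _ | _
  · simp [letterMatrix]
  · ext i j; fin_cases i <;> fin_cases j <;> simp [letterMatrix]
  · ext i j; fin_cases i <;> fin_cases j <;> simp [letterMatrix]

theorem letterMatrix_anticomm : letterMatrix (some XZ.X) * letterMatrix (some XZ.Z) =
    -(letterMatrix (some XZ.Z) * letterMatrix (some XZ.X)) := by
  simp [letterMatrix]

theorem pauliMatrix_eq_tens (P : PauliString n) :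
    pauliMatrix P = tens fun u => letterMatrix (P u) := rfl

theorem pauliMatrix_sq (P : PauliString n) : pauliMatrix P * pauliMatrix P = 1 := by
  simp [pauliMatrix_eq_tens, tens_mul, letterMatrix_sq, tens_one]

theorem pauliMatrix_herm (P : PauliString n) : (pauliMatrix P).IsHermitian := by
  simp [Matrix.IsHermitian, pauliMatrix_eq_tens, tens_conjTranspose, letterMatrix_herm]

variable [NeZero k]

theorem pauliMatrix_weightOne (u : Fin n) (D : XZ) :
    pauliMatrix (weightOne (k := k) u D).1 = site u (letterMatrix (some D)) := by
  rw [pauliMatrix_eq_tens, site]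
  congr 1; funext v
  by_cases h : v = u <;> simp [weightOne, h, letterMatrix]

/-- The letters of a Pauli operator with the qubits they act on, in increasing order. -/
def letters (P : Pauli n k) : List (XZ × Fin n) :=
  (List.finRange n).filterMap fun v => (P.1 v).map fun D => (D, v)

theorem factors_eq (P : Pauli n k) : factors P = (letters P).map fun a => one a.1 a.2 := by
  simp only [factors, letters, List.map_filterMap, Option.map_map]
  rfl

theorem mem_support_of_mem_letters {P : Pauli n k} {a : XZ × Fin n} (h : a ∈ letters P) :
    a.2 ∈ support P.1 := by
  simp only [letters, List.mem_filterMap, Option.map_eq_some_iff] at h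
  obtain ⟨v, -, D, hD, rfl⟩ := h
  simp [support, hD]

/-- The letters sit on distinct qubits of the support. The bound by `k` makes them an admissible
primitive sequence. -/
theorem letters_length_le (P : Pauli n k) : (letters P).length ≤ k := by
  have hnd : ((letters P).map Prod.snd).Nodup := by
    have : (letters P).map Prod.snd = (List.finRange n).filter fun v => (P.1 v).isSome := by
      simp only [letters, List.map_filterMap, Option.map_map]
      rw [← List.filterMap_eq_filter]
      congr 1; funext v
      cases h : P.1 v <;> simp [Option.guard, h]
    rw [this]
    exact (List.nodup_finRange n).filter _
  have hsub : ((letters P).map Prod.snd).toFinset ⊆ support P.1 := by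
    intro v hv
    simp only [List.mem_toFinset, List.mem_map] at hv
    obtain ⟨a, ha, rfl⟩ := hv
    exact mem_support_of_mem_letters ha
  calc (letters P).length = ((letters P).map Prod.snd).toFinset.card := by
        rw [List.toFinset_card_of_nodup hnd, List.length_map]
    _ ≤ _ := Finset.card_le_card hsub
    _ ≤ k := P.2

theorem prod_letters (P : Pauli n k) :
    ((letters P).map fun a => site a.2 (letterMatrix (some a.1))).prod = pauliMatrix P.1 := by
  -- The induction runs over sublists of the qubits, with the identity on the qubits that are not
  -- listed.
  have key : ∀ l : List (Fin n), l.Nodup →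
      ((l.filterMap fun v => (P.1 v).map fun D => (D, v)).map
        fun a => site a.2 (letterMatrix (some a.1))).prod =
      tens fun v => if v ∈ l then letterMatrix (P.1 v) else 1 := by
    intro l
    induction l with
    | nil => simp [tens_one]
    | cons v l ih =>
      intro hl
      rw [List.nodup_cons] at hl
      have h1 : tens (fun w => if w ∈ v :: l then letterMatrix (P.1 w) else 1) =
          site v (letterMatrix (P.1 v)) * tens fun w => if w ∈ l then letterMatrix (P.1 w) else 1 := by
        rw [site, tens_mul]
        congr 1; funext w
        by_cases hw : w = v
        · subst hw; simp [hl.1]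
        · simp [hw]
      rw [h1, ← ih hl.2]
      cases h : P.1 v with
      | none => simp [h, letterMatrix, site_one]
      | some D => simp [h]
  rw [letters, key _ (List.nodup_finRange n), pauliMatrix_eq_tens]
  simp

end Pauli

/-! ## The encoded Pauli operators on the control register -/

section Enc

variable {n : ℕ}

/-- The encoded letters on the two control bits of a qubit. -/
def encLetter : XZ → Matrix (Fin 2 × Fin 2) (Fin 2 × Fin 2) ℂ
  | XZ.X => letterMatrix (some XZ.X) ⊗ₖ 1
  | XZ.Z => letterMatrix (some XZ.Z) ⊗ₖ letterMatrix (some XZ.X)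

/-- The Clifford operation that turns encoded letters into letters of the first bit. -/
def decoder : Matrix (Fin 2 × Fin 2) (Fin 2 × Fin 2) ℂ :=
  Matrix.of fun p q => ((√2 : ℝ) : ℂ)⁻¹ *
    (if q.1 = p.1 + p.2 then (-1) ^ ((p.2 : ℕ) * (q.2 : ℕ)) else 0)

theorem decoder_isometry : decoderᴴ * decoder = 1 := by
  have h2 : ((√2 : ℝ) : ℂ)⁻¹ * ((√2 : ℝ) : ℂ)⁻¹ = 1 / 2 := by
    rw [← mul_inv, ← Complex.ofReal_mul, Real.mul_self_sqrt (by norm_num)]; norm_num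
  ext ⟨i, j⟩ ⟨i', j'⟩
  simp only [Matrix.mul_apply, Matrix.conjTranspose_apply, decoder, Matrix.of_apply,
    Fintype.sum_prod_type, Fin.sum_univ_two, Matrix.one_apply, star_mul', star_inv₀,
    Complex.star_def, Complex.conj_ofReal]
  fin_cases i <;> fin_cases j <;> fin_cases i' <;> fin_cases j' <;>
    simp [h2] <;> norm_num

/-- `decoder` is a Hadamard gate on the second bit followed by a CNOT from the second bit to the
first. Conjugation fixes `X ⊗ 1`, and sends `Z ⊗ X` first to `Z ⊗ Z` and then to `Z ⊗ 1`. -/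
theorem decoder_mul_encLetter (D : XZ) :
    decoder * encLetter D = (letterMatrix (some D) ⊗ₖ 1) * decoder := by
  ext ⟨i, j⟩ ⟨i', j'⟩
  cases D <;>
  simp only [Matrix.mul_apply, encLetter, letterMatrix, decoder, Matrix.of_apply,
    Fintype.sum_prod_type, Fin.sum_univ_two, Matrix.one_apply, Matrix.kroneckerMap_apply] <;>
  fin_cases i <;> fin_cases j <;> fin_cases i' <;> fin_cases j' <;>
    simp

end Enc
end PauliGame

namespace PauliGame

/-! ## Matrices and diagonal families acting on vector-valued functions -/

section MatrixAction

variable {X Y Z K : Type*} [Fintype X] [Fintype Y] [Fintype Z]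
  [NormedAddCommGroup K] [InnerProductSpace ℂ K]

/-- The action `B ⊗ 1` of a matrix on functions with values in `K`. -/
def mact (B : Matrix Y X ℂ) : PiLp 2 (fun _ : X => K) →ₗ[ℂ] PiLp 2 (fun _ : Y => K) where
  toFun v := WithLp.toLp 2 fun y => ∑ x, B y x • v x
  map_add' v w := by ext y; simp [Finset.sum_add_distrib]
  map_smul' c v := by ext y; simp [Finset.smul_sum, smul_comm c]

theorem mact_apply (B : Matrix Y X ℂ) (v : PiLp 2 (fun _ : X => K)) (y : Y) :
    mact B v y = ∑ x, B y x • v x := rfl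

theorem mact_mul (A : Matrix Z Y ℂ) (B : Matrix Y X ℂ) (v : PiLp 2 (fun _ : X => K)) :
    mact (A * B) v = mact A (mact B v) := by
  ext z
  simp only [mact_apply, Matrix.mul_apply, Finset.sum_smul, Finset.smul_sum, smul_smul]
  exact Finset.sum_comm

theorem mact_one [DecidableEq X] (v : PiLp 2 (fun _ : X => K)) :
    mact (1 : Matrix X X ℂ) v = v := by
  ext x
  simp [mact_apply, Matrix.one_apply]

theorem mact_add (A B : Matrix Y X ℂ) (v : PiLp 2 (fun _ : X => K)) :
    mact (A + B) v = mact A v + mact B v := by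
  ext y; simp [mact_apply, add_smul, Finset.sum_add_distrib]

theorem mact_sub (A B : Matrix Y X ℂ) (v : PiLp 2 (fun _ : X => K)) :
    mact (A - B) v = mact A v - mact B v := by
  ext y; simp [mact_apply, sub_smul]

theorem mact_smul (c : ℂ) (B : Matrix Y X ℂ) (v : PiLp 2 (fun _ : X => K)) :
    mact (c • B) v = c • mact B v := by
  ext y; simp [mact_apply, Finset.smul_sum, smul_smul]

theorem inner_mact (B : Matrix Y X ℂ) (v : PiLp 2 (fun _ : X => K))
    (w : PiLp 2 (fun _ : Y => K)) : inner ℂ (mact B v) w = inner ℂ v (mact Bᴴ w) := by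
  simp only [PiLp.inner_apply, mact_apply, sum_inner, inner_sum, inner_smul_left,
    inner_smul_right, Matrix.conjTranspose_apply]
  exact Finset.sum_comm

theorem norm_mact_sq (B : Matrix Y X ℂ) (v : PiLp 2 (fun _ : X => K)) :
    ‖mact B v‖ ^ 2 = (inner ℂ v (mact (Bᴴ * B) v)).re := by
  rw [mact_mul, ← inner_mact]
  exact norm_sq_eq_re_inner (𝕜 := ℂ) _

theorem norm_mact [DecidableEq X] {B : Matrix Y X ℂ} (h : Bᴴ * B = 1)
    (v : PiLp 2 (fun _ : X => K)) : ‖mact B v‖ = ‖v‖ := by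
  have h2 := norm_mact_sq B v
  rw [h, mact_one] at h2
  have h3 : (inner ℂ v v : ℂ).re = ‖v‖ ^ 2 := (norm_sq_eq_re_inner (𝕜 := ℂ) v).symm
  rw [h3] at h2
  exact (pow_left_inj₀ (norm_nonneg _) (norm_nonneg _) two_ne_zero).mp h2

/-- The linear isometry given by a matrix with orthonormal columns. -/
def isom [DecidableEq X] (B : Matrix Y X ℂ) (h : Bᴴ * B = 1) :
    PiLp 2 (fun _ : X => K) →ₗᵢ[ℂ] PiLp 2 (fun _ : Y => K) := ⟨mact B, norm_mact h⟩

@[simp] theorem isom_apply [DecidableEq X] (B : Matrix Y X ℂ) (h : Bᴴ * B = 1)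
    (v : PiLp 2 (fun _ : X => K)) : isom B h v = mact B v := rfl

end MatrixAction

section Diag

variable {X F : Type*} [Fintype X] [NormedAddCommGroup F] [NormedSpace ℂ F]

/-- A family of isometries controlled by the index. -/
def diag (f : X → F →ₗᵢ[ℂ] F) : PiLp 2 (fun _ : X => F) →ₗᵢ[ℂ] PiLp 2 (fun _ : X => F) where
  toFun v := WithLp.toLp 2 fun x => f x (v x)
  map_add' v w := by ext y; simp
  map_smul' c v := by ext y; simp
  norm_map' v := by simp [PiLp.norm_eq_of_L2]

@[simp] theorem diag_apply (f : X → F →ₗᵢ[ℂ] F) (v : PiLp 2 (fun _ : X => F)) (x : X) :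
    diag f v x = f x (v x) := rfl

theorem diag_mul (f g : X → F →ₗᵢ[ℂ] F) : diag f * diag g = diag fun x => f x * g x := by
  ext v x; simp

theorem diag_one : diag (fun _ : X => (1 : F →ₗᵢ[ℂ] F)) = 1 := by
  ext v x; simp

/-- Relabelling of the index by a permutation. -/
def permute (e : Equiv.Perm X) : PiLp 2 (fun _ : X => F) →ₗᵢ[ℂ] PiLp 2 (fun _ : X => F) where
  toFun v := WithLp.toLp 2 fun x => v (e x)
  map_add' v w := by ext y; simp
  map_smul' c v := by ext y; simp
  norm_map' v := by
    simp only [PiLp.norm_eq_of_L2]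
    congr 1
    exact Equiv.sum_comp e fun x => ‖v x‖ ^ 2

@[simp] theorem permute_apply (e : Equiv.Perm X) (v : PiLp 2 (fun _ : X => F)) (x : X) :
    permute e v x = v (e x) := rfl

/-- The constant function of the same norm as a given vector. -/
def uniform [Nonempty X] : F →ₗᵢ[ℂ] PiLp 2 (fun _ : X => F) where
  toFun v := WithLp.toLp 2 fun _ => ((√(Fintype.card X : ℝ) : ℝ) : ℂ)⁻¹ • v
  map_add' v w := by ext y; simp
  map_smul' c v := by ext y; simp [smul_comm c]
  norm_map' v := by
    have h : (0 : ℝ) < Fintype.card X := by exact_mod_cast Fintype.card_pos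
    simp only [LinearMap.coe_mk, AddHom.coe_mk, PiLp.norm_eq_of_L2, norm_smul, norm_inv,
      Complex.norm_real, Real.norm_eq_abs, Finset.sum_const, Finset.card_univ, nsmul_eq_mul,
      mul_pow, inv_pow, sq_abs, Real.sq_sqrt h.le]
    rw [mul_inv_cancel_left₀ h.ne', Real.sqrt_sq (norm_nonneg v)]

theorem uniform_apply [Nonempty X] (v : F) (x : X) :
    (uniform v : PiLp 2 (fun _ : X => F)) x = ((√(Fintype.card X : ℝ) : ℝ) : ℂ)⁻¹ • v := rfl

/-- Operators of the player alone preserve the product form, so estimates on `uniform φ` descend to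
estimates on `φ`. -/
theorem diag_const_uniform [Nonempty X] (f : F →ₗᵢ[ℂ] F) (v : F) :
    diag (fun _ : X => f) (uniform v) = uniform (f v) := by
  ext x; simp [uniform_apply]

theorem permute_uniform [Nonempty X] (e : Equiv.Perm X) (v : F) :
    permute e (uniform v) = uniform v := by
  ext x; simp [uniform_apply]

end Diag

/-! ## Reflections attached to labels -/

/-- The space of the control register and the player. -/
abbrev Space (n : ℕ) (F : Type*) : Type _ := PiLp 2 (fun _ : Ctrl n => F)

/-- Reflections on a space `F` for the symbols `P` and `P|Q`. -/
structure Reflections (n k : ℕ) (F : Type*) [NormedAddCommGroup F] [NormedSpace ℂ F] where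
  single : Pauli n k → F →ₗᵢ[ℂ] F
  derived : (Q : MultiPauli n k) → Q.1 → F →ₗᵢ[ℂ] F
  single_sq : ∀ P, single P * single P = 1
  derived_sq : ∀ Q P, derived Q P * derived Q P = 1

/-- Negation of a control bit. -/
def flipBit {n : ℕ} (c : Fin n × XZ) : Equiv.Perm (Ctrl n) :=
  Function.Involutive.toPerm (fun x => Function.update x c (1 - x c)) fun x => by
    ext d : 1
    by_cases h : d = c <;> simp [h]

theorem flipBit_apply {n : ℕ} (c : Fin n × XZ) (x : Ctrl n) :
    flipBit c x = Function.update x c (1 - x c) := rfl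

namespace Reflections

variable {n k : ℕ} {F : Type*} [NormedAddCommGroup F] [NormedSpace ℂ F] (R : Reflections n k F)

/-- The action of a label on the player's space, controlled labels being ignored. -/
def loc : Label n k → F →ₗᵢ[ℂ] F
  | Label.single P => R.single P
  | Label.derived Q P => R.derived Q P
  | Label.controlled _ _ => 1

/-- The action of a label on the control register and the player. -/
def act : Label n k → Space n F →ₗᵢ[ℂ] Space n F
  | Label.single P => diag fun _ => R.single P
  | Label.derived Q P => diag fun _ => R.derived Q P
  | Label.controlled c P => diag fun x => if x c = 1 then R.single P else 1

theorem act_sq (a : Label n k) : R.act a * R.act a = 1 := by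
  cases a with
  | single P => simp [act, diag_mul, R.single_sq, diag_one]
  | derived Q P => simp [act, diag_mul, R.derived_sq, diag_one]
  | controlled c P =>
    rw [act, diag_mul, ← diag_one]
    congr 1; funext x
    split_ifs <;> simp [R.single_sq]

/-- The product of the actions of the labels of a word. -/
def word (l : List (Label n k)) : Space n F →ₗᵢ[ℂ] Space n F := (l.map R.act).prod

/-- The product of the local actions of the labels of a word. -/
def locWord (l : List (Label n k)) : F →ₗᵢ[ℂ] F := (l.map R.loc).prod

@[simp] theorem word_nil : R.word [] = 1 := rfl

@[simp] theorem word_cons (a : Label n k) (l : List (Label n k)) :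
    R.word (a :: l) = R.act a * R.word l := by simp [word]

theorem word_append (l l' : List (Label n k)) : R.word (l ++ l') = R.word l * R.word l' := by
  simp [word]

@[simp] theorem locWord_nil : R.locWord [] = 1 := rfl

@[simp] theorem locWord_cons (a : Label n k) (l : List (Label n k)) :
    R.locWord (a :: l) = R.loc a * R.locWord l := by simp [locWord]

theorem word_reverse_mul (l : List (Label n k)) : R.word l.reverse * R.word l = 1 := by
  induction l with
  | nil => simp
  | cons a l ih =>
    rw [List.reverse_cons, word_append, word_cons, word_cons, word_nil, mul_one, mul_assoc,
      ← mul_assoc (R.act a), act_sq, one_mul, ih]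

theorem word_mul_reverse (l : List (Label n k)) : R.word l * R.word l.reverse = 1 := by
  simpa using R.word_reverse_mul l.reverse

/-- The label is not a controlled one. -/
def _root_.PauliGame.Label.IsLocal : Label n k → Prop
  | Label.controlled _ _ => False
  | _ => True

theorem act_of_isLocal {a : Label n k} (h : a.IsLocal) : R.act a = diag fun _ => R.loc a := by
  cases a <;> first | rfl | exact h.elim

theorem word_of_isLocal {l : List (Label n k)} (h : ∀ a ∈ l, a.IsLocal) :
    R.word l = diag fun _ => R.locWord l := by
  induction l with
  | nil => simp [diag_one]
  | cons a l ih =>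
    rw [word_cons, R.act_of_isLocal (h a (by simp)), ih fun b hb => h b (by simp [hb]), diag_mul]
    simp

theorem isLocal_of_isPrefixSeq [NeZero k] {q : List (Label n k)} (h : IsPrefixSeq q) :
    ∀ a ∈ q, a.IsLocal := by
  obtain ⟨p, d, ⟨-, hp⟩, ⟨-, hd⟩, rfl⟩ := h
  intro a ha
  rcases List.mem_append.mp ha with ha | ha
  · obtain ⟨D, u, rfl⟩ := hp a ha
    trivial
  · rcases hd with rfl | ⟨Q, hQ⟩
    · simp at ha
    · obtain ⟨P, rfl⟩ := hQ a ha
      trivial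

theorem isLocal_of_isConstraint [NeZero k] {c : Constraint n k} (h : IsConstraint c) :
    ∀ a ∈ c.word, a.IsLocal := by
  intro a ha
  cases h with
  | product P =>
    simp only [factors_eq, List.mem_cons, List.mem_map] at ha
    rcases ha with rfl | ⟨_, _, rfl⟩ <;> trivial
  | _ =>
    simp only [List.mem_cons, List.not_mem_nil, or_false] at ha
    rcases ha with rfl | rfl | rfl | rfl | rfl | rfl <;> trivial

/-- The pair of controlled letters of each qubit of the list, the last qubit first. -/
def lam [NeZero k] : List (Fin n) → (Space n F →ₗᵢ[ℂ] Space n F)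
  | [] => 1
  | u :: L => R.act (Label.controlled (u, XZ.Z) (weightOne u XZ.Z)) *
      (R.act (Label.controlled (u, XZ.X) (weightOne u XZ.X)) * lam L)

/-- All constraints hold on `χ` up to an error `e`. -/
def Sat [NeZero k] (e : ℝ) (χ : Space n F) : Prop :=
  ∀ c : Constraint n k, IsConstraint c → ‖R.word c.word χ - (-1 : ℂ) ^ (c.sign : ℕ) • χ‖ ≤ e

end Reflections

end PauliGame

namespace PauliGame

/-! ## The sequence of reflections along the clock -/

namespace Listing

variable {n k : ℕ} [NeZero k] (E : Listing n k)

/-- The part of the sequence that belongs to one prefix. -/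
def block (q : List (Label n k)) : List (Label n k) :=
  q ++ E.seqW ++ E.seqW.reverse ++ q.reverse

/-- The part of `𝔚` that belongs to one qubit. -/
def qubitBlock (u : Fin n) : List (Label n k) :=
  E.seqV ++ [Label.controlled (u, XZ.X) (weightOne u XZ.X)] ++
    E.seqV ++ [Label.controlled (u, XZ.Z) (weightOne u XZ.Z)]

theorem seqU_eq : E.seqU = E.seqs.flatMap E.block := rfl

theorem seqW_eq : E.seqW = (List.finRange n).flatMap E.qubitBlock := rfl

theorem block_length (q : List (Label n k)) :
    (E.block q).length = 2 * (E.seqW.length + q.length) := by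
  simp [block]; ring

theorem qubitBlock_length (u : Fin n) : (E.qubitBlock u).length = 2 * (E.seqV.length + 1) := by
  simp [qubitBlock]; ring

theorem flatMap_qubitBlock_length (L : List (Fin n)) :
    (L.flatMap E.qubitBlock).length = L.length * (2 * (E.seqV.length + 1)) := by
  simp [List.length_flatMap, qubitBlock_length]

theorem seqW_length : E.seqW.length = n * (2 * (E.seqV.length + 1)) := by
  rw [seqW_eq, flatMap_qubitBlock_length, List.length_finRange]

theorem exists_split {l : ℕ} (hl : l < E.seqs.length) :
    E.seqU = (E.seqs.take l).flatMap E.block ++ (E.block E.seqs[l] ++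
      (E.seqs.drop (l + 1)).flatMap E.block) := by
  have h : E.seqs = E.seqs.take l ++ (E.seqs[l] :: E.seqs.drop (l + 1)) := by simp
  conv_lhs => rw [seqU_eq, h, List.flatMap_append, List.flatMap_cons]

/-- The words of the first `j` constraints. -/
def firstWords (j : ℕ) : List (Label n k) := (E.constraints.take j).flatMap Constraint.word

theorem vertex_eq {l : ℕ} (hl : l < E.seqs.length) (i j : ℕ) :
    E.vertex l i j = ((E.seqs.take l).flatMap E.block).length + E.seqs[l].length
      + i * (E.seqV.length + 1) + (E.firstWords j).length := by
  simp [vertex, firstWords, List.length_flatMap, block_length, hl]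

theorem firstWords_zero : E.firstWords 0 = [] := rfl

theorem firstWords_length : E.firstWords E.constraints.length = E.seqV := by
  simp [firstWords, seqV]

theorem firstWords_succ {j : ℕ} (hj : j < E.constraints.length) :
    E.firstWords (j + 1) = E.firstWords j ++ E.constraints[j].word := by
  rw [firstWords, firstWords, List.take_succ_eq_append_getElem hj, List.flatMap_append]
  simp

theorem seqV_split {j : ℕ} (hj : j < E.constraints.length) :
    E.seqV = E.firstWords j ++ (E.constraints[j].word ++
      (E.constraints.drop (j + 1)).flatMap Constraint.word) := by
  have h : E.constraints = E.constraints.take j ++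
    (E.constraints[j] :: E.constraints.drop (j + 1)) := by simp
  conv_lhs => rw [seqV, h, List.flatMap_append, List.flatMap_cons]
  rfl

theorem word_length_pos {c : Constraint n k} (h : IsConstraint c) : 0 < c.word.length := by
  cases h <;> simp

/-- Each constraint has a nonempty word. Bounding all numbers of sampled choices by powers of `N`
later turns the average rejection probability into a bound for every single choice. -/
theorem constraints_length_le : E.constraints.length ≤ E.seqV.length := by
  rw [seqV, List.length_flatMap]
  have : ∀ C : List (Constraint n k), (∀ c ∈ C, 0 < c.word.length) →
      C.length ≤ (C.map fun c => c.word.length).sum := by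
    intro C
    induction C with
    | nil => simp
    | cons c C ih =>
      intro h
      have h1 := ih fun d hd => h d (by simp [hd])
      have h2 := h c (by simp)
      simp only [List.length_cons, List.map_cons, List.sum_cons]
      omega
  exact this _ fun c hc => word_length_pos ((E.mem_constraints c).mp hc)

theorem seqs_length_pos : 0 < E.seqs.length := by
  have := E.head_seqs
  rcases h : E.seqs with _ | ⟨a, l⟩
  · simp [h] at this
  · simp

theorem block_length_le {l : ℕ} (hl : l < E.seqs.length) :
    ((E.seqs.take l).flatMap E.block).length + 2 * (E.seqW.length + E.seqs[l].length) ≤ E.N := by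
  rw [N, E.exists_split hl]
  simp only [List.length_append, block_length]
  omega

theorem seqW_length_le : 2 * E.seqW.length ≤ E.N := by
  have := E.block_length_le E.seqs_length_pos
  omega

theorem constraints_length_le_N [NeZero n] : E.constraints.length ≤ E.N := by
  have h1 := E.constraints_length_le
  have h2 := E.seqW_length_le
  rw [seqW_length] at h2
  have h3 : 1 ≤ n := NeZero.one_le
  nlinarith

theorem two_mul_le_N : 2 * n ≤ E.N := by
  have h2 := E.seqW_length_le
  rw [seqW_length] at h2
  nlinarith [Nat.zero_le n, Nat.zero_le (n * E.seqV.length)]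

theorem N_pos [NeZero n] : 0 < E.N := by
  have h3 : 1 ≤ n := NeZero.one_le
  have := E.two_mul_le_N
  omega

theorem seqs_length_le_N [NeZero n] : E.seqs.length ≤ E.N := by
  have hW : 0 < E.seqW.length := by
    rw [seqW_length]
    have h3 : 1 ≤ n := NeZero.one_le
    positivity
  rw [N, seqU_eq, List.length_flatMap]
  have : ∀ C : List (List (Label n k)),
      C.length ≤ (C.map fun q => (E.block q).length).sum := by
    intro C
    induction C with
    | nil => simp
    | cons c C ih =>
      have h2 := E.block_length c
      simp only [List.length_cons, List.map_cons, List.sum_cons]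
      omega
  exact this _

theorem vertex_le_N {l : ℕ} (hl : l < E.seqs.length) {i : ℕ} (hi : i < 2 * n) {j : ℕ} :
    E.vertex l i j ≤ E.N := by
  have h1 := E.block_length_le hl
  have h2 : (E.firstWords j).length ≤ E.seqV.length := by
    have : E.seqV = E.firstWords j ++ (E.constraints.drop j).flatMap Constraint.word := by
      conv_lhs => rw [seqV, ← List.take_append_drop j E.constraints, List.flatMap_append]
      rfl
    rw [this, List.length_append]
    omega
  have h3 := E.seqW_length
  rw [E.vertex_eq hl]
  have h4 : (i + 1) * (E.seqV.length + 1) ≤ E.seqW.length := by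
    rw [h3]
    calc (i + 1) * (E.seqV.length + 1) ≤ (2 * n) * (E.seqV.length + 1) :=
          Nat.mul_le_mul_right _ hi
      _ = _ := by ring
  rw [add_mul] at h4
  omega

end Listing

/-! ## States that approximately pass the checks -/

/-- Clock blocks that pass the three checks up to an error `δ` for each of them. -/
structure ApproxClock {n k : ℕ} [NeZero k] {F : Type*} [NormedAddCommGroup F] [NormedSpace ℂ F]
    (R : Reflections n k F) (E : Listing n k) (δ : ℝ) (Ψ : ℕ → Space n F) : Prop where
  prop : ∀ (i : ℕ) (h : i < E.seqU.length), ‖Ψ i - R.act E.seqU[i] (Ψ (i + 1))‖ ≤ δ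
  init : ∀ c, ‖Ψ 0 - permute (flipBit c) (Ψ 0)‖ ≤ δ
  cons : ∀ i < 2 * n, ∀ l < E.seqs.length, ∀ (j : ℕ) (h : j < E.constraints.length),
    ‖Ψ (E.vertex l i j) - (-1 : ℂ) ^ (E.constraints[j].sign : ℕ) • Ψ (E.vertex l i (j + 1))‖ ≤ δ

/-! ### Transport along the clock and validity of the constraints -/

section Segments

variable {n k : ℕ} [NeZero k] {F : Type*} [NormedAddCommGroup F] [NormedSpace ℂ F]
  {R : Reflections n k F} {E : Listing n k} {δ : ℝ} {Ψ : ℕ → Space n F}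

/-- Along a segment of the sequence the clock blocks differ by the word of the segment. -/
theorem norm_sub_word_le (prop : ∀ (i : ℕ) (h : i < E.seqU.length),
      ‖Ψ i - R.act E.seqU[i] (Ψ (i + 1))‖ ≤ δ) (w : List (Label n k)) :
    ∀ pre post, E.seqU = pre ++ (w ++ post) →
      ‖Ψ pre.length - R.word w (Ψ (pre.length + w.length))‖ ≤ w.length * δ := by
  induction w with
  | nil => intro pre post _; simp
  | cons a w ih =>
    intro pre post h
    have h1 := ih (pre ++ [a]) post (by simp [h])
    have h2 := prop pre.length (by rw [h]; simp)
    have h3 : E.seqU[pre.length]'(by rw [h]; simp) = a := by simp [h]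
    rw [h3] at h2
    simp only [List.length_append, List.length_cons, List.length_nil, zero_add] at h1
    rw [Reflections.word_cons, LinearIsometry.coe_mul, Function.comp_apply]
    have h4 := (R.act a).norm_map (Ψ (pre.length + 1) - R.word w (Ψ (pre.length + 1 + w.length)))
    rw [map_sub] at h4
    have h5 : pre.length + (a :: w).length = pre.length + 1 + w.length := by
      simp only [List.length_cons]; ring
    rw [h5]
    calc _ ≤ ‖Ψ pre.length - R.act a (Ψ (pre.length + 1))‖ +
          ‖R.act a (Ψ (pre.length + 1)) - R.act a (R.word w (Ψ (pre.length + 1 + w.length)))‖ :=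
          norm_sub_le_norm_sub_add_norm_sub _ _ _
      _ ≤ δ + w.length * δ := by rw [h4]; gcongr
      _ = _ := by simp only [List.length_cons]; push_cast; ring

/-- A block is a palindrome of involutions and cancels from its middle. Hence earlier blocks leave
no trace, and every block starts again from `Ψ 0`. -/
theorem word_block (R : Reflections n k F) (q : List (Label n k)) : R.word (E.block q) = 1 := by
  rw [Listing.block, R.word_append, R.word_append, R.word_append, mul_assoc (R.word q),
    R.word_mul_reverse, mul_one, R.word_mul_reverse]

theorem word_flatMap_block (R : Reflections n k F) (C : List (List (Label n k))) :
    R.word (C.flatMap E.block) = 1 := by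
  induction C with
  | nil => rfl
  | cons q C ih => rw [List.flatMap_cons, R.word_append, word_block, ih, one_mul]

theorem Reflections.norm_word_reverse_sub (R : Reflections n k F) (w : List (Label n k))
    (a b : Space n F) : ‖R.word w.reverse a - b‖ = ‖a - R.word w b‖ := by
  rw [← (R.word w).norm_map (R.word w.reverse a - b), map_sub, ← Function.comp_apply (f := R.word w),
    ← LinearIsometry.coe_mul, R.word_mul_reverse]
  rfl

theorem Reflections.norm_act_sub (R : Reflections n k F) (a : Label n k) (x y : Space n F) :
    ‖R.act a x - y‖ = ‖x - R.act a y‖ := by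
  rw [← (R.act a).norm_map (R.act a x - y), map_sub, ← Function.comp_apply (f := R.act a),
    ← LinearIsometry.coe_mul, R.act_sq]
  rfl

theorem norm_neg_one_pow_smul {H : Type*} [NormedAddCommGroup H] [NormedSpace ℂ H] (j : ℕ)
    (v : H) : ‖(-1 : ℂ) ^ j • v‖ = ‖v‖ := by
  simp [norm_smul]

theorem ApproxClock.nonneg (h : ApproxClock R E δ Ψ) [NeZero n] : 0 ≤ δ :=
  (norm_nonneg _).trans (h.init (0, XZ.X))

theorem sign_mul_self (j : ℕ) : (-1 : ℂ) ^ j * (-1 : ℂ) ^ j = 1 := by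
  rw [← mul_pow]; simp

/-- Within one copy of `𝔙` the clock blocks are equal up to a sign. -/
theorem ApproxClock.copy (h : ApproxClock R E δ Ψ) {l i : ℕ} (hl : l < E.seqs.length)
    (hi : i < 2 * n) {j : ℕ} (hj : j ≤ E.constraints.length) :
    ∃ s : ℕ, ‖Ψ (E.vertex l i 0) - (-1 : ℂ) ^ s • Ψ (E.vertex l i j)‖ ≤ j * δ := by
  induction j with
  | zero => exact ⟨0, by simp⟩
  | succ j ih =>
    obtain ⟨s, hs⟩ := ih (by omega)
    have h1 := h.cons i hi l hl j (by omega)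
    refine ⟨s + E.constraints[j].sign, ?_⟩
    rw [← norm_neg_one_pow_smul s, smul_sub, smul_smul, ← pow_add] at h1
    calc _ ≤ _ := norm_sub_le_norm_sub_add_norm_sub _ ((-1 : ℂ) ^ s • Ψ (E.vertex l i j)) _
      _ ≤ j * δ + δ := add_le_add hs h1
      _ = _ := by push_cast; ring

/-- The error `d` enters twice, once under the word, which is an isometry, and once in the bare
vector. The global sign is irrelevant. -/
theorem Reflections.Sat.of_near {e d : ℝ} {χ χ' : Space n F} (h : R.Sat e χ) (s : ℕ)
    (hd : ‖χ - (-1 : ℂ) ^ s • χ'‖ ≤ d) : R.Sat (e + 2 * d) χ' := by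
  intro c hc
  have h1 := h c hc
  set t := (-1 : ℂ) ^ (c.sign : ℕ)
  have h2 : ‖R.word c.word χ - (-1 : ℂ) ^ s • R.word c.word χ'‖ ≤ d := by
    rw [← map_smul, ← map_sub, LinearIsometry.norm_map]; exact hd
  have h3 : ‖t • χ - (-1 : ℂ) ^ s • t • χ'‖ ≤ d := by
    rw [smul_comm _ t, ← smul_sub, norm_neg_one_pow_smul]; exact hd
  rw [← norm_neg_one_pow_smul s, smul_sub]
  calc ‖(-1 : ℂ) ^ s • R.word c.word χ' - (-1 : ℂ) ^ s • t • χ'‖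
      ≤ ‖(-1 : ℂ) ^ s • R.word c.word χ' - R.word c.word χ‖ + (‖R.word c.word χ - t • χ‖ +
        ‖t • χ - (-1 : ℂ) ^ s • t • χ'‖) :=
        (norm_sub_le_norm_sub_add_norm_sub _ (R.word c.word χ) _).trans
          (add_le_add_right (norm_sub_le_norm_sub_add_norm_sub _ (t • χ) _) _)
    _ ≤ d + (e + d) := by rw [norm_sub_rev]; gcongr
    _ = _ := by ring

/-- At the start of a copy of `𝔙` all constraints hold. -/
theorem ApproxClock.sat [NeZero n] (h : ApproxClock R E δ Ψ) {l i : ℕ} (hl : l < E.seqs.length)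
    (hi : i < 2 * n)
    (hpre : ∃ pre post, E.seqU = pre ++ (E.seqV ++ post) ∧ pre.length = E.vertex l i 0) :
    R.Sat (4 * E.N * δ) (Ψ (E.vertex l i 0)) := by
  obtain ⟨pre, post, hU, hlen⟩ := hpre
  have hδ := h.nonneg
  intro c hc
  obtain ⟨j, hj, rfl⟩ := List.mem_iff_getElem.mp ((E.mem_constraints c).mpr hc)
  obtain ⟨s, hs⟩ := h.copy hl hi (j := j + 1) (by omega)
  have h1 := h.cons i hi l hl j hj
  have hpos : (pre ++ E.firstWords j).length = E.vertex l i j := by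
    rw [List.length_append, hlen, E.vertex_eq hl, E.vertex_eq hl, E.firstWords_zero]; simp
  have hpos' : (pre ++ E.firstWords j).length + E.constraints[j].word.length =
      E.vertex l i (j + 1) := by
    rw [hpos, E.vertex_eq hl, E.vertex_eq hl, E.firstWords_succ hj, List.length_append]; ring
  -- Propagation says that the word carries the block after the constraint to the block before it.
  -- The constraint check says that these blocks differ by the prescribed sign. So the word acts as
  -- this sign on the later block, and `copy` moves the relation back to the start of `𝔙`.
  have h2 := norm_sub_word_le h.prop E.constraints[j].word (pre ++ E.firstWords j)
    ((E.constraints.drop (j + 1)).flatMap Constraint.word ++ post)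
    (by conv_lhs => rw [hU, E.seqV_split hj]
        simp)
  rw [hpos', hpos] at h2
  set t := (-1 : ℂ) ^ (E.constraints[j].sign : ℕ)
  set χ := Ψ (E.vertex l i 0)
  set χ' := Ψ (E.vertex l i (j + 1))
  set w := R.word E.constraints[j].word
  have h3 : ‖w χ - (-1 : ℂ) ^ s • w χ'‖ ≤ (j + 1 : ℕ) * δ := by
    rw [← map_smul, ← map_sub, LinearIsometry.norm_map]; exact hs
  have h4 : ‖(-1 : ℂ) ^ s • t • χ' - t • χ‖ ≤ (j + 1 : ℕ) * δ := by
    rw [smul_comm _ t, ← smul_sub, norm_neg_one_pow_smul, norm_sub_rev]; exact hs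
  have h5 : ‖(-1 : ℂ) ^ s • w χ' - (-1 : ℂ) ^ s • t • χ'‖ ≤
      E.constraints[j].word.length * δ + δ := by
    rw [← smul_sub, norm_neg_one_pow_smul]
    refine (norm_sub_le_norm_sub_add_norm_sub _ (Ψ (E.vertex l i j)) _).trans ?_
    rw [norm_sub_rev]
    exact add_le_add h2 h1
  -- Two transports over `j + 1` constraint checks, the propagation over one word, and one
  -- constraint check.
  have hlen : 2 * (j + 1) + (E.constraints[j].word.length + 1) ≤ 4 * E.N := by
    have h6 := E.constraints_length_le_N
    have h7 : E.constraints[j].word.length ≤ E.N := by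
      rw [Listing.N, hU, E.seqV_split hj]; simp only [List.length_append]; omega
    have := E.N_pos
    omega
  calc _ ≤ (j + 1 : ℕ) * δ + ((E.constraints[j].word.length * δ + δ) + (j + 1 : ℕ) * δ) :=
        (norm_sub_le_norm_sub_add_norm_sub _ ((-1 : ℂ) ^ s • w χ') _).trans
          (add_le_add h3 ((norm_sub_le_norm_sub_add_norm_sub _ ((-1 : ℂ) ^ s • t • χ') _).trans
            (add_le_add h5 h4)))
    _ = ((2 * (j + 1) + (E.constraints[j].word.length + 1) : ℕ) : ℝ) * δ := by push_cast; ring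
    _ ≤ ((4 * E.N : ℕ) : ℝ) * δ := by gcongr
    _ = _ := by push_cast; ring

end Segments

end PauliGame

namespace PauliGame

/-! ### Constraints along the controlled reflections, on a product state -/

section Path

variable {n k : ℕ} [NeZero k] [NeZero n] {F : Type*} [NormedAddCommGroup F] [NormedSpace ℂ F]
  {R : Reflections n k F} {E : Listing n k} {δ : ℝ} {Ψ : ℕ → Space n F}

/-- From the start of a copy of `𝔙` over the controlled reflection that follows it. -/
theorem ApproxClock.step (h : ApproxClock R E δ Ψ) {l i : ℕ} (hl : l < E.seqs.length)
    (hi : i < 2 * n) {a : Label n k} {pre post : List (Label n k)}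
    (hU : E.seqU = pre ++ (E.seqV ++ ([a] ++ post))) (hlen : pre.length = E.vertex l i 0) :
    ∃ s : ℕ, ‖R.act a (Ψ (E.vertex l i 0)) - (-1 : ℂ) ^ s • Ψ (E.vertex l (i + 1) 0)‖ ≤
      (E.seqV.length + 1) * δ := by
  obtain ⟨s, hs⟩ := h.copy hl hi le_rfl
  have hpos : (pre ++ E.seqV).length = E.vertex l i E.constraints.length := by
    rw [List.length_append, hlen, E.vertex_eq hl, E.vertex_eq hl, E.firstWords_zero,
      E.firstWords_length]; simp
  have hpos' : (pre ++ E.seqV).length + [a].length = E.vertex l (i + 1) 0 := by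
    rw [hpos, E.vertex_eq hl, E.vertex_eq hl, E.firstWords_zero, E.firstWords_length]
    simp only [List.length_cons, List.length_nil]; ring
  have h2 := norm_sub_word_le h.prop [a] (pre ++ E.seqV) post (by rw [hU]; simp)
  rw [hpos', hpos] at h2
  refine ⟨s, ?_⟩
  rw [R.norm_act_sub, map_smul]
  rw [← norm_neg_one_pow_smul s, smul_sub] at h2
  have h3 : (E.constraints.length : ℝ) ≤ E.seqV.length := by
    exact_mod_cast E.constraints_length_le
  have hδ := h.nonneg
  calc _ ≤ E.constraints.length * δ + ([a].length : ℝ) * δ :=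
        (norm_sub_le_norm_sub_add_norm_sub _ _ _).trans (add_le_add hs h2)
    _ ≤ E.seqV.length * δ + 1 * δ := by gcongr; simp
    _ = _ := by ring

/-- The position of a qubit within a block of the sequence. -/
theorem Listing.exists_position {l : ℕ} (hl : l < E.seqs.length) {A B : List (Fin n)} {u : Fin n}
    (hAB : List.finRange n = A ++ u :: B) :
    ∃ pre post, E.seqU = pre ++ (E.qubitBlock u ++ post) ∧
      pre.length = E.vertex l (2 * A.length) 0 := by
  refine ⟨(E.seqs.take l).flatMap E.block ++ E.seqs[l] ++ A.flatMap E.qubitBlock,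
    B.flatMap E.qubitBlock ++ E.seqW.reverse ++ E.seqs[l].reverse ++
      (E.seqs.drop (l + 1)).flatMap E.block, ?_, ?_⟩
  · conv_lhs => rw [E.exists_split hl, Listing.block, E.seqW_eq, hAB]
    rw [E.seqW_eq, hAB]
    simp
  · rw [E.vertex_eq hl, E.firstWords_zero]
    simp only [List.length_append, E.flatMap_qubitBlock_length, List.length_nil]
    ring

theorem smul_trans {H : Type*} [NormedAddCommGroup H] [NormedSpace ℂ H] {a b c : H} {s t : ℕ}
    {d e : ℝ} (h : ‖a - (-1 : ℂ) ^ s • b‖ ≤ d) (h' : ‖b - (-1 : ℂ) ^ t • c‖ ≤ e) :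
    ‖a - (-1 : ℂ) ^ (s + t) • c‖ ≤ d + e := by
  rw [pow_add, ← smul_smul]
  refine (norm_sub_le_norm_sub_add_norm_sub _ ((-1 : ℂ) ^ s • b) _).trans (add_le_add h ?_)
  rwa [← smul_sub, norm_neg_one_pow_smul]

theorem smul_isometry {H H' : Type*} [NormedAddCommGroup H] [NormedSpace ℂ H]
    [NormedAddCommGroup H'] [NormedSpace ℂ H'] (f : H →ₗᵢ[ℂ] H') {a b : H} {s : ℕ}
    {d : ℝ} (h : ‖a - (-1 : ℂ) ^ s • b‖ ≤ d) : ‖f a - (-1 : ℂ) ^ s • f b‖ ≤ d := by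
  rwa [← map_smul, ← map_sub, LinearIsometry.norm_map]

/-- The clock blocks along `𝔚` within a block of the sequence. -/
theorem ApproxClock.along (h : ApproxClock R E δ Ψ) {l : ℕ} (hl : l < E.seqs.length)
    (A : List (Fin n)) : ∀ B u, List.finRange n = A ++ u :: B →
      (∃ s : ℕ, ‖R.lam A.reverse (R.word E.seqs[l].reverse (Ψ 0)) -
        (-1 : ℂ) ^ s • Ψ (E.vertex l (2 * A.length) 0)‖ ≤
          (((E.seqs.take l).flatMap E.block ++ E.seqs[l]).length +
            2 * A.length * (E.seqV.length + 1)) * δ) ∧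
      ∃ s : ℕ, ‖R.act (Label.controlled (u, XZ.X) (weightOne u XZ.X))
          (R.lam A.reverse (R.word E.seqs[l].reverse (Ψ 0))) -
        (-1 : ℂ) ^ s • Ψ (E.vertex l (2 * A.length + 1) 0)‖ ≤
          (((E.seqs.take l).flatMap E.block ++ E.seqs[l]).length +
            (2 * A.length + 1) * (E.seqV.length + 1)) * δ := by
  -- Passing from an even position to the following odd one is the same in both cases of the
  -- induction: a copy of `𝔙` contributes only a sign, and then the controlled `X_u` is applied.
  have extend : ∀ (A : List (Fin n)) B u, List.finRange n = A ++ u :: B →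
      (∃ s : ℕ, ‖R.lam A.reverse (R.word E.seqs[l].reverse (Ψ 0)) -
        (-1 : ℂ) ^ s • Ψ (E.vertex l (2 * A.length) 0)‖ ≤
          (((E.seqs.take l).flatMap E.block ++ E.seqs[l]).length +
            2 * A.length * (E.seqV.length + 1)) * δ) →
      ∃ s : ℕ, ‖R.act (Label.controlled (u, XZ.X) (weightOne u XZ.X))
          (R.lam A.reverse (R.word E.seqs[l].reverse (Ψ 0))) -
        (-1 : ℂ) ^ s • Ψ (E.vertex l (2 * A.length + 1) 0)‖ ≤
          (((E.seqs.take l).flatMap E.block ++ E.seqs[l]).length +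
            (2 * A.length + 1) * (E.seqV.length + 1)) * δ := by
    intro A B u hAB ⟨s, hs⟩
    obtain ⟨pre, post, hU, hlen⟩ := Listing.exists_position (E := E) hl hAB
    have hA : A.length < n := by
      have := congrArg List.length hAB
      simp at this; omega
    obtain ⟨t, ht⟩ := h.step hl (i := 2 * A.length) (by omega)
      (a := Label.controlled (u, XZ.X) (weightOne u XZ.X))
      (post := E.seqV ++ [Label.controlled (u, XZ.Z) (weightOne u XZ.Z)] ++ post)
      (by rw [hU]; simp [Listing.qubitBlock]) hlen
    refine ⟨s + t, (smul_trans (smul_isometry (R.act _) hs) ht).trans_eq ?_⟩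
    ring
  induction A using List.reverseRecOn with
  | nil =>
    intro B u hAB
    suffices h0 : _ from ⟨h0, extend [] B u hAB h0⟩
    refine ⟨0, ?_⟩
    have h1 := norm_sub_word_le h.prop ((E.seqs.take l).flatMap E.block ++ E.seqs[l]) []
      (E.seqW ++ E.seqW.reverse ++ E.seqs[l].reverse ++ (E.seqs.drop (l + 1)).flatMap E.block)
      (by conv_lhs => rw [E.exists_split hl, Listing.block]
          simp)
    -- The blocks before the `l`-th act as the identity, so only the prefix `𝔔_l` separates `Ψ 0`
    -- from the first copy of `𝔙`. The cancelled blocks still count towards the error.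
    rw [R.word_append, word_flatMap_block, one_mul, ← R.norm_word_reverse_sub] at h1
    have h2 : E.vertex l 0 0 = ((E.seqs.take l).flatMap E.block ++ E.seqs[l]).length := by
      rw [E.vertex_eq hl, E.firstWords_zero]; simp
    simpa [h2, Reflections.lam] using h1
  | append_singleton A v ih =>
    intro B u hAB
    suffices h0 : _ from ⟨h0, extend (A ++ [v]) B u hAB h0⟩
    have hAB' : List.finRange n = A ++ v :: (u :: B) := by simp [hAB]
    obtain ⟨-, s, hs⟩ := ih _ _ hAB'
    obtain ⟨pre, post, hU, hlen⟩ := Listing.exists_position (E := E) hl hAB'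
    have hA : A.length < n := by
      have := congrArg List.length hAB'
      simp at this; omega
    obtain ⟨t, ht⟩ := h.step hl (i := 2 * A.length + 1) (by omega)
      (a := Label.controlled (v, XZ.Z) (weightOne v XZ.Z))
      (pre := pre ++ E.seqV ++ [Label.controlled (v, XZ.X) (weightOne v XZ.X)])
      (post := post) (by rw [hU]; simp [Listing.qubitBlock])
      (by rw [List.length_append, List.length_append, hlen, E.vertex_eq hl, E.vertex_eq hl]
          simp only [List.length_singleton]; ring)
    have h1 := smul_trans (smul_isometry (R.act _) hs) ht
    have h2 : E.vertex l (2 * A.length + 1 + 1) 0 = E.vertex l (2 * (A ++ [v]).length) 0 := by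
      rw [List.length_append, List.length_singleton]; rfl
    rw [h2] at h1
    refine ⟨s + t, ?_⟩
    rw [List.reverse_append]
    refine le_trans (le_of_eq ?_) (h1.trans_eq ?_)
    · rfl
    · simp only [List.length_append, List.length_singleton]
      push_cast; ring

/-- The first clock block is close to a uniform superposition on the control register. -/
theorem exists_uniform_near {φ : Space n F} (hδ : 0 ≤ δ)
    (h : ∀ c, ‖φ - permute (flipBit c) φ‖ ≤ δ) :
    ∃ ψ : F, ‖φ - uniform ψ‖ ≤ 2 * n * δ := by
  classical
  -- averaging over the flips of a list of control bits
  have h1 : ∀ C : List (Fin n × XZ), ∃ φ' : Space n F, ‖φ - φ'‖ ≤ C.length * δ ∧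
      (∀ c, ‖φ' - permute (flipBit c) φ'‖ ≤ δ) ∧ ∀ c ∈ C, permute (flipBit c) φ' = φ' := by
    intro C
    induction C with
    | nil => exact ⟨φ, by simp, h, by simp⟩
    | cons c C ih =>
      obtain ⟨φ', h1, h2, h3⟩ := ih
      -- Flips commute, so averaging over one of them keeps the invariance already reached and the
      -- estimates for the others.
      have hcomm : ∀ a b : Fin n × XZ, permute (flipBit a) (permute (flipBit b) φ') =
          permute (flipBit b) (permute (flipBit a) φ') := by
        intro a b
        by_cases hab : a = b
        · rw [hab]
        ext x
        simp only [permute_apply, flipBit_apply]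
        rw [Function.update_of_ne hab, Function.update_of_ne (Ne.symm hab),
          Function.update_comm hab]
      refine ⟨(1 / 2 : ℂ) • (φ' + permute (flipBit c) φ'), ?_, ?_, ?_⟩
      · have h4 : φ - (1 / 2 : ℂ) • (φ' + permute (flipBit c) φ') =
            (φ - φ') + (1 / 2 : ℂ) • (φ' - permute (flipBit c) φ') := by module
        rw [h4]
        have h5 : ‖(1 / 2 : ℂ) • (φ' - permute (flipBit c) φ')‖ ≤ δ := by
          rw [norm_smul]
          have := h2 c
          norm_num
          linarith
        refine (norm_add_le _ _).trans ((add_le_add h1 h5).trans_eq ?_)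
        simp only [List.length_cons]; push_cast; ring
      · intro a
        have h4 : (1 / 2 : ℂ) • (φ' + permute (flipBit c) φ') -
            permute (flipBit a) ((1 / 2 : ℂ) • (φ' + permute (flipBit c) φ')) =
            (1 / 2 : ℂ) • ((φ' - permute (flipBit a) φ') +
              permute (flipBit c) (φ' - permute (flipBit a) φ')) := by
          rw [map_smul, map_add, map_sub, hcomm a c]; module
        rw [h4, norm_smul]
        have h5 := norm_add_le (φ' - permute (flipBit a) φ')
          (permute (flipBit c) (φ' - permute (flipBit a) φ'))
        rw [LinearIsometry.norm_map] at h5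
        have := h2 a
        rw [norm_div, norm_one, Complex.norm_ofNat]
        linarith
      · intro a ha
        rw [map_smul, map_add]
        rcases List.mem_cons.mp ha with rfl | ha
        · have h4 : permute (flipBit a) (permute (flipBit a) φ') = φ' := by
            ext x
            have : flipBit a (flipBit a x) = x := by
              ext d : 1
              by_cases hd : d = a <;> simp [flipBit_apply, hd]
            rw [permute_apply, permute_apply, this]
          rw [h4, add_comm]
        · rw [hcomm a c, h3 a ha]
  obtain ⟨φ', h2, -, h3⟩ := h1 Finset.univ.toList
  -- an invariant function is constant
  have h4 : ∀ x y : Ctrl n, φ' x = φ' y := by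
    have h5 : ∀ (s : Finset (Fin n × XZ)) (x y : Ctrl n), (∀ c ∉ s, x c = y c) → φ' x = φ' y := by
      intro s
      induction s using Finset.induction_on with
      | empty => intro x y hxy; rw [funext fun c => hxy c (by simp)]
      | insert c s hc ih =>
        intro x y hxy
        by_cases hc' : x c = y c
        · refine ih x y fun d hd => ?_
          by_cases hdc : d = c
          · rw [hdc, hc']
          · exact hxy d (by simp [hdc, hd])
        · have h6 : φ' (flipBit c x) = φ' x := by
            have := congrArg (fun v : Space n F => v x) (h3 c (by simp))
            simpa using this
          rw [← h6]
          refine ih _ y fun d hd => ?_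
          rw [flipBit_apply]
          by_cases hdc : d = c
          · subst hdc
            rw [Function.update_self]
            omega
          · rw [Function.update_of_ne hdc]
            exact hxy d (by simp [hdc, hd])
    intro x y
    exact h5 Finset.univ x y (by simp)
  have hc : ((√(Fintype.card (Ctrl n) : ℝ) : ℝ) : ℂ) ≠ 0 := by
    have : (0 : ℝ) < Fintype.card (Ctrl n) := by exact_mod_cast Fintype.card_pos
    exact_mod_cast (Real.sqrt_pos.mpr this).ne'
  -- The factor undoes the normalization in `uniform`.
  refine ⟨((√(Fintype.card (Ctrl n) : ℝ) : ℝ) : ℂ) • φ' 0, ?_⟩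
  have h5 : uniform (((√(Fintype.card (Ctrl n) : ℝ) : ℝ) : ℂ) • φ' 0) = φ' := by
    ext x
    rw [uniform_apply, smul_smul, inv_mul_cancel₀ hc, one_smul, h4 x 0]
  rw [h5]
  have h6 : ((Finset.univ : Finset (Fin n × XZ)).toList.length : ℝ) = 2 * n := by
    rw [Finset.length_toList, Finset.card_univ, Fintype.card_prod, Fintype.card_fin]
    have : Fintype.card XZ = 2 := rfl
    rw [this]; push_cast; ring
  rwa [h6] at h2

/-- The state `ψ` of the player satisfies, after every prefix sequence and along the whole
sequence of controlled reflections, all constraints up to an error `e`. -/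
structure Good (R : Reflections n k F) (e : ℝ) (φ : F) : Prop where
  even : ∀ L u, (u :: L) <:+ (List.finRange n).reverse → R.Sat e (R.lam L (uniform φ))
  odd : ∀ L u, (u :: L) <:+ (List.finRange n).reverse →
    R.Sat e (R.act (Label.controlled (u, XZ.X) (weightOne u XZ.X)) (R.lam L (uniform φ)))

theorem ApproxClock.exists_good (h : ApproxClock R E δ Ψ) :
    ∃ ψ : F, ‖Ψ 0 - uniform ψ‖ ≤ E.N * δ ∧
      ∀ q, IsPrefixSeq q → Good R (8 * E.N * δ) (R.locWord q.reverse ψ) := by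
  have hδ := h.nonneg
  obtain ⟨ψ, hψ⟩ := exists_uniform_near hδ h.init
  have hψ' : ‖Ψ 0 - uniform ψ‖ ≤ E.N * δ := by
    have : ((2 * n : ℕ) : ℝ) ≤ E.N := by exact_mod_cast E.two_mul_le_N
    refine hψ.trans ?_
    push_cast at this
    gcongr
  refine ⟨ψ, hψ', fun q hq => ?_⟩
  obtain ⟨l, hl, rfl⟩ := List.mem_iff_getElem.mp ((E.mem_seqs q).mpr hq)
  have hloc : R.word E.seqs[l].reverse (uniform ψ) =
      uniform (R.locWord E.seqs[l].reverse ψ) := by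
    rw [R.word_of_isLocal fun a ha => Reflections.isLocal_of_isPrefixSeq hq a (List.mem_reverse.mp ha),
      diag_const_uniform]
  -- `4 N δ` is the constraint error at the clock block. Moving to the product state costs twice the
  -- distance, which is `N δ` for the path and `N δ` for replacing `Ψ 0` by `uniform ψ`.
  rw [show 8 * (E.N : ℝ) * δ = 4 * E.N * δ + 2 * (E.N * δ + E.N * δ) by ring]
  have hdec : ∀ L u, (u :: L) <:+ (List.finRange n).reverse →
      ∃ B, List.finRange n = L.reverse ++ u :: B := by
    rintro L u ⟨t, ht⟩
    refine ⟨t.reverse, ?_⟩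
    rw [← List.reverse_reverse (List.finRange n), ← ht]
    simp
  have hblock := E.block_length_le hl
  rw [E.seqW_length] at hblock
  have hnear : ∀ L : List (Fin n), ‖R.lam L (R.word E.seqs[l].reverse (Ψ 0)) -
      R.lam L (uniform (R.locWord E.seqs[l].reverse ψ))‖ ≤ E.N * δ := by
    intro L
    rw [← hloc, ← map_sub, ← map_sub, LinearIsometry.norm_map, LinearIsometry.norm_map]
    exact hψ'
  have bound : ∀ j : ℕ, j ≤ 2 * n →
      ((((E.seqs.take l).flatMap E.block ++ E.seqs[l]).length : ℝ) +
        (j : ℝ) * (E.seqV.length + 1)) * δ ≤ E.N * δ := by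
    intro j hj
    refine mul_le_mul_of_nonneg_right ?_ hδ
    have : ((E.seqs.take l).flatMap E.block ++ E.seqs[l]).length +
        j * (E.seqV.length + 1) ≤ E.N := by
      have := Nat.mul_le_mul_right (E.seqV.length + 1) hj
      rw [List.length_append]
      have h2 : 2 * n * (E.seqV.length + 1) = n * (2 * (E.seqV.length + 1)) := by ring
      omega
    exact_mod_cast this
  constructor
  · intro L u hL
    obtain ⟨B, hB⟩ := hdec L u hL
    obtain ⟨⟨s, hs⟩, -⟩ := h.along hl L.reverse B u hB
    have hA : L.reverse.length < n := by
      have := congrArg List.length hB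
      simp at this; simp; omega
    obtain ⟨pre, post, hU, hlen⟩ := Listing.exists_position (E := E) hl hB
    have hsat := h.sat hl (i := 2 * L.reverse.length) (by omega)
      ⟨pre, _, by
        rw [hU, Listing.qubitBlock, List.append_assoc, List.append_assoc, List.append_assoc], hlen⟩
    rw [List.reverse_reverse] at hs
    have hb := bound (2 * L.reverse.length) (by omega)
    push_cast at hb
    refine hsat.of_near s ?_
    rw [← norm_neg_one_pow_smul s, smul_sub, smul_smul, sign_mul_self, one_smul]
    refine (norm_sub_le_norm_sub_add_norm_sub _
      (R.lam L (R.word E.seqs[l].reverse (Ψ 0))) _).trans (add_le_add ?_ (hnear L))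
    rw [norm_sub_rev]
    exact hs.trans hb
  · intro L u hL
    obtain ⟨B, hB⟩ := hdec L u hL
    obtain ⟨-, s, hs⟩ := h.along hl L.reverse B u hB
    have hA : L.reverse.length < n := by
      have := congrArg List.length hB
      simp at this; simp; omega
    obtain ⟨pre, post, hU, hlen⟩ := Listing.exists_position (E := E) hl hB
    have hsat := h.sat hl (i := 2 * L.reverse.length + 1) (by omega)
      ⟨pre ++ E.seqV ++ [Label.controlled (u, XZ.X) (weightOne u XZ.X)],
        [Label.controlled (u, XZ.Z) (weightOne u XZ.Z)] ++ post,
        by rw [hU, Listing.qubitBlock]; simp only [List.append_assoc], by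
          rw [List.length_append, List.length_append, hlen, E.vertex_eq hl, E.vertex_eq hl]
          simp only [List.length_singleton]; ring⟩
    rw [List.reverse_reverse] at hs
    have hb := bound (2 * L.reverse.length + 1) (by omega)
    push_cast at hb
    refine hsat.of_near s ?_
    rw [← norm_neg_one_pow_smul s, smul_sub, smul_smul, sign_mul_self, one_smul]
    refine (norm_sub_le_norm_sub_add_norm_sub _
      (R.act (Label.controlled (u, XZ.X) (weightOne u XZ.X))
        (R.lam L (R.word E.seqs[l].reverse (Ψ 0)))) _).trans (add_le_add ?_ ?_)
    · rw [norm_sub_rev]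
      exact hs.trans hb
    · rw [← map_sub, LinearIsometry.norm_map]
      exact hnear L

end Path

end PauliGame

namespace PauliGame

section Encoding

variable {n : ℕ} {F : Type*} [NormedAddCommGroup F] [NormedSpace ℂ F]

/-- The Pauli `Z` on the first control bit of a qubit. -/
def phase (u : Fin n) : Space n F →ₗᵢ[ℂ] Space n F :=
  diag fun x => if x (u, XZ.X) = 1 then (LinearIsometryEquiv.neg ℂ).toLinearIsometry else 1

theorem phase_apply (u : Fin n) (v : Space n F) (x : Ctrl n) :
    phase u v x = if x (u, XZ.X) = 1 then -v x else v x := by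
  rw [phase, diag_apply]
  split_ifs <;> simp

/-- The encoded letters acting on the control register. -/
def enc : XZ × Fin n → (Space n F →ₗᵢ[ℂ] Space n F)
  | (XZ.X, u) => permute (flipBit (u, XZ.X))
  | (XZ.Z, u) => phase u * permute (flipBit (u, XZ.Z))

/-- Products of encoded letters. -/
def encWord (w : List (XZ × Fin n)) : Space n F →ₗᵢ[ℂ] Space n F := (w.map enc).prod

@[simp] theorem encWord_nil : encWord (F := F) ([] : List (XZ × Fin n)) = 1 := rfl

@[simp] theorem encWord_cons (a : XZ × Fin n) (w : List (XZ × Fin n)) :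
    encWord (F := F) (a :: w) = enc a * encWord w := by simp [encWord]

theorem encWord_append (w w' : List (XZ × Fin n)) :
    encWord (F := F) (w ++ w') = encWord w * encWord w' := by simp [encWord]

theorem encX_apply (u : Fin n) (v : Space n F) (x : Ctrl n) :
    enc (XZ.X, u) v x = v (flipBit (u, XZ.X) x) := rfl

theorem encZ_apply (u : Fin n) (v : Space n F) (x : Ctrl n) :
    enc (XZ.Z, u) v x =
      if x (u, XZ.X) = 1 then -v (flipBit (u, XZ.Z) x) else v (flipBit (u, XZ.Z) x) := by
  rw [enc, LinearIsometry.coe_mul, Function.comp_apply, phase_apply]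
  rfl

theorem flipBit_comm (c d : Fin n × XZ) (x : Ctrl n) :
    flipBit c (flipBit d x) = flipBit d (flipBit c x) := by
  by_cases h : c = d
  · rw [h]
  · simp only [flipBit_apply]
    rw [Function.update_of_ne h, Function.update_of_ne (Ne.symm h), Function.update_comm h]

theorem flipBit_flipBit (c : Fin n × XZ) (x : Ctrl n) : flipBit c (flipBit c x) = x := by
  ext d : 1
  by_cases hd : d = c <;> simp [flipBit_apply, hd]

theorem flipBit_self (c : Fin n × XZ) (x : Ctrl n) : flipBit c x c = 1 - x c := by
  simp [flipBit_apply]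

theorem flipBit_of_ne {c d : Fin n × XZ} (h : d ≠ c) (x : Ctrl n) : flipBit c x d = x d := by
  simp [flipBit_apply, h]

theorem one_sub_eq_one_iff (a : Fin 2) : 1 - a = 1 ↔ ¬ a = 1 := by
  revert a; decide

theorem enc_sq (a : XZ × Fin n) : enc (F := F) a * enc a = 1 := by
  obtain ⟨D, u⟩ := a
  cases D
  · ext v x
    simp [encX_apply, flipBit_flipBit]
  · ext v x
    have h : flipBit (u, XZ.Z) x (u, XZ.X) = x (u, XZ.X) := flipBit_of_ne (by simp) x
    simp only [LinearIsometry.coe_mul, Function.comp_apply, encZ_apply, h, flipBit_flipBit]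
    split_ifs <;> simp

theorem enc_comm {a b : XZ × Fin n} (h : a.1 = b.1 ∨ a.2 ≠ b.2) :
    enc (F := F) a * enc b = enc b * enc a := by
  obtain ⟨D, u⟩ := a
  obtain ⟨D', v⟩ := b
  ext ξ x
  simp only [LinearIsometry.coe_mul, Function.comp_apply]
  cases D <;> cases D'
  · simp only [encX_apply]
    rw [flipBit_comm]
  · have huv : u ≠ v := by simpa using h
    have h1 : flipBit (u, XZ.X) x (v, XZ.X) = x (v, XZ.X) :=
      flipBit_of_ne (by simp [huv.symm]) x
    simp only [encX_apply, encZ_apply, h1]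
    rw [flipBit_comm]
  · have huv : u ≠ v := by simpa using h
    have h1 : flipBit (v, XZ.X) x (u, XZ.X) = x (u, XZ.X) :=
      flipBit_of_ne (by simp [huv]) x
    simp only [encX_apply, encZ_apply, h1]
    rw [flipBit_comm]
  · have h1 : ∀ u v, flipBit (u, XZ.Z) x (v, XZ.X) = x (v, XZ.X) :=
      fun u v => flipBit_of_ne (by simp) x
    simp only [encZ_apply, h1]
    rw [flipBit_comm]
    split_ifs <;> simp

/-- The encoded `X` flips exactly the bit that determines the phase in the encoded `Z`. -/
theorem enc_anticomm (u : Fin n) (ξ : Space n F) :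
    enc (XZ.Z, u) (enc (XZ.X, u) ξ) = -enc (XZ.X, u) (enc (XZ.Z, u) ξ) := by
  ext x
  have h1 : flipBit (u, XZ.X) x (u, XZ.X) = 1 - x (u, XZ.X) := flipBit_self _ x
  rw [PiLp.neg_apply]
  simp only [encX_apply, encZ_apply, h1, one_sub_eq_one_iff]
  rw [flipBit_comm]
  split_ifs <;> simp_all

/-- Encoded letters of the same type commute, so the occurrence of `u` can be moved to the front,
where the square cancels. -/
theorem encWord_erase {D : XZ} {u : Fin n} {α : List (Fin n)} (h : u ∈ α) :
    enc (F := F) (D, u) * encWord (α.map fun v => (D, v)) =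
      encWord ((α.erase u).map fun v => (D, v)) := by
  have h1 : encWord (F := F) (α.map fun v => (D, v)) =
      encWord ((u :: α.erase u).map fun v => (D, v)) := by
    refine List.Perm.prod_eq' (((List.perm_cons_erase h).map _).map _) ?_
    rw [List.pairwise_map, List.pairwise_map]
    exact List.pairwise_of_forall fun a b => enc_comm (Or.inl rfl)
  rw [h1, List.map_cons, encWord_cons, ← mul_assoc, enc_sq, one_mul]

theorem exists_encZ_comm (u : Fin n) (α : List (Fin n)) :
    ∃ s : ℕ, ∀ ξ : Space n F, enc (XZ.Z, u) (encWord (α.map fun v => (XZ.X, v)) ξ) =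
      (-1 : ℂ) ^ s • encWord (α.map fun v => (XZ.X, v)) (enc (XZ.Z, u) ξ) := by
  induction α with
  | nil => exact ⟨0, by simp⟩
  | cons v α ih =>
    obtain ⟨s, hs⟩ := ih
    by_cases h : u = v
    · subst h
      refine ⟨s + 1, fun ξ => ?_⟩
      rw [List.map_cons, encWord_cons, LinearIsometry.coe_mul, Function.comp_apply,
        Function.comp_apply, enc_anticomm, hs, map_smul, pow_succ]
      simp
    · refine ⟨s, fun ξ => ?_⟩
      have h1 := enc_comm (F := F) (a := (XZ.Z, u)) (b := (XZ.X, v)) (Or.inr h)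
      rw [List.map_cons, encWord_cons, LinearIsometry.coe_mul, Function.comp_apply,
        Function.comp_apply, ← Function.comp_apply (f := enc (XZ.Z, u)), ← LinearIsometry.coe_mul,
        h1, LinearIsometry.coe_mul, Function.comp_apply, hs, map_smul]

/-- Every word of encoded letters is, up to sign, a product of distinct `X`s and distinct `Z`s. -/
theorem exists_normalForm {J : Finset (Fin n)} (w : List (XZ × Fin n)) (hw : ∀ a ∈ w, a.2 ∈ J) :
    ∃ (s : ℕ) (α β : List (Fin n)), α.Nodup ∧ β.Nodup ∧ (∀ u ∈ α, u ∈ J) ∧ (∀ u ∈ β, u ∈ J) ∧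
      ∀ ξ : Space n F, encWord w ξ = (-1 : ℂ) ^ s •
        encWord ((α.map fun v => (XZ.X, v)) ++ β.map fun v => (XZ.Z, v)) ξ := by
  induction w with
  | nil => exact ⟨0, [], [], by simp⟩
  | cons a w ih =>
    obtain ⟨s, α, β, hα, hβ, hαJ, hβJ, hs⟩ := ih fun b hb => hw b (by simp [hb])
    have ha := hw a (by simp)
    obtain ⟨D, u⟩ := a
    cases D
    · by_cases hu : u ∈ α
      · refine ⟨s, α.erase u, β, hα.erase u, hβ, fun v hv => hαJ v (List.mem_of_mem_erase hv),
          hβJ, fun ξ => ?_⟩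
        rw [encWord_cons, LinearIsometry.coe_mul, Function.comp_apply, hs, map_smul,
          encWord_append, encWord_append, ← encWord_erase hu]
        rfl
      · refine ⟨s, u :: α, β, by simp [hu, hα], hβ, by simpa using ⟨ha, hαJ⟩, hβJ, fun ξ => ?_⟩
        rw [encWord_cons, LinearIsometry.coe_mul, Function.comp_apply, hs, map_smul,
          List.map_cons, List.cons_append, encWord_cons]
        rfl
    · obtain ⟨t, ht⟩ := exists_encZ_comm (F := F) u α
      by_cases hu : u ∈ β
      · refine ⟨s + t, α, β.erase u, hα, hβ.erase u, hαJ,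
          fun v hv => hβJ v (List.mem_of_mem_erase hv), fun ξ => ?_⟩
        rw [encWord_cons, LinearIsometry.coe_mul, Function.comp_apply, hs, map_smul,
          encWord_append, encWord_append, ← encWord_erase hu, LinearIsometry.coe_mul,
          Function.comp_apply, ht, smul_smul, pow_add]
        rfl
      · refine ⟨s + t, α, u :: β, hα, by simp [hu, hβ], hαJ, by simpa using ⟨ha, hβJ⟩,
          fun ξ => ?_⟩
        rw [encWord_cons, LinearIsometry.coe_mul, Function.comp_apply, hs, map_smul,
          encWord_append, encWord_append, LinearIsometry.coe_mul, Function.comp_apply, ht,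
          smul_smul, pow_add, List.map_cons, encWord_cons]
        rfl

end Encoding

/-! ## Moving letters through the controlled reflections -/

section Moving

variable {n k : ℕ} [NeZero k] {F : Type*} [NormedAddCommGroup F] [NormedSpace ℂ F]
  (R : Reflections n k F)

theorem norm_le_norm_of_forall {ι : Type*} [Fintype ι] {v w : PiLp 2 (fun _ : ι => F)}
    (h : ∀ x, ‖v x‖ ≤ ‖w x‖) : ‖v‖ ≤ ‖w‖ := by
  rw [PiLp.norm_eq_of_L2, PiLp.norm_eq_of_L2]
  gcongr with x
  exact h x

/-- The controlled letter of a control bit. -/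
abbrev Reflections.ctl (c : Fin n × XZ) : Space n F →ₗᵢ[ℂ] Space n F :=
  R.act (Label.controlled c (weightOne c.1 c.2))

theorem Reflections.ctl_apply (c : Fin n × XZ) (ξ : Space n F) (x : Ctrl n) :
    R.ctl c ξ x = if x c = 1 then R.single (weightOne c.1 c.2) (ξ x) else ξ x := by
  rw [Reflections.ctl, Reflections.act, diag_apply]
  split_ifs <;> rfl

theorem Reflections.one_apply (D : XZ) (u : Fin n) (ξ : Space n F) (x : Ctrl n) :
    R.act (one D u) ξ x = R.single (weightOne u D) (ξ x) := rfl

theorem Reflections.single_single (P : Pauli n k) (v : F) : R.single P (R.single P v) = v := by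
  rw [← Function.comp_apply (f := R.single P), ← LinearIsometry.coe_mul, R.single_sq]
  rfl

/-- If the control bit is `1`, the two copies of `D_u` cancel; if it is `0`, one copy remains. The
letter thus exchanges the roles of the two control values, which is conjugation by a flip. -/
theorem Reflections.ctl_self (u : Fin n) (D : XZ) (ξ : Space n F) :
    R.ctl (u, D) (R.act (one D u) ξ) =
      permute (flipBit (u, D)) (R.ctl (u, D) (permute (flipBit (u, D)) ξ)) := by
  ext x
  simp only [ctl_apply, one_apply, permute_apply, flipBit_flipBit, flipBit_self,
    one_sub_eq_one_iff]
  split_ifs <;> simp [single_single]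

theorem Reflections.ctl_permute {c d : Fin n × XZ} (h : c ≠ d) (ξ : Space n F) :
    R.ctl c (permute (flipBit d) ξ) = permute (flipBit d) (R.ctl c ξ) := by
  ext x
  simp only [ctl_apply, permute_apply, flipBit_of_ne h]

theorem Reflections.ctl_phase (c : Fin n × XZ) (u : Fin n) (ξ : Space n F) :
    R.ctl c (phase u ξ) = phase u (R.ctl c ξ) := by
  ext x
  simp only [ctl_apply, phase_apply]
  split_ifs <;> simp

theorem Reflections.ctl_enc {c : Fin n × XZ} {a : XZ × Fin n} (h : c.1 ≠ a.2) (ξ : Space n F) :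
    R.ctl c (enc a ξ) = enc a (R.ctl c ξ) := by
  obtain ⟨D, u⟩ := a
  cases D
  · exact R.ctl_permute (fun hc => h (by simp [hc])) ξ
  · simp only [enc, LinearIsometry.coe_mul, Function.comp_apply]
    rw [ctl_phase, R.ctl_permute fun hc => h (by simp [hc])]

theorem Reflections.lam_cons (u : Fin n) (L : List (Fin n)) (ξ : Space n F) :
    R.lam (u :: L) ξ = R.ctl (u, XZ.Z) (R.ctl (u, XZ.X) (R.lam L ξ)) := rfl

/-- The control bits of a qubit not yet treated are still uniform and absorb a flip. This removes
the inner flip of `ctl_self`. -/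
theorem Reflections.permute_lam {c : Fin n × XZ} {L : List (Fin n)} (h : c.1 ∉ L) (φ : F) :
    permute (flipBit c) (R.lam L (uniform φ)) = R.lam L (uniform φ) := by
  induction L with
  | nil => exact permute_uniform _ _
  | cons u L ih =>
    simp only [List.mem_cons, not_or] at h
    rw [lam_cons, ← ctl_permute, ← ctl_permute, ih h.2]
    · exact fun hc => h.1 (by rw [← hc])
    · exact fun hc => h.1 (by rw [← hc])

variable {R}

theorem Reflections.Sat.comm {e : ℝ} {ξ : Space n F} (h : R.Sat e ξ) {u v : Fin n} (huv : u ≠ v)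
    (D D' : XZ) : ‖R.act (one D' v) (R.act (one D u) ξ) -
      R.act (one D u) (R.act (one D' v) ξ)‖ ≤ e := by
  have h1 := h _ (IsConstraint.commute u v huv D D')
  simp only [word_cons, word_nil, mul_one, LinearIsometry.coe_mul, Function.comp_apply,
    Fin.val_zero, pow_zero, one_smul] at h1
  rw [R.norm_act_sub, R.norm_act_sub, norm_sub_rev] at h1
  exact h1

theorem Reflections.Sat.anticomm {e : ℝ} {ξ : Space n F} (h : R.Sat e ξ) (u : Fin n) :
    ‖R.act (one XZ.X u) (R.act (one XZ.Z u) ξ) +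
      R.act (one XZ.Z u) (R.act (one XZ.X u) ξ)‖ ≤ e := by
  have h1 := h _ (IsConstraint.anticommute u)
  simp only [word_cons, word_nil, mul_one, LinearIsometry.coe_mul, Function.comp_apply,
    Fin.val_one, pow_one, neg_smul, one_smul] at h1
  rw [R.norm_act_sub, R.norm_act_sub, map_neg, map_neg, sub_neg_eq_add] at h1
  exact h1

/-- For fixed control bits the difference is either zero or the commutator on the player's space, so
the uncontrolled estimate dominates it pointwise. -/
theorem Reflections.Sat.ctl_comm {e : ℝ} {ξ : Space n F} (h : R.Sat e ξ) {u : Fin n}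
    {c : Fin n × XZ} (huc : u ≠ c.1) (D : XZ) :
    ‖R.ctl c (R.act (one D u) ξ) - R.act (one D u) (R.ctl c ξ)‖ ≤ e := by
  refine le_trans (norm_le_norm_of_forall fun x => ?_) (h.comm huc D c.2)
  simp only [PiLp.sub_apply, ctl_apply, one_apply]
  split_ifs <;> simp

/-- Exchanging `Z_u` with `X_u` costs a sign, and only where the control bit is `1`. This sign is
`phase u`, the `Z`-part of the encoded letter. -/
theorem Reflections.Sat.ctl_anticomm {e : ℝ} {ξ : Space n F} (h : R.Sat e ξ) (u : Fin n) :
    ‖R.ctl (u, XZ.X) (R.act (one XZ.Z u) ξ) -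
      phase u (R.act (one XZ.Z u) (R.ctl (u, XZ.X) ξ))‖ ≤ e := by
  refine le_trans (norm_le_norm_of_forall fun x => ?_) (h.anticomm u)
  simp only [PiLp.sub_apply, PiLp.add_apply, ctl_apply, one_apply, phase_apply]
  split_ifs <;> simp

theorem act_one_uniform (R : Reflections n k F) (D : XZ) (u : Fin n) (φ : F) :
    R.act (one D u) (uniform φ) = uniform (R.single (weightOne u D) φ) :=
  diag_const_uniform _ _

variable [NeZero n]

/-- The letter commutes approximately with both controlled letters of every other qubit, at cost `e`
each. The relation is needed at the vector just before each gate, which is what `Good.even` and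
`Good.odd` provide. -/
theorem Good.lam_not_mem {e : ℝ} {φ : F} (h : Good R e φ) (D : XZ) {u : Fin n}
    {L : List (Fin n)} (hL : L <:+ (List.finRange n).reverse) (hu : u ∉ L) :
    ‖R.lam L (R.act (one D u) (uniform φ)) - R.act (one D u) (R.lam L (uniform φ))‖ ≤
      L.length * (2 * e) := by
  induction L with
  | nil => simp [Reflections.lam]
  | cons v L ih =>
    simp only [List.mem_cons, not_or] at hu
    have h1 := ih ((List.suffix_cons v L).trans hL) hu.2
    have h2 := (h.even L v hL).ctl_comm (c := (v, XZ.X)) hu.1 D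
    have h3 := (h.odd L v hL).ctl_comm (c := (v, XZ.Z)) hu.1 D
    rw [← (R.ctl (v, XZ.X)).norm_map, map_sub, ← (R.ctl (v, XZ.Z)).norm_map, map_sub] at h1
    rw [← (R.ctl (v, XZ.Z)).norm_map, map_sub] at h2
    rw [R.lam_cons, R.lam_cons]
    calc _ ≤ _ := norm_sub_le_norm_sub_add_norm_sub _ _ _
      _ ≤ L.length * (2 * e) + (e + e) := add_le_add h1
          ((norm_sub_le_norm_sub_add_norm_sub _ _ _).trans (add_le_add h2 h3))
      _ = _ := by simp only [List.length_cons]; push_cast; ring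

/-- Gates of qubits applied before that of `u` are passed by commutation. At `u` itself the letter
is converted into an encoded letter, which commutes exactly with all later gates. -/
theorem Good.lam_mem {e : ℝ} {φ : F} (h : Good R e φ) (D : XZ) {u : Fin n}
    {L : List (Fin n)} (hL : L <:+ (List.finRange n).reverse) (hu : u ∈ L) :
    ‖R.lam L (R.act (one D u) (uniform φ)) - enc (D, u) (R.lam L (uniform φ))‖ ≤
      L.length * (2 * e) := by
  induction L with
  | nil => simp at hu
  | cons v L ih =>
    have hsuf := (List.suffix_cons v L).trans hL
    have hnd : (v :: L).Nodup :=
      hL.sublist.nodup (List.nodup_reverse.mpr (List.nodup_finRange n))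
    rw [List.nodup_cons] at hnd
    have he : 0 ≤ e := (norm_nonneg _).trans ((h.even L v hL) _ (IsConstraint.anticommute v))
    by_cases huv : u = v
    · subst huv
      have h1 := h.lam_not_mem D hsuf hnd.1
      rw [← (R.ctl (u, XZ.X)).norm_map, map_sub, ← (R.ctl (u, XZ.Z)).norm_map, map_sub] at h1
      rw [R.lam_cons, R.lam_cons]
      have hlen : (((u :: L).length : ℕ) : ℝ) * (2 * e) = L.length * (2 * e) + (e + e) := by
        simp only [List.length_cons]; push_cast; ring
      rw [hlen]
      cases D
      -- `X_u`: the controlled `X_u` turns it into a flip of its own control bit, which commutes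
      -- with the controlled `Z_u`.
      · rw [R.ctl_self, R.permute_lam hnd.1, R.ctl_permute (by simp)] at h1
        exact h1.trans (by linarith)
      -- `Z_u`: passing the controlled `X_u` leaves a phase, and the controlled `Z_u` then turns the
      -- letter into a flip of the second control bit.
      · have h2 := (h.even L u hL).ctl_anticomm u
        rw [← (R.ctl (u, XZ.Z)).norm_map, map_sub, R.ctl_phase, R.ctl_self,
          ← R.ctl_permute (c := (u, XZ.X)) (d := (u, XZ.Z)) (by simp),
          R.permute_lam (c := (u, XZ.Z)) hnd.1] at h2
        refine (norm_sub_le_norm_sub_add_norm_sub _ _ _).trans (add_le_add h1 ?_)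
        exact h2.trans (by linarith)
    · have h1 := ih hsuf (by simpa [huv] using hu)
      rw [← (R.ctl (v, XZ.X)).norm_map, map_sub, ← (R.ctl (v, XZ.Z)).norm_map, map_sub,
        R.ctl_enc (Ne.symm huv), R.ctl_enc (Ne.symm huv)] at h1
      rw [R.lam_cons, R.lam_cons]
      refine h1.trans ?_
      simp only [List.length_cons]; push_cast
      linarith

/-- The isometry that applies all controlled reflections to a uniform control register. -/
def Reflections.spread (R : Reflections n k F) : F →ₗᵢ[ℂ] Space n F :=
  (R.lam (List.finRange n).reverse).comp uniform

theorem Good.spread_single {e : ℝ} {φ : F} (h : Good R e φ) (D : XZ) (u : Fin n) :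
    ‖R.spread (R.single (weightOne u D) φ) - enc (D, u) (R.spread φ)‖ ≤ 2 * n * e := by
  have h1 := h.lam_mem D (u := u) List.suffix_rfl (by simp)
  rw [List.length_reverse, List.length_finRange, act_one_uniform] at h1
  exact h1.trans_eq (by ring)

theorem Good.sat {e : ℝ} {φ : F} (h : Good R e φ) : R.Sat e (uniform φ : Space n F) := by
  have hne : List.finRange n ≠ [] := by
    have : n ≠ 0 := NeZero.ne n
    simpa using this
  obtain ⟨u, L, hL⟩ := List.exists_cons_of_ne_nil hne
  exact h.even [] u ⟨L.reverse, by rw [hL]; simp⟩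

theorem Good.constraint {e : ℝ} {φ : F} (h : Good R e φ) {c : Constraint n k}
    (hc : IsConstraint c) : ‖R.locWord c.word φ - (-1 : ℂ) ^ (c.sign : ℕ) • φ‖ ≤ e := by
  have h1 := h.sat c hc
  rwa [R.word_of_isLocal (Reflections.isLocal_of_isConstraint hc), diag_const_uniform,
    ← map_smul, ← map_sub, LinearIsometry.norm_map] at h1

theorem Good.product {e : ℝ} {φ : F} (h : Good R e φ) (P : Pauli n k) :
    ‖R.single P φ - R.locWord ((letters P).map fun a => one a.1 a.2) φ‖ ≤ e := by
  have h1 := h.constraint (IsConstraint.product P)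
  simp only [factors_eq, Reflections.locWord_cons, LinearIsometry.coe_mul, Function.comp_apply,
    Fin.val_zero, pow_zero, one_smul] at h1
  rw [← (R.single P).norm_map, map_sub, norm_sub_rev] at h1
  have h2 := R.single_single P (R.locWord ((letters P).map fun a => one a.1 a.2) φ)
  rwa [Reflections.loc, h2] at h1

theorem Good.consistent {e : ℝ} {φ : F} (h : Good R e φ) (Q : MultiPauli n k) (P : Q.1) :
    ‖R.derived Q P φ - R.single P.1 φ‖ ≤ e := by
  have h1 := h.constraint (IsConstraint.consistent Q P)
  simp only [Reflections.locWord_cons, Reflections.locWord_nil, mul_one, LinearIsometry.coe_mul,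
    Function.comp_apply, Fin.val_zero, pow_zero, one_smul, Reflections.loc] at h1
  rw [← (R.derived Q P).norm_map, map_sub, norm_sub_rev] at h1
  have h2 : R.derived Q P (R.derived Q P (R.single P.1 φ)) = R.single P.1 φ := by
    rw [← Function.comp_apply (f := R.derived Q P), ← LinearIsometry.coe_mul, R.derived_sq]
    rfl
  rwa [h2] at h1

end Moving

end PauliGame

namespace PauliGame

/-! ### Words of reflections behind the isometry -/

section Words

variable {n k : ℕ} [NeZero k] {F : Type*} [NormedAddCommGroup F] [NormedSpace ℂ F]
  {R : Reflections n k F}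

/-- The vector `φ` behaves like a vector of a Pauli representation behind the isometry. -/
structure Legit (R : Reflections n k F) (e : ℝ) (φ : F) : Prop where
  letter : ∀ D u, ‖R.spread (R.single (weightOne u D) φ) - enc (D, u) (R.spread φ)‖ ≤ e
  product : ∀ P, ‖R.single P φ - R.locWord ((letters P).map fun a : XZ × Fin n => one a.1 a.2) φ‖ ≤ e
  consistent : ∀ Q P, ‖R.derived Q P φ - R.single P.1 φ‖ ≤ e

theorem Good.legit [NeZero n] {e : ℝ} {φ : F} (h : Good R e φ) : Legit R (2 * n * e) φ := by
  have he : 0 ≤ e := (norm_nonneg _).trans (h.sat _ (IsConstraint.anticommute 0))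
  have hn : (1 : ℝ) ≤ n := by exact_mod_cast NeZero.one_le
  have hle : e ≤ 2 * n * e := by nlinarith
  exact ⟨h.spread_single, fun P => (h.product P).trans hle,
    fun Q P => (h.consistent Q P).trans hle⟩

theorem Reflections.norm_spread_sub (R : Reflections n k F) (a b : F) :
    ‖R.spread a - R.spread b‖ = ‖a - b‖ := by
  rw [← map_sub, LinearIsometry.norm_map]

theorem norm_enc_sub (a : XZ × Fin n) (v w : Space n F) :
    ‖enc a v - enc a w‖ = ‖v - w‖ := by
  rw [← map_sub, LinearIsometry.norm_map]

/-- A sequence of primitive letters followed by a sequence of derived letters `X_u|Q`. -/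
theorem isPrefixSeq_of {α : List (Label n k)} {β : List (XZ × Fin n)} (hα : α.length ≤ k)
    {Q : Option (MultiPauli n k)} (hQ : ∀ a ∈ α, ∃ Q' ∈ Q, ∃ P : Q'.1, a = Label.derived Q' P)
    (hβ : β.length ≤ k) : IsPrefixSeq (α ++ β.map fun a : XZ × Fin n => one a.1 a.2).reverse := by
  refine ⟨(β.map fun a : XZ × Fin n => one a.1 a.2).reverse, α.reverse, ⟨by simpa, ?_⟩, ⟨by simpa, ?_⟩,
    List.reverse_append⟩
  · intro x hx
    simp only [List.mem_reverse, List.mem_map] at hx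
    obtain ⟨a, -, rfl⟩ := hx
    exact ⟨_, _, rfl⟩
  · rcases Q with _ | Q
    · left
      rw [List.reverse_eq_nil_iff]
      refine List.eq_nil_iff_forall_not_mem.mpr fun a ha => ?_
      simpa using hQ a ha
    · right
      refine ⟨Q, fun x hx => ?_⟩
      obtain ⟨Q', hQ', P, rfl⟩ := hQ x (List.mem_reverse.mp hx)
      cases hQ'
      exact ⟨P, rfl⟩

/-- After every prefix sequence, the vector `ψ` is legitimate. -/
def AllLegit (R : Reflections n k F) (e : ℝ) (ψ : F) : Prop :=
  ∀ w : List (Label n k), IsPrefixSeq w.reverse → Legit R e (R.locWord w ψ)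

variable {e : ℝ} {ψ : F}

theorem AllLegit.primitive (h : AllLegit R e ψ) {β : List (XZ × Fin n)} (hβ : β.length ≤ k) :
    Legit R e (R.locWord (β.map fun a : XZ × Fin n => one a.1 a.2) ψ) := by
  simpa using h _ (isPrefixSeq_of (α := []) (Q := none) (by simp) (by simp) hβ)

theorem AllLegit.self (h : AllLegit R e ψ) : Legit R e ψ := by
  simpa using h.primitive (β := []) (by simp)

theorem AllLegit.nonneg (h : AllLegit R e ψ) [NeZero n] : 0 ≤ e :=
  (norm_nonneg _).trans (h.self.letter XZ.X 0)

/-- Every suffix of `β` is itself a primitive sequence of length at most `k`, so each letter is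
applied at a legitimate vector and costs one `e`. -/
theorem AllLegit.spread_primitive (h : AllLegit R e ψ) {β : List (XZ × Fin n)}
    (hβ : β.length ≤ k) :
    ‖R.spread (R.locWord (β.map fun a : XZ × Fin n => one a.1 a.2) ψ) - encWord β (R.spread ψ)‖ ≤
      β.length * e := by
  induction β with
  | nil => simp
  | cons a β ih =>
    have hβ' : β.length ≤ k := (Nat.le_succ _).trans hβ
    have h1 := ih hβ'
    have h2 := (h.primitive hβ').letter a.1 a.2
    rw [← norm_enc_sub a] at h1
    rw [List.map_cons, R.locWord_cons, encWord_cons]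
    refine (norm_sub_le_norm_sub_add_norm_sub _ _ _).trans
      ((add_le_add h2 h1).trans_eq ?_)
    simp only [List.length_cons]; push_cast; ring

/-- The single reflections act like the Pauli operators behind the isometry. -/
theorem AllLegit.spread_single [NeZero n] (h : AllLegit R e ψ) (P : Pauli n k) :
    ‖R.spread (R.single P ψ) - encWord (letters P) (R.spread ψ)‖ ≤ (k + 1) * e := by
  have h1 := h.self.product P
  rw [← R.norm_spread_sub] at h1
  have h2 := h.spread_primitive (letters_length_le P)
  have h3 : ((letters P).length : ℝ) ≤ k := by exact_mod_cast letters_length_le P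
  have he := h.nonneg
  calc _ ≤ e + (letters P).length * e :=
        (norm_sub_le_norm_sub_add_norm_sub _ _ _).trans (add_le_add h1 h2)
    _ ≤ e + k * e := by gcongr
    _ = _ := by ring

/-- The set of all `X_u` with `u` in a set of `k` qubits. -/
def xSet (J : Finset (Fin n)) (hJ : J.card = k) : MultiPauli n k :=
  ⟨J.image fun u => weightOne u XZ.X, by
    rw [Finset.card_image_of_injective, hJ]
    intro u v huv
    have := congrFun (congrArg Subtype.val huv) u
    by_contra hne
    simp [weightOne, hne] at this, by
    intro P hP P' hP'
    obtain ⟨u, -, rfl⟩ := Finset.mem_image.mp hP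
    obtain ⟨v, -, rfl⟩ := Finset.mem_image.mp hP'
    rw [pauliMatrix_weightOne, pauliMatrix_weightOne]
    by_cases huv : u = v
    · rw [huv]
    · exact site_comm huv _ _, J, hJ, by
    intro P hP
    obtain ⟨u, hu, rfl⟩ := Finset.mem_image.mp hP
    intro v hv
    by_contra hne
    have : v ≠ u := fun h => hne (h ▸ hu)
    simp [support, weightOne, this] at hv⟩

/-- Every word of encoded letters in `J` is attained at a legitimate vector. -/
theorem AllLegit.exists_near [NeZero n] (h : AllLegit R e ψ) {J : Finset (Fin n)}
    (hJ : J.card = k) (w : List (XZ × Fin n)) (hw : ∀ a ∈ w, a.2 ∈ J) :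
    ∃ ξ, Legit R e ξ ∧ ‖R.spread ξ - encWord w (R.spread ψ)‖ ≤ 3 * k * e := by
  -- In the normal form the `Z`s act first and are realized by primitive letters. The `X`s are
  -- realized by symbols `X_u|Q` with `Q` the set of all `X_u`, `u ∈ J`. Both lists are
  -- duplicate-free in `J`, so they fit the lengths of a prefix.
  obtain ⟨s, α, β, hα, hβ, hαJ, hβJ, hs⟩ := exists_normalForm (F := F) w hw
  have he := h.nonneg
  have hcard : ∀ γ : List (Fin n), γ.Nodup → (∀ u ∈ γ, u ∈ J) → γ.length ≤ k := by
    intro γ h1 h2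
    rw [← List.toFinset_card_of_nodup h1, ← hJ]
    exact Finset.card_le_card fun u hu => h2 u (List.mem_toFinset.mp hu)
  have hβk := hcard β hβ hβJ
  have hmem : ∀ u : {u // u ∈ J}, weightOne u.1 XZ.X ∈ (xSet J hJ).1 :=
    fun u => Finset.mem_image_of_mem _ u.2
  let der : {u // u ∈ J} → Label n k := fun u => Label.derived (xSet J hJ) ⟨_, hmem u⟩
  have key : ∀ γ : List {u // u ∈ J}, γ.length ≤ k →
      Legit R e (R.locWord (γ.map der ++ (β.map fun v => (XZ.Z, v)).map fun a : XZ × Fin n => one a.1 a.2) ψ) ∧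
      ‖R.spread (R.locWord
        (γ.map der ++ (β.map fun v => (XZ.Z, v)).map fun a : XZ × Fin n => one a.1 a.2) ψ) -
        encWord ((γ.map fun u => (XZ.X, u.1)) ++ β.map fun v => (XZ.Z, v)) (R.spread ψ)‖ ≤
          (β.length + 2 * γ.length) * e := by
    intro γ
    induction γ with
    | nil =>
      intro _
      have h1 := h.spread_primitive (β := β.map fun v => (XZ.Z, v)) (by simpa)
      exact ⟨h.primitive (by simpa), by simpa using h1⟩
    | cons u γ ih =>
      intro hγ
      obtain ⟨h1, h2⟩ := ih ((Nat.le_succ _).trans hγ)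
      refine ⟨h _ (isPrefixSeq_of (Q := some (xSet J hJ)) (by rwa [List.length_map]) ?_
        (by rwa [List.length_map])), ?_⟩
      · intro a ha
        obtain ⟨v, -, rfl⟩ := List.mem_map.mp ha
        exact ⟨_, rfl, _, rfl⟩
      · have h3 := h1.consistent (xSet J hJ) ⟨_, hmem u⟩
        have h4 := h1.letter XZ.X u.1
        rw [← R.norm_spread_sub] at h3
        rw [← norm_enc_sub (XZ.X, u.1)] at h2
        rw [List.map_cons, List.cons_append, List.map_cons, List.cons_append, R.locWord_cons,
          encWord_cons]
        refine (norm_sub_le_norm_sub_add_norm_sub _ _ _).trans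
          ((add_le_add h3 ((norm_sub_le_norm_sub_add_norm_sub _ _ _).trans
            (add_le_add h4 h2))).trans_eq ?_)
        simp only [List.length_cons]; push_cast; ring
  have hαk := hcard α hα hαJ
  obtain ⟨γ, hγ⟩ : ∃ γ : List {u // u ∈ J}, γ.map Subtype.val = α :=
    ⟨α.attach.map fun u => ⟨u.1, hαJ u.1 u.2⟩, by
      rw [List.map_map]; exact List.attach_map_subtype_val α⟩
  have hlen : γ.length = α.length := by rw [← hγ, List.length_map]
  obtain ⟨h1, h2⟩ := key γ (by omega)
  have h5 : (γ.map fun u => (XZ.X, u.1)) = α.map fun v => (XZ.X, v) := by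
    rw [← hγ, List.map_map]; rfl
  rw [h5, hlen] at h2
  set ξ := R.locWord (γ.map der ++
    (β.map fun v => (XZ.Z, v)).map fun a : XZ × Fin n => one a.1 a.2) ψ
  -- The sign of the normal form goes into the vector; being legitimate does not depend on it.
  refine ⟨(-1 : ℂ) ^ s • ξ, ⟨fun D u => ?_, fun P => ?_, fun Q P => ?_⟩, ?_⟩
  · rw [map_smul, map_smul, map_smul, map_smul, ← smul_sub, norm_neg_one_pow_smul]
    exact h1.letter D u
  · rw [map_smul, map_smul, ← smul_sub, norm_neg_one_pow_smul]
    exact h1.product P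
  · rw [map_smul, map_smul, ← smul_sub, norm_neg_one_pow_smul]
    exact h1.consistent Q P
  · rw [map_smul, hs, ← smul_sub, norm_neg_one_pow_smul]
    refine h2.trans ?_
    have h6 : ((β.length + 2 * α.length : ℕ) : ℝ) ≤ (3 * k : ℕ) := by
      exact_mod_cast (by omega)
    push_cast at h6
    gcongr

/-- Applying a letter in `J`. -/
theorem AllLegit.spread_letter [NeZero n] (h : AllLegit R e ψ) {J : Finset (Fin n)}
    (hJ : J.card = k) {w : List (XZ × Fin n)} (hw : ∀ a ∈ w, a.2 ∈ J) {ξ : F} {d : ℝ}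
    (hξ : ‖R.spread ξ - encWord w (R.spread ψ)‖ ≤ d) (a : XZ × Fin n) :
    ‖R.spread (R.loc (one a.1 a.2) ξ) - encWord (a :: w) (R.spread ψ)‖ ≤
      d + (6 * k + 1) * e := by
  obtain ⟨ξ', hleg, hξ'⟩ := h.exists_near hJ w hw
  -- The vector `ξ` need not be legitimate. It is exchanged for a legitimate one with nearly the
  -- same image before the letter is applied, so the earlier error `d` enters with coefficient `1`
  -- and does not grow with the word.
  have h1 : ‖R.spread (R.loc (one a.1 a.2) ξ) - R.spread (R.loc (one a.1 a.2) ξ')‖ ≤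
      d + 3 * k * e := by
    rw [R.norm_spread_sub, ← map_sub, LinearIsometry.norm_map, ← R.norm_spread_sub]
    refine (norm_sub_le_norm_sub_add_norm_sub _ (encWord w (R.spread ψ)) _).trans
      (add_le_add hξ ?_)
    rwa [norm_sub_rev]
  have h2 := hleg.letter a.1 a.2
  rw [← norm_enc_sub a] at hξ'
  rw [encWord_cons]
  refine (norm_sub_le_norm_sub_add_norm_sub _ _ _).trans
    ((add_le_add h1 ((norm_sub_le_norm_sub_add_norm_sub _ _ _).trans
      (add_le_add h2 hξ'))).trans_eq ?_)
  ring

/-- Applying a symbol `P|Q` with `P` supported in `J`. -/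
theorem AllLegit.spread_derived [NeZero n] (h : AllLegit R e ψ) {J : Finset (Fin n)}
    (hJ : J.card = k) {w : List (XZ × Fin n)} (hw : ∀ a ∈ w, a.2 ∈ J) {ξ : F} {d : ℝ}
    (hξ : ‖R.spread ξ - encWord w (R.spread ψ)‖ ≤ d) (Q : MultiPauli n k) (P : Q.1)
    (hP : support P.1.1 ⊆ J) :
    ‖R.spread (R.derived Q P ξ) - encWord (letters P.1 ++ w) (R.spread ψ)‖ ≤
      d + (6 * k ^ 2 + 7 * k + 2) * e := by
  obtain ⟨ξ', hleg, hξ'⟩ := h.exists_near hJ w hw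
  have he := h.nonneg
  have h1 : ‖R.spread (R.derived Q P ξ) - R.spread (R.derived Q P ξ')‖ ≤ d + 3 * k * e := by
    rw [R.norm_spread_sub, ← map_sub, LinearIsometry.norm_map, ← R.norm_spread_sub]
    refine (norm_sub_le_norm_sub_add_norm_sub _ (encWord w (R.spread ψ)) _).trans
      (add_le_add hξ ?_)
    rwa [norm_sub_rev]
  have h2 := hleg.consistent Q P
  have h3 := hleg.product P.1
  rw [← R.norm_spread_sub] at h2 h3
  -- After the exchange, `P|Q` becomes `P` by consistency and then a product of letters. These are
  -- applied one at a time, each with a fresh exchange.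
  have key : ∀ l : List (XZ × Fin n), (∀ a ∈ l, a.2 ∈ J) →
      ‖R.spread (R.locWord (l.map fun a : XZ × Fin n => one a.1 a.2) ξ') - encWord (l ++ w) (R.spread ψ)‖ ≤
        3 * k * e + l.length * ((6 * k + 1) * e) := by
    intro l
    induction l with
    | nil => intro _; simpa using hξ'
    | cons a l ih =>
      intro hl
      have h4 := h.spread_letter hJ (w := l ++ w) (fun b hb => by
        rcases List.mem_append.mp hb with hb | hb
        · exact hl b (by simp [hb])
        · exact hw b hb) (ih fun b hb => hl b (by simp [hb])) a
      rw [List.map_cons, R.locWord_cons, List.cons_append]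
      refine h4.trans_eq ?_
      simp only [List.length_cons]; push_cast; ring
  have h4 := key (letters P.1) fun a ha => hP (mem_support_of_mem_letters ha)
  have h5 : ((letters P.1).length : ℝ) ≤ k := by exact_mod_cast letters_length_le P.1
  calc _ ≤ (d + 3 * k * e) + (e + (e + (3 * k * e + (letters P.1).length * ((6 * k + 1) * e)))) :=
        (norm_sub_le_norm_sub_add_norm_sub _ _ _).trans (add_le_add h1
          ((norm_sub_le_norm_sub_add_norm_sub _ _ _).trans (add_le_add h2
            ((norm_sub_le_norm_sub_add_norm_sub _ _ _).trans (add_le_add h3 h4)))))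
    _ ≤ (d + 3 * k * e) + (e + (e + (3 * k * e + k * ((6 * k + 1) * e)))) := by gcongr
    _ = _ := by ring

/-- The projection onto an eigenspace of a reflection. -/
def eigenProj {H : Type*} [NormedAddCommGroup H] [NormedSpace ℂ H] (A : H →ₗᵢ[ℂ] H) (a : Fin 2) :
    Module.End ℂ H := (1 / 2 : ℂ) • (1 + (-1 : ℂ) ^ (a : ℕ) • A.toLinearMap)

theorem eigenProj_apply {H : Type*} [NormedAddCommGroup H] [NormedSpace ℂ H] (A : H →ₗᵢ[ℂ] H)
    (a : Fin 2) (v : H) : eigenProj A a v = (1 / 2 : ℂ) • (v + (-1 : ℂ) ^ (a : ℕ) • A v) := rfl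

/-- The last factor acts first, so splitting it off leaves the shorter product applied to `v` and to
`A P v`. -/
theorem prod_eigenProj_append {ι H : Type*} [NormedAddCommGroup H] [NormedSpace ℂ H]
    (A : ι → H →ₗᵢ[ℂ] H) (b : ι → Fin 2) (l : List ι) (P : ι) (v : H) :
    ((l ++ [P]).map fun P => eigenProj (A P) (b P)).prod v =
      (1 / 2 : ℂ) • ((l.map fun P => eigenProj (A P) (b P)).prod v + (-1 : ℂ) ^ (b P : ℕ) •
        (l.map fun P => eigenProj (A P) (b P)).prod (A P v)) := by
  rw [List.map_append, List.prod_append, Module.End.mul_apply, List.map_singleton,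
    List.prod_singleton, eigenProj_apply, map_smul, map_add, map_smul]

/-- The joint projections of the symbols `P|Q` act like those of the Pauli operators. -/
theorem AllLegit.spread_prod_eigenProj [NeZero n] (h : AllLegit R e ψ) (Q : MultiPauli n k)
    (b : Q.1 → Fin 2) (l : List Q.1) :
    ‖R.spread ((l.map fun P => eigenProj (R.derived Q P) (b P)).prod ψ) -
      (l.map fun P => eigenProj (encWord (letters P.1)) (b P)).prod (R.spread ψ)‖ ≤
        l.length * ((6 * k ^ 2 + 7 * k + 2) * e) := by
  obtain ⟨J, hJ, hsupp'⟩ := Q.2.2.2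
  have hsupp : ∀ P : Q.1, support P.1.1 ⊆ J := fun P => hsupp' P.1 P.2
  have he := h.nonneg
  have hder : ∀ m : List Q.1, ‖R.spread (R.locWord (m.map (Label.derived Q)) ψ) -
      encWord (m.flatMap fun P => letters P.1) (R.spread ψ)‖ ≤
        m.length * ((6 * k ^ 2 + 7 * k + 2) * e) := by
    intro m
    induction m with
    | nil => simp
    | cons P m ih =>
      have hw : ∀ a ∈ m.flatMap fun P => letters P.1, a.2 ∈ J := by
        intro a ha
        obtain ⟨P', -, ha⟩ := List.mem_flatMap.mp ha
        exact hsupp P' (mem_support_of_mem_letters ha)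
      have h1 : ‖R.spread (R.derived Q P (R.locWord (m.map (Label.derived Q)) ψ)) -
          encWord (letters P.1 ++ m.flatMap fun P => letters P.1) (R.spread ψ)‖ ≤
          m.length * ((6 * k ^ 2 + 7 * k + 2) * e) + (6 * k ^ 2 + 7 * k + 2) * e :=
        h.spread_derived hJ hw ih Q P (hsupp P)
      rw [List.map_cons, R.locWord_cons, List.flatMap_cons]
      refine h1.trans_eq ?_
      simp only [List.length_cons]; push_cast; ring
  -- The statement is strengthened by a word `m` already applied. Each projection splits into the
  -- cases without and with one more symbol in `m`, and the factor `1 / 2` averages the two errors.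
  have key : ∀ m : List Q.1,
      ‖R.spread ((l.map fun P => eigenProj (R.derived Q P) (b P)).prod
          (R.locWord (m.map (Label.derived Q)) ψ)) -
        (l.map fun P => eigenProj (encWord (letters P.1)) (b P)).prod
          (encWord (m.flatMap fun P => letters P.1) (R.spread ψ))‖ ≤
        (l.length + m.length) * ((6 * k ^ 2 + 7 * k + 2) * e) := by
    induction l using List.reverseRecOn with
    | nil => intro m; simpa using hder m
    | append_singleton l P ih =>
      intro m
      have h1 := ih m
      have h2 := ih (P :: m)
      rw [← norm_neg_one_pow_smul (b P : ℕ), smul_sub, List.map_cons, R.locWord_cons,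
        List.flatMap_cons, encWord_append] at h2
      simp only [LinearIsometry.coe_mul, Function.comp_apply, Reflections.loc] at h2
      rw [prod_eigenProj_append, prod_eigenProj_append, map_smul, map_add, map_smul,
        ← smul_sub, norm_smul, add_sub_add_comm]
      have h3 := norm_add_le_of_le h1 h2
      have h4 : ‖(1 / 2 : ℂ)‖ = 1 / 2 := by norm_num
      rw [h4]
      refine (mul_le_mul_of_nonneg_left h3 (by norm_num)).trans ?_
      have h5 : (0 : ℝ) ≤ (6 * k ^ 2 + 7 * k + 2) * e := by positivity
      simp only [List.length_cons, List.length_append, List.length_nil]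
      push_cast
      linarith
  simpa using key []

end Words

end PauliGame

namespace PauliGame

/-! ## Projective measurements -/

section Projective

variable {ι Ω : Type*} [Fintype ι] [DecidableEq ι] [Fintype Ω] [DecidableEq Ω]
  {p : Ω → Matrix ι ι ℂ}

/-- The outcomes of a projective measurement are mutually orthogonal. -/
theorem projective_orthogonal (herm : ∀ b, (p b).IsHermitian) (idem : ∀ b, p b * p b = p b)
    (sum : ∑ b, p b = 1) {b c : Ω} (h : c ≠ b) : p c * p b = 0 := by
  have h1 : ∑ c, (p c * p b)ᴴ * (p c * p b) = p b := by
    have : ∀ c, (p c * p b)ᴴ * (p c * p b) = p b * p c * p b := by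
      intro c
      rw [Matrix.conjTranspose_mul, (herm c).eq, (herm b).eq, Matrix.mul_assoc,
        ← Matrix.mul_assoc (p c), idem, Matrix.mul_assoc]
    simp only [this]
    rw [← Finset.sum_mul, ← Finset.mul_sum, sum, Matrix.mul_one, idem]
  -- The term `c = b` already equals the whole sum. The remaining positive semidefinite terms add up
  -- to zero, and taking traces makes each of them vanish.
  have h2 : ∑ c ∈ Finset.univ.erase b, (p c * p b)ᴴ * (p c * p b) = 0 := by
    rw [← Finset.add_sum_erase _ _ (Finset.mem_univ b), idem, (herm b).eq, idem] at h1
    simpa using h1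
  have h3 : ∑ c ∈ Finset.univ.erase b, ((p c * p b)ᴴ * (p c * p b)).trace = 0 := by
    rw [← Matrix.trace_sum, h2, Matrix.trace_zero]
  rw [Finset.sum_eq_zero_iff_of_nonneg fun c _ =>
    (Matrix.posSemidef_conjTranspose_mul_self _).trace_nonneg] at h3
  exact Matrix.trace_conjTranspose_mul_self_eq_zero_iff.mp (h3 c (by simp [h]))

/-- The reflection that records a bit of the outcome of a measurement. -/
def obs (p : Ω → Matrix ι ι ℂ) (c : Ω → Fin 2) : Matrix ι ι ℂ :=
  ∑ b, (-1 : ℂ) ^ (c b : ℕ) • p b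

theorem obs_herm (herm : ∀ b, (p b).IsHermitian) (c : Ω → Fin 2) : (obs p c)ᴴ = obs p c := by
  simp [obs, Matrix.conjTranspose_sum, Matrix.conjTranspose_smul, (herm _).eq]

theorem obs_mul (herm : ∀ b, (p b).IsHermitian) (idem : ∀ b, p b * p b = p b)
    (sum : ∑ b, p b = 1) (c : Ω → Fin 2) (b : Ω) :
    obs p c * p b = (-1 : ℂ) ^ (c b : ℕ) • p b := by
  rw [obs, Finset.sum_mul, Finset.sum_eq_single b]
  · rw [Matrix.smul_mul, idem]
  · intro b' _ hb'
    rw [Matrix.smul_mul, projective_orthogonal herm idem sum hb', smul_zero]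
  · simp

theorem obs_sq (herm : ∀ b, (p b).IsHermitian) (idem : ∀ b, p b * p b = p b)
    (sum : ∑ b, p b = 1) (c : Ω → Fin 2) : obs p c * obs p c = 1 := by
  conv_lhs => rw [obs.eq_1 p c, ← obs.eq_1 p c]
  rw [← sum]
  nth_rewrite 2 [obs]
  rw [Finset.mul_sum]
  refine Finset.sum_congr rfl fun b _ => ?_
  rw [Matrix.mul_smul, obs_mul herm idem sum, smul_smul, sign_mul_self, one_smul]

end Projective

/-! ## The state vectors of a strategy -/

/-- The space of the player together with a purifying system. -/
abbrev Player (d : ℕ) (κ : Type) [Fintype κ] : Type :=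
  PiLp 2 (fun _ : Fin d => EuclideanSpace ℂ κ)

/-- The operator `|u⟩⟨v|` on the clock. -/
def ketbra (N u v : ℕ) : Matrix (Fin (N + 1)) (Fin (N + 1)) ℂ :=
  Matrix.vecMulVec (ket N u) (star (ket N v))

theorem edgeProj_eq (N u v : ℕ) (a : Fin 2) : edgeProj N u v a = (1 / 2 : ℂ) •
    (ketbra N u u + ketbra N v v + (-1 : ℂ) ^ (a : ℕ) • (ketbra N u v + ketbra N v u)) := by
  simp only [edgeProj, ketbra, star_add, star_smul, Matrix.vecMulVec_add, Matrix.add_vecMulVec,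
    Matrix.vecMulVec_smul, Matrix.smul_vecMulVec, star_pow, star_neg, star_one]
  simp only [smul_add, smul_smul, sign_mul_self, mul_one]
  abel

/-- Accepting `2` or `a` excludes only the other edge outcome. -/
theorem edgeRest_add_edgeProj (N u v : ℕ) (a : Fin 2) :
    edgeRest N u v + edgeProj N u v a = 1 + (1 / 2 : ℂ) • (-(ketbra N u u + ketbra N v v) +
      (-1 : ℂ) ^ (a : ℕ) • (ketbra N u v + ketbra N v u)) := by
  rw [edgeRest, edgeProj_eq, edgeProj_eq, edgeProj_eq]
  fin_cases a <;> simp <;> module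

/-- Operators `B ⊗ M` on the control register and the player. -/
def tact {n d : ℕ} {κ : Type} [Fintype κ] (B : Matrix (Ctrl n) (Ctrl n) ℂ)
    (M : Matrix (Fin d) (Fin d) ℂ) (v : Space n (Player d κ)) : Space n (Player d κ) :=
  WithLp.toLp 2 fun x => ∑ y, B x y • mact M (v y)

/-- The components of a matrix at a value of the clock. -/
def clockVec {n d N : ℕ} {κ : Type} [Fintype κ]
    (G : Matrix (Fin (N + 1) × Ctrl n × Fin d) κ ℂ) (t : ℕ) : Space n (Player d κ) :=
  if h : t < N + 1 then
    WithLp.toLp 2 fun x => WithLp.toLp 2 fun r => WithLp.toLp 2 fun j => G (⟨t, h⟩, x, r) j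
  else 0

theorem clockVec_of_lt {n d N : ℕ} {κ : Type} [Fintype κ]
    (G : Matrix (Fin (N + 1) × Ctrl n × Fin d) κ ℂ) {t : ℕ} (h : t < N + 1) :
    clockVec G t = WithLp.toLp 2 fun x => WithLp.toLp 2 fun r =>
      WithLp.toLp 2 fun j => G (⟨t, h⟩, x, r) j := by
  rw [clockVec, dif_pos h]

namespace Strategy

variable {n k : ℕ} [NeZero k] {E : Listing n k} {d : ℕ} (S : Strategy E d)

/-- The reflections of a strategy. -/
def reflections (κ : Type) [Fintype κ] : Reflections n k (Player d κ) where
  single P := isom (S.refl P) (by rw [(S.refl_herm P).eq, S.refl_sq])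
  derived Q P := isom (obs (S.meas Q) fun b => b P) (by
    rw [obs_herm (S.meas_herm Q), obs_sq (S.meas_herm Q) (S.meas_idem Q) (S.meas_sum Q)])
  single_sq P := by
    ext v : 1
    simp [← mact_mul, S.refl_sq, mact_one]
  derived_sq Q P := by
    ext v : 1
    simp [← mact_mul, obs_sq (S.meas_herm Q) (S.meas_idem Q) (S.meas_sum Q), mact_one]

/-- The complex number whose real part is `S.prob`. -/
def cprob (A : Matrix (Fin (E.N + 1)) (Fin (E.N + 1)) ℂ) (B : Matrix (Ctrl n) (Ctrl n) ℂ)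
    (M : Matrix (Fin d) (Fin d) ℂ) : ℂ := ((A ⊗ₖ (B ⊗ₖ M)) * S.ρ).trace

variable {A A' : Matrix (Fin (E.N + 1)) (Fin (E.N + 1)) ℂ} {B B' : Matrix (Ctrl n) (Ctrl n) ℂ}
  {M M' : Matrix (Fin d) (Fin d) ℂ}

theorem prob_eq_re : S.prob A B M = (S.cprob A B M).re := rfl

theorem cprob_add_left : S.cprob (A + A') B M = S.cprob A B M + S.cprob A' B M := by
  simp [cprob, Matrix.add_kronecker, Matrix.add_mul]

theorem cprob_smul_left (c : ℂ) : S.cprob (c • A) B M = c * S.cprob A B M := by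
  simp [cprob, Matrix.smul_kronecker]

theorem cprob_neg_left : S.cprob (-A) B M = -S.cprob A B M := by
  rw [← neg_one_smul ℂ, cprob_smul_left, neg_one_mul]

theorem cprob_sub_left : S.cprob (A - A') B M = S.cprob A B M - S.cprob A' B M := by
  rw [sub_eq_add_neg, cprob_add_left, cprob_neg_left, sub_eq_add_neg]

theorem cprob_add_mid : S.cprob A (B + B') M = S.cprob A B M + S.cprob A B' M := by
  simp [cprob, Matrix.add_kronecker, Matrix.kronecker_add, Matrix.add_mul]

theorem cprob_smul_mid (c : ℂ) : S.cprob A (c • B) M = c * S.cprob A B M := by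
  simp [cprob, Matrix.smul_kronecker, Matrix.kronecker_smul]

theorem cprob_add_right : S.cprob A B (M + M') = S.cprob A B M + S.cprob A B M' := by
  simp [cprob, Matrix.kronecker_add, Matrix.add_mul]

theorem cprob_smul_right (c : ℂ) : S.cprob A B (c • M) = c * S.cprob A B M := by
  simp [cprob, Matrix.kronecker_smul]

theorem cprob_sum_right {ι : Type*} (s : Finset ι) (f : ι → Matrix (Fin d) (Fin d) ℂ) :
    S.cprob A B (∑ i ∈ s, f i) = ∑ i ∈ s, S.cprob A B (f i) := by
  classical
  induction s using Finset.induction_on with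
  | empty => simp [cprob]
  | insert a s ha ih => rw [Finset.sum_insert ha, Finset.sum_insert ha, cprob_add_right, ih]

theorem cprob_one : S.cprob 1 1 1 = 1 := by
  simp [cprob, S.ρ_trace]

variable {κ : Type} [Fintype κ] {G : Matrix (Fin (E.N + 1) × Ctrl n × Fin d) κ ℂ}

/-- The columns of `G` purify `ρ`. Every matrix element between clock values becomes an inner
product of two components of the purification, so acceptance probabilities can be read as norms. -/
theorem cprob_ketbra (hG : S.ρ = G * Gᴴ) {u v : ℕ} (hu : u ≤ E.N) (hv : v ≤ E.N) :
    S.cprob (ketbra E.N u v) B M = inner ℂ (clockVec G u) (tact B M (clockVec G v)) := by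
  have hu' : u < E.N + 1 := by omega
  have hv' : v < E.N + 1 := by omega
  rw [clockVec_of_lt G hu', clockVec_of_lt G hv', cprob, hG]
  have hket : ∀ (t : ℕ) (ht : t < E.N + 1) (s : Fin (E.N + 1)),
      ket E.N t s = if s = ⟨t, ht⟩ then 1 else 0 := by
    intro t ht s
    simp [ket, Fin.ext_iff]
  simp only [PiLp.inner_apply, tact, mact_apply, Matrix.trace, Matrix.diag, Matrix.mul_apply,
    Fintype.sum_prod_type, Matrix.kroneckerMap_apply, ketbra, Matrix.vecMulVec_apply,
    Pi.star_apply, hket u hu', hket v hv', Matrix.conjTranspose_apply, RCLike.inner_apply,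
    WithLp.ofLp_sum, WithLp.ofLp_smul, Finset.sum_apply, Pi.smul_apply, smul_eq_mul,
    apply_ite star, star_one, star_zero]
  simp only [ite_mul, mul_ite, one_mul, zero_mul, mul_zero, mul_one, Finset.sum_ite_irrel,
    Finset.sum_ite_eq', Finset.mem_univ, if_true, Finset.sum_const_zero]
  refine Finset.sum_congr rfl fun x _ => Finset.sum_congr rfl fun r _ => ?_
  simp only [Finset.mul_sum, Finset.sum_mul]
  conv_rhs => rw [Finset.sum_comm]
  refine Finset.sum_congr rfl fun y _ => ?_
  conv_rhs => rw [Finset.sum_comm]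
  refine Finset.sum_congr rfl fun s _ => Finset.sum_congr rfl fun j _ => ?_
  rw [Complex.star_def]
  ring

/-- Summing over the answers leaves the reflection `obs p c` that records the bit compared with the
clock outcome. All three types of edge and the constraint check are instances. -/
theorem accept_family (hG : S.ρ = G * Gᴴ) {u v : ℕ} (hu : u ≤ E.N) (hv : v ≤ E.N)
    {Ω : Type*} [Fintype Ω] (p : Ω → Matrix (Fin d) (Fin d) ℂ) (hp : ∑ b, p b = 1)
    (c : Ω → Fin 2) :
    ∑ b, S.cprob (edgeRest E.N u v + edgeProj E.N u v (c b)) B (p b) =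
      S.cprob 1 B 1 - (1 / 2 : ℂ) * (inner ℂ (clockVec G u) (tact B 1 (clockVec G u)) +
        inner ℂ (clockVec G v) (tact B 1 (clockVec G v))) +
      (1 / 2 : ℂ) * (inner ℂ (clockVec G u) (tact B (obs p c) (clockVec G v)) +
        inner ℂ (clockVec G v) (tact B (obs p c) (clockVec G u))) := by
  rw [← S.cprob_ketbra hG hu hu, ← S.cprob_ketbra hG hv hv, ← S.cprob_ketbra hG hu hv,
    ← S.cprob_ketbra hG hv hu]
  simp only [edgeRest_add_edgeProj, cprob_add_left, cprob_smul_left, cprob_neg_left,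
    Finset.sum_add_distrib, obs, cprob_sum_right, cprob_smul_right, ← hp]
  simp only [mul_add, Finset.sum_add_distrib, ← Finset.mul_sum, Finset.sum_neg_distrib]
  ring

theorem tact_one_left (M : Matrix (Fin d) (Fin d) ℂ) (v : Space n (Player d κ)) (x : Ctrl n) :
    tact 1 M v x = mact M (v x) := by
  simp [tact, Matrix.one_apply]

theorem tact_one_one (v : Space n (Player d κ)) : tact 1 1 v = v := by
  ext x : 1
  rw [tact_one_left, mact_one]

theorem tact_ctrlZ (c : Fin n × XZ) (b : Fin 2) (M : Matrix (Fin d) (Fin d) ℂ)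
    (v : Space n (Player d κ)) (x : Ctrl n) :
    tact (ctrlZ c b) M v x = if x c = b then mact M (v x) else 0 := by
  simp [tact, ctrlZ, Matrix.diagonal_apply]

theorem tact_ctrlX (c : Fin n × XZ) (v : Space n (Player d κ)) :
    tact (ctrlX c) 1 v = permute (flipBit c) v := by
  ext x : 1
  have h : ∀ y : Ctrl n, x = Function.update y c (1 - y c) ↔ y = flipBit c x := by
    intro y
    rw [← flipBit_apply]
    constructor
    · rintro rfl; rw [flipBit_flipBit]
    · rintro rfl; rw [flipBit_flipBit]
  simp [tact, ctrlX, mact_one, h]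

theorem act_single (P : Pauli n k) (v : Space n (Player d κ)) :
    (S.reflections κ).act (Label.single P) v = tact 1 (S.refl P) v := by
  ext x : 1
  rw [tact_one_left]
  rfl

theorem act_derived (Q : MultiPauli n k) (P : Q.1) (v : Space n (Player d κ)) :
    (S.reflections κ).act (Label.derived Q P) v =
      tact 1 (obs (S.meas Q) fun b => b P) v := by
  ext x : 1
  rw [tact_one_left]
  rfl

theorem act_controlled (c : Fin n × XZ) (P : Pauli n k) (v : Space n (Player d κ)) :
    (S.reflections κ).act (Label.controlled c P) v =
      tact (ctrlZ c 0) 1 v + tact (ctrlZ c 1) (S.refl P) v := by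
  ext x : 1
  rw [PiLp.add_apply, tact_ctrlZ, tact_ctrlZ, Reflections.act, diag_apply]
  by_cases h : x c = 1
  · simp [h, reflections]
  · have h0 : x c = 0 := by omega
    simp [h0, mact_one]

theorem ctrlZ_add (c : Fin n × XZ) : ctrlZ c 0 + ctrlZ c 1 = 1 := by
  rw [ctrlZ, ctrlZ, Matrix.diagonal_add, ← Matrix.diagonal_one]
  congr 1; funext x
  by_cases h : x c = 1
  · simp [h]
  · have h0 : x c = 0 := by omega
    simp [h0]

theorem tact_add_left (B B' : Matrix (Ctrl n) (Ctrl n) ℂ) (M : Matrix (Fin d) (Fin d) ℂ)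
    (v : Space n (Player d κ)) : tact (B + B') M v = tact B M v + tact B' M v := by
  ext x : 1
  simp [tact, add_smul, Finset.sum_add_distrib]

theorem tact_smul_right (B : Matrix (Ctrl n) (Ctrl n) ℂ) (c : ℂ) (M : Matrix (Fin d) (Fin d) ℂ)
    (v : Space n (Player d κ)) : tact B (c • M) v = c • tact B M v := by
  ext x : 1
  simp [tact, mact_smul, Finset.smul_sum, smul_comm c]

/-- The squared distance of `u` and `U v` for an isometric involution `U`. -/
theorem norm_sub_act_sq {F : Type*} [NormedAddCommGroup F] [InnerProductSpace ℂ F]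
    (R : Reflections n k F) (a : Label n k) (u v : Space n F) :
    1 - (1 / 2 : ℝ) * ‖u - R.act a v‖ ^ 2 =
      (1 - (1 / 2 : ℂ) * (inner ℂ u u + inner ℂ v v) +
        (1 / 2 : ℂ) * (inner ℂ u (R.act a v) + inner ℂ v (R.act a u))).re := by
  -- An isometric involution is self-adjoint.
  have h1 : inner ℂ v (R.act a u) = inner ℂ (R.act a v) u := by
    have h2 : R.act a (R.act a v) = v := by
      rw [← Function.comp_apply (f := R.act a), ← LinearIsometry.coe_mul, R.act_sq]
      rfl
    conv_lhs => rw [← h2]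
    exact LinearIsometry.inner_map_map _ _ _
  have h3 : ∀ w : Space n F, ‖w‖ ^ 2 = (inner ℂ w w : ℂ).re :=
    fun w => norm_sq_eq_re_inner (𝕜 := ℂ) w
  have h4 : (inner ℂ (R.act a v) u : ℂ).re = (inner ℂ u (R.act a v) : ℂ).re :=
    inner_re_symm (𝕜 := ℂ) _ _
  rw [h1, h3, inner_sub_left, inner_sub_right, inner_sub_right, LinearIsometry.inner_map_map]
  have h5 : ∀ z : ℂ, ((1 / 2 : ℂ) * z).re = 1 / 2 * z.re := by
    intro z
    rw [show (1 / 2 : ℂ) = ((1 / 2 : ℝ) : ℂ) by norm_num, Complex.re_ofReal_mul]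
  simp only [Complex.sub_re, Complex.add_re, h5, Complex.one_re, h4]
  ring

theorem sum_reflProj (T : Matrix (Fin d) (Fin d) ℂ) : ∑ a, reflProj T a = 1 := by
  rw [Fin.sum_univ_two, reflProj, reflProj]
  simp only [Fin.val_zero, Fin.val_one, pow_zero, pow_one]
  module

theorem obs_reflProj (T : Matrix (Fin d) (Fin d) ℂ) : obs (reflProj T) id = T := by
  rw [obs, Fin.sum_univ_two, reflProj, reflProj]
  simp only [Fin.val_zero, Fin.val_one, pow_zero, pow_one, id]
  module

/-- The acceptance probability of an edge of the propagation check. -/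
theorem edgeAccept_eq (hG : S.ρ = G * Gᴴ) {u v : ℕ} (hu : u ≤ E.N) (hv : v ≤ E.N)
    (a : Label n k) : S.edgeAccept u v a =
      1 - (1 / 2 : ℝ) * ‖clockVec G u - (S.reflections κ).act a (clockVec G v)‖ ^ 2 := by
  rw [norm_sub_act_sq]
  cases a with
  | single P =>
    have h := S.accept_family (B := 1) hG hu hv (reflProj (S.refl P)) (sum_reflProj _) id
    rw [obs_reflProj, tact_one_one, tact_one_one, cprob_one, ← act_single, ← act_single] at h
    rw [← h, Complex.re_sum]
    rfl
  | derived Q P =>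
    have h := S.accept_family (B := 1) hG hu hv (S.meas Q) (S.meas_sum Q) fun b => b P
    rw [tact_one_one, tact_one_one, cprob_one, ← act_derived, ← act_derived] at h
    rw [← h, Complex.re_sum]
    rfl
  | controlled c P =>
    have h1 := S.accept_family (B := ctrlZ c 1) hG hu hv (reflProj (S.refl P))
      (sum_reflProj _) id
    -- With control bit `0` the answer is ignored: the compared bit is constantly `0` and the
    -- recorded reflection is the identity.
    have h0 := S.accept_family (B := ctrlZ c 0) hG hu hv (reflProj (S.refl P))
      (sum_reflProj _) (fun _ => 0)
    have hobs : obs (reflProj (S.refl P)) (fun _ => 0) = 1 := by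
      simp [obs, -Fin.sum_univ_two, sum_reflProj]
    rw [obs_reflProj] at h1
    rw [hobs] at h0
    rw [act_controlled, act_controlled, inner_add_right, inner_add_right]
    have hs : ∀ w : Space n (Player d κ), (inner ℂ w w : ℂ) =
        inner ℂ w (tact (ctrlZ c 0) 1 w) + inner ℂ w (tact (ctrlZ c 1) 1 w) := by
      intro w
      rw [← inner_add_right, ← tact_add_left, ctrlZ_add, tact_one_one]
    have h3 : S.cprob 1 (ctrlZ c 0) 1 + S.cprob 1 (ctrlZ c 1) 1 = 1 := by
      rw [← cprob_add_mid, ctrlZ_add, cprob_one]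
    have h4 : S.edgeAccept u v (Label.controlled c P) =
        (∑ b, S.cprob (edgeRest E.N u v + edgeProj E.N u v 0) (ctrlZ c 0)
            (reflProj (S.refl P) b) +
          ∑ b, S.cprob (edgeRest E.N u v + edgeProj E.N u v (id b)) (ctrlZ c 1)
            (reflProj (S.refl P) b)).re := by
      rw [← Finset.sum_add_distrib, Complex.re_sum, edgeAccept]
      refine Finset.sum_congr rfl fun b _ => ?_
      simp only [prob_eq_re, cprob_add_left, id, ← ctrlZ_add c, cprob_add_mid, Complex.add_re]
      ring
    rw [h4, h0, h1, hs, hs (clockVec G v), ← h3]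
    congr 1
    ring

/-- The probability that an edge of the constraint check is accepted. -/
theorem constraint_accept_eq (hG : S.ρ = G * Gᴴ) {u v : ℕ} (hu : u ≤ E.N) (hv : v ≤ E.N)
    (s : Fin 2) : S.prob (edgeRest E.N u v + edgeProj E.N u v s) 1 1 =
      1 - (1 / 2 : ℝ) * ‖clockVec G u - (-1 : ℂ) ^ (s : ℕ) • clockVec G v‖ ^ 2 := by
  have h := S.accept_family (B := 1) hG hu hv (fun _ : Unit => 1) (by simp) fun _ => s
  have hobs : obs (fun _ : Unit => (1 : Matrix (Fin d) (Fin d) ℂ)) (fun _ => s) =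
      (-1 : ℂ) ^ (s : ℕ) • 1 := by simp [obs]
  rw [hobs, tact_smul_right, tact_smul_right, tact_one_one, tact_one_one, cprob_one,
    Fintype.sum_unique] at h
  rw [prob_eq_re, h]
  have h3 : ∀ w : Space n (Player d κ), ‖w‖ ^ 2 = (inner ℂ w w : ℂ).re :=
    fun w => norm_sq_eq_re_inner (𝕜 := ℂ) w
  have h5 : ∀ z : ℂ, ((1 / 2 : ℂ) * z).re = 1 / 2 * z.re := by
    intro z
    rw [show (1 / 2 : ℂ) = ((1 / 2 : ℝ) : ℂ) by norm_num, Complex.re_ofReal_mul]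
  have h4 : (inner ℂ (clockVec G v) (clockVec G u) : ℂ).re =
    (inner ℂ (clockVec G u) (clockVec G v) : ℂ).re := inner_re_symm (𝕜 := ℂ) _ _
  rw [h3, inner_sub_left, inner_sub_right, inner_sub_right]
  simp only [inner_smul_right, inner_smul_left]
  fin_cases s
  · simp only [pow_zero, Complex.sub_re, Complex.add_re, h5, Complex.one_re, h4, one_mul,
      map_one]
    ring
  · simp only [pow_one, Complex.sub_re, Complex.add_re, h5, Complex.one_re, h4, neg_mul, one_mul,
      map_one, map_neg, Complex.neg_re, neg_neg]
    ring

/-- The acceptance probability of the initialization check. -/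
theorem initializationCheck_eq [NeZero n] (hG : S.ρ = G * Gᴴ) : S.initializationCheck =
    1 - (1 / (2 * n : ℝ)) * ∑ c, (1 / 4 : ℝ) *
      ‖clockVec (n := n) (d := d) G 0 - permute (flipBit c) (clockVec G 0)‖ ^ 2 := by
  have h3 : ∀ w : Space n (Player d κ), ‖w‖ ^ 2 = (inner ℂ w w : ℂ).re :=
    fun w => norm_sq_eq_re_inner (𝕜 := ℂ) w
  have h5 : ∀ z : ℂ, ((1 / 2 : ℂ) * z).re = 1 / 2 * z.re := by
    intro z
    rw [show (1 / 2 : ℂ) = ((1 / 2 : ℝ) : ℂ) by norm_num, Complex.re_ofReal_mul]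
  have hk : Matrix.vecMulVec (ket E.N 0) (star (ket E.N 0)) = ketbra E.N 0 0 := rfl
  have h1 : ∀ c : Fin n × XZ, S.prob (ketbra E.N 0 0) (reflProj (ctrlX c) 0) 1 =
      ‖clockVec (n := n) (d := d) G 0‖ ^ 2 - (1 / 4 : ℝ) *
        ‖clockVec (n := n) (d := d) G 0 - permute (flipBit c) (clockVec G 0)‖ ^ 2 := by
    intro c
    have h4 : (inner ℂ (permute (flipBit c) (clockVec (n := n) (d := d) G 0)) (clockVec G 0)
        : ℂ).re = (inner ℂ (clockVec (n := n) (d := d) G 0)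
          (permute (flipBit c) (clockVec G 0)) : ℂ).re := inner_re_symm (𝕜 := ℂ) _ _
    rw [prob_eq_re, reflProj, Fin.val_zero, pow_zero, one_smul, cprob_smul_mid, cprob_add_mid,
      S.cprob_ketbra hG (Nat.zero_le _) (Nat.zero_le _),
      S.cprob_ketbra hG (Nat.zero_le _) (Nat.zero_le _), tact_one_one, tact_ctrlX, h3, h3,
      inner_sub_left, inner_sub_right, inner_sub_right, LinearIsometry.inner_map_map]
    simp only [Complex.sub_re, Complex.add_re, h5, h4]
    ring
  have h0 : S.prob (1 - ketbra E.N 0 0) 1 1 = 1 - ‖clockVec (n := n) (d := d) G 0‖ ^ 2 := by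
    rw [prob_eq_re, cprob_sub_left, cprob_one,
      S.cprob_ketbra hG (Nat.zero_le _) (Nat.zero_le _), tact_one_one, h3, Complex.sub_re,
      Complex.one_re]
  have hn : (n : ℝ) ≠ 0 := by exact_mod_cast NeZero.ne n
  rw [initializationCheck, hk, h0, Finset.sum_congr rfl fun c _ => h1 c, Finset.sum_sub_distrib,
    Finset.sum_const, Finset.card_univ, Fintype.card_prod, Fintype.card_fin,
    show Fintype.card XZ = 2 from rfl, nsmul_eq_mul]
  push_cast
  field_simp
  ring

theorem norm_clockVec_sq_sum (hG : S.ρ = G * Gᴴ) :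
    ∑ t : Fin (E.N + 1), ‖clockVec (n := n) (d := d) G t‖ ^ 2 = 1 := by
  have h1 : (1 : Matrix (Fin (E.N + 1)) (Fin (E.N + 1)) ℂ) =
      ∑ t : Fin (E.N + 1), ketbra E.N t t := by
    ext s s'
    simp [Matrix.sum_apply, ketbra, ket, Matrix.vecMulVec_apply, ← Fin.ext_iff, Matrix.one_apply]
  have h2 := S.cprob_one
  have h3 : ∀ (s : Finset (Fin (E.N + 1))), S.cprob (∑ t ∈ s, ketbra E.N t t) 1 1 =
      ∑ t ∈ s, S.cprob (ketbra E.N t t) 1 1 := by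
    intro s
    induction s using Finset.induction_on with
    | empty => simp [cprob]
    | insert a s ha ih => rw [Finset.sum_insert ha, Finset.sum_insert ha, cprob_add_left, ih]
  rw [h1, h3] at h2
  have h4 := congrArg Complex.re h2
  rw [Complex.re_sum, Complex.one_re] at h4
  rw [← h4]
  refine Finset.sum_congr rfl fun t _ => ?_
  rw [S.cprob_ketbra hG (Nat.lt_succ_iff.mp t.2) (Nat.lt_succ_iff.mp t.2), tact_one_one]
  exact norm_sq_eq_re_inner (𝕜 := ℂ) _

end Strategy

end PauliGame

namespace PauliGame

theorem Listing.constraints_length_pos {n k : ℕ} [NeZero k] [NeZero n] (E : Listing n k) :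
    0 < E.constraints.length :=
  List.length_pos_of_mem ((E.mem_constraints _).mpr (IsConstraint.anticommute 0))

/-! ### From the value of a strategy to approximate clock relations -/

namespace Strategy

variable {n k : ℕ} [NeZero k] [NeZero n] {E : Listing n k} {d : ℕ} (S : Strategy E d)
  {κ : Type} [Fintype κ] {G : Matrix (Fin (E.N + 1) × Ctrl n × Fin d) κ ℂ}

/-- The rejection probability in the propagation check, in terms of the clock blocks. -/
def propLoss (G : Matrix (Fin (E.N + 1) × Ctrl n × Fin d) κ ℂ) : ℝ :=
  (1 / (E.N : ℝ)) * ∑ i : Fin E.N, (1 / 2 : ℝ) * ‖clockVec (n := n) (d := d) G i -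
    (S.reflections κ).act (E.seqU.get i) (clockVec G ((i : ℕ) + 1))‖ ^ 2

/-- The rejection probability in the initialization check, in terms of the clock blocks. -/
def initLoss (G : Matrix (Fin (E.N + 1) × Ctrl n × Fin d) κ ℂ) : ℝ :=
  (1 / (2 * n : ℝ)) * ∑ c, (1 / 4 : ℝ) *
    ‖clockVec (n := n) (d := d) G 0 - permute (flipBit c) (clockVec G 0)‖ ^ 2

/-- The rejection probability in the constraint check, in terms of the clock blocks. -/
def consLoss (G : Matrix (Fin (E.N + 1) × Ctrl n × Fin d) κ ℂ) : ℝ :=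
  (1 / ((2 * n) * E.seqs.length * E.constraints.length : ℝ)) *
    ∑ i : Fin (2 * n), ∑ l : Fin E.seqs.length, ∑ j : Fin E.constraints.length, (1 / 2 : ℝ) *
      ‖clockVec (n := n) (d := d) G (E.vertex l i j) -
        (-1 : ℂ) ^ ((E.constraints.get j).sign : ℕ) •
          clockVec G (E.vertex l i ((j : ℕ) + 1))‖ ^ 2

theorem propagationCheck_eq (hG : S.ρ = G * Gᴴ) : S.propagationCheck = 1 - S.propLoss G := by
  have hN : (E.N : ℝ) ≠ 0 := by exact_mod_cast E.N_pos.ne'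
  have hacc : ∀ i : Fin E.N, S.edgeAccept (i : ℕ) ((i : ℕ) + 1) (E.seqU.get i) =
      1 - (1 / 2 : ℝ) * ‖clockVec (n := n) (d := d) G i -
        (S.reflections κ).act (E.seqU.get i) (clockVec G ((i : ℕ) + 1))‖ ^ 2 :=
    fun i => S.edgeAccept_eq hG (by omega) (by omega) (E.seqU.get i)
  rw [propagationCheck, Finset.sum_congr rfl fun i _ => hacc i, Finset.sum_sub_distrib, mul_sub, propLoss]
  congr 1
  rw [Finset.sum_const, Finset.card_univ, Fintype.card_fin, nsmul_eq_mul]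
  field_simp

theorem constraintCheck_eq (hG : S.ρ = G * Gᴴ) :
    S.constraintCheck = 1 - consLoss (E := E) (d := d) G := by
  have hn : (n : ℝ) ≠ 0 := by exact_mod_cast NeZero.ne n
  have hL : (E.seqs.length : ℝ) ≠ 0 := by exact_mod_cast E.seqs_length_pos.ne'
  have hm : (E.constraints.length : ℝ) ≠ 0 := by exact_mod_cast E.constraints_length_pos.ne'
  have h1 : ∀ (i : Fin (2 * n)) (l : Fin E.seqs.length) (j : Fin E.constraints.length),
      S.prob (edgeRest E.N (E.vertex l i j) (E.vertex l i ((j : ℕ) + 1))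
        + edgeProj E.N (E.vertex l i j) (E.vertex l i ((j : ℕ) + 1)) (E.constraints.get j).sign)
        1 1 = 1 - (1 / 2 : ℝ) * ‖clockVec (n := n) (d := d) G (E.vertex l i j) -
        (-1 : ℂ) ^ ((E.constraints.get j).sign : ℕ) •
          clockVec G (E.vertex l i ((j : ℕ) + 1))‖ ^ 2 :=
    fun i l j => S.constraint_accept_eq hG (E.vertex_le_N l.2 i.2) (E.vertex_le_N l.2 i.2) _
  rw [constraintCheck, consLoss]
  simp only [h1, Finset.sum_sub_distrib, mul_sub]
  congr 1
  simp only [Finset.sum_const, Finset.card_univ, Fintype.card_fin, nsmul_eq_mul]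
  push_cast
  field_simp

theorem value_eq (hG : S.ρ = G * Gᴴ) : S.value =
    1 - (1 / 3) * (S.propLoss G + initLoss (E := E) (d := d) G +
      consLoss (E := E) (d := d) G) := by
  rw [value, S.propagationCheck_eq hG, S.initializationCheck_eq hG, S.constraintCheck_eq hG,
    initLoss]
  ring

theorem propLoss_nonneg : 0 ≤ S.propLoss G := by unfold propLoss; positivity

theorem initLoss_nonneg : 0 ≤ initLoss (E := E) (d := d) G := by unfold initLoss; positivity

theorem consLoss_nonneg : 0 ≤ consLoss (E := E) (d := d) G := by unfold consLoss; positivity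

theorem exists_factor : ∃ G : Matrix (Fin (E.N + 1) × Ctrl n × Fin d)
    (Fin (E.N + 1) × Ctrl n × Fin d) ℂ, S.ρ = G * Gᴴ := by
  open scoped MatrixOrder in
  obtain ⟨B, hB⟩ := CStarAlgebra.nonneg_iff_eq_star_mul_self.mp S.ρ_pos.nonneg
  exact ⟨Bᴴ, by rw [Matrix.conjTranspose_conjTranspose]; exact hB⟩

theorem value_le_one : S.value ≤ 1 := by
  obtain ⟨G, hG⟩ := S.exists_factor
  rw [S.value_eq hG]
  have := S.propLoss_nonneg (G := G)
  have := initLoss_nonneg (E := E) (d := d) (G := G)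
  have := consLoss_nonneg (E := E) (d := d) (G := G)
  linarith

/-- Each of the three losses is at most `3 ε`. Singling out one term multiplies by the number of
choices, at most `N ^ 3` in the constraint check. The factor `1 / 4` in the initialization loss
determines the constant `12 = 3 * 4`. -/
theorem approxClock (hG : S.ρ = G * Gᴴ) {ε : ℝ} (hε : 0 ≤ ε) (hv : 1 - ε ≤ S.value) :
    ApproxClock (S.reflections κ) E (√(12 * E.N ^ 3 * ε)) (clockVec G) := by
  rw [S.value_eq hG] at hv
  have h1 := S.propLoss_nonneg (G := G)
  have h2 := initLoss_nonneg (E := E) (d := d) (G := G)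
  have h3 := consLoss_nonneg (E := E) (d := d) (G := G)
  have hN : (1 : ℝ) ≤ E.N := by exact_mod_cast E.N_pos
  have hn : (0 : ℝ) < n := by exact_mod_cast Nat.pos_of_ne_zero (NeZero.ne n)
  have hnN : (2 * n : ℝ) ≤ E.N := by exact_mod_cast E.two_mul_le_N
  have hL : (0 : ℝ) < E.seqs.length := by exact_mod_cast E.seqs_length_pos
  have hm : (0 : ℝ) < E.constraints.length := by exact_mod_cast E.constraints_length_pos
  have hLN : (E.seqs.length : ℝ) ≤ E.N := by exact_mod_cast E.seqs_length_le_N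
  have hmN : (E.constraints.length : ℝ) ≤ E.N := by exact_mod_cast E.constraints_length_le_N
  have hN1 : (E.N : ℝ) * ε ≤ E.N ^ 3 * ε := by
    refine mul_le_mul_of_nonneg_right ?_ hε
    exact le_self_pow₀ hN (by norm_num)
  have hN3 : 0 ≤ (E.N : ℝ) ^ 3 * ε := by positivity
  have key : ∀ {a w s : ℝ}, 0 < w → 1 / w * s ≤ 3 * ε → a ≤ s → a ≤ w * (3 * ε) := by
    intro a w s hw h ha
    rw [one_div, inv_mul_le_iff₀ hw] at h
    exact ha.trans h
  constructor
  · intro i hi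
    refine Real.le_sqrt_of_sq_le ?_
    have h := key (w := E.N) (by linarith) (by rw [← propLoss]; linarith)
      (Finset.single_le_sum (f := fun i : Fin E.N => (1 / 2 : ℝ) *
        ‖clockVec (n := n) (d := d) G i -
          (S.reflections κ).act (E.seqU.get i) (clockVec G ((i : ℕ) + 1))‖ ^ 2)
        (fun _ _ => by positivity) (Finset.mem_univ (⟨i, hi⟩ : Fin E.N)))
    have h' : (1 / 2 : ℝ) * ‖clockVec (n := n) (d := d) G i -
      (S.reflections κ).act E.seqU[i] (clockVec G (i + 1))‖ ^ 2 ≤ E.N * (3 * ε) := h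
    linarith
  · intro c
    refine Real.le_sqrt_of_sq_le ?_
    have h := key (w := 2 * n) (by linarith) (by rw [← initLoss]; linarith)
      (Finset.single_le_sum (f := fun c : Fin n × XZ => (1 / 4 : ℝ) *
        ‖clockVec (n := n) (d := d) G 0 - permute (flipBit c) (clockVec G 0)‖ ^ 2)
        (fun _ _ => by positivity) (Finset.mem_univ c))
    have h5 := mul_le_mul_of_nonneg_right hnN hε
    linarith
  · intro i hi l hl j hj
    refine Real.le_sqrt_of_sq_le ?_
    let f : Fin (2 * n) → Fin E.seqs.length → Fin E.constraints.length → ℝ := fun i l j =>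
      (1 / 2 : ℝ) * ‖clockVec (n := n) (d := d) G (E.vertex l i j) -
        (-1 : ℂ) ^ ((E.constraints.get j).sign : ℕ) •
          clockVec G (E.vertex l i ((j : ℕ) + 1))‖ ^ 2
    have hf : ∀ i l j, 0 ≤ f i l j := fun i l j => by positivity
    have h := key (w := 2 * n * E.seqs.length * E.constraints.length) (by positivity)
      (s := ∑ i, ∑ l, ∑ j, f i l j) (a := f ⟨i, hi⟩ ⟨l, hl⟩ ⟨j, hj⟩)
      (by change consLoss (E := E) (d := d) G ≤ _; linarith)
      (((Finset.single_le_sum (f := fun j => f ⟨i, hi⟩ ⟨l, hl⟩ j) (fun _ _ => hf _ _ _)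
        (Finset.mem_univ _)).trans
        (Finset.single_le_sum (f := fun l => ∑ j, f ⟨i, hi⟩ l j)
          (fun _ _ => Finset.sum_nonneg fun _ _ => hf _ _ _) (Finset.mem_univ _))).trans
        (Finset.single_le_sum (f := fun i => ∑ l, ∑ j, f i l j)
          (fun _ _ => Finset.sum_nonneg fun _ _ => Finset.sum_nonneg fun _ _ => hf _ _ _)
          (Finset.mem_univ _)))
    have h5 : (2 * n * E.seqs.length * E.constraints.length : ℝ) * ε ≤ E.N ^ 3 * ε := by
      refine mul_le_mul_of_nonneg_right ?_ hε
      calc _ ≤ (E.N * E.N * E.N : ℝ) := by gcongr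
        _ = _ := by ring
    simp only [f, List.get_eq_getElem] at h
    linarith

/-- The unnormalized state of the player at clock value `0`. -/
theorem trace_mul_zeroBlock (hG : S.ρ = G * Gᴴ) (M : Matrix (Fin d) (Fin d) ℂ) :
    (M * S.zeroBlock).trace =
      ∑ x, inner ℂ (clockVec (n := n) G 0 x) (mact M (clockVec (n := n) G 0 x)) := by
  have h1 : (M * S.zeroBlock).trace = S.cprob (ketbra E.N 0 0) 1 M := by
    obtain ⟨z, hz⟩ : ∃ z : Fin (E.N + 1), z = 0 := ⟨_, rfl⟩
    obtain ⟨B, hB⟩ : ∃ B : Matrix (Ctrl n) (Ctrl n) ℂ, B = 1 := ⟨_, rfl⟩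
    have hkb : ∀ s t : Fin (E.N + 1), ketbra E.N 0 0 s t = if s = z ∧ t = z then 1 else 0 := by
      intro s t
      have hs : ∀ s : Fin (E.N + 1), (s : ℕ) = 0 ↔ s = z := by
        intro s; rw [hz, Fin.ext_iff]; rfl
      rw [ketbra, Matrix.vecMulVec_apply, Pi.star_apply, ket, ket]
      by_cases h1 : s = z <;> by_cases h2 : t = z <;> simp [hs, h1, h2]
    have h2 : S.cprob (ketbra E.N 0 0) B M =
        ∑ x : Ctrl n, ∑ r, ∑ s, M r s * S.ρ (z, x, s) (z, x, r) := by
      simp only [cprob, Matrix.trace, Matrix.diag, Matrix.mul_apply, Fintype.sum_prod_type,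
        Matrix.kroneckerMap_apply, hkb]
      rw [Finset.sum_eq_single z (fun t _ ht => by simp [ht]) (by simp)]
      refine Finset.sum_congr rfl fun x _ => Finset.sum_congr rfl fun r _ => ?_
      rw [Finset.sum_eq_single z (fun t _ ht => by simp [ht]) (by simp)]
      rw [Finset.sum_eq_single x (fun t _ ht => by simp [hB, Matrix.one_apply_ne ht.symm])
        (by simp)]
      simp [hB]
    rw [← hB, h2]
    simp only [Matrix.trace, Matrix.diag, Matrix.mul_apply, zeroBlock, Matrix.of_apply,
      Finset.mul_sum, ← hz]
    conv_rhs => rw [Finset.sum_comm]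
    exact Finset.sum_congr rfl fun r _ => Finset.sum_comm
  rw [h1, S.cprob_ketbra hG (Nat.zero_le _) (Nat.zero_le _), PiLp.inner_apply]
  simp only [tact_one_left]

theorem p₀_eq (hG : S.ρ = G * Gᴴ) : S.p₀ = ‖clockVec (n := n) (d := d) G 0‖ ^ 2 := by
  have h := S.trace_mul_zeroBlock hG 1
  rw [Matrix.one_mul] at h
  rw [p₀, h, PiLp.norm_sq_eq_of_L2, Complex.re_sum]
  refine Finset.sum_congr rfl fun x _ => ?_
  rw [mact_one]
  exact (norm_sq_eq_re_inner (𝕜 := ℂ) _).symm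

end Strategy

theorem ApproxClock.norm_near {n k : ℕ} [NeZero k] {F : Type*} [NormedAddCommGroup F]
    [NormedSpace ℂ F] {R : Reflections n k F} {E : Listing n k} {δ : ℝ} {Ψ : ℕ → Space n F}
    (h : ApproxClock R E δ Ψ) (t : ℕ) (ht : t ≤ E.N) : |‖Ψ 0‖ - ‖Ψ t‖| ≤ t * δ := by
  have h1 := norm_sub_word_le h.prop (E.seqU.take t) [] (E.seqU.drop t) (by simp)
  have hlen : (E.seqU.take t).length = t := by
    rw [List.length_take]; exact min_eq_left ht
  rw [hlen, List.length_nil, zero_add] at h1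
  refine (le_trans ?_ h1)
  rw [← (R.word (E.seqU.take t)).norm_map (Ψ t)]
  exact abs_norm_sub_norm_le _ _

/-- The probability of the clock value `0` is close to uniform. -/
theorem Strategy.abs_p₀_sub_le {n k : ℕ} [NeZero k] [NeZero n] {E : Listing n k} {d : ℕ}
    (S : Strategy E d) {κ : Type} [Fintype κ]
    {G : Matrix (Fin (E.N + 1) × Ctrl n × Fin d) κ ℂ} (hG : S.ρ = G * Gᴴ) {δ : ℝ} (hδ : 0 ≤ δ)
    (h : ApproxClock (S.reflections κ) E δ (clockVec G)) :
    |S.p₀ - 1 / ((E.N : ℝ) + 1)| ≤ 2 * E.N * δ := by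
  have hsum := S.norm_clockVec_sq_sum hG
  rw [S.p₀_eq hG]
  have hle : ∀ t : Fin (E.N + 1), ‖clockVec (n := n) (d := d) G t‖ ≤ 1 := by
    intro t
    have h1 := Finset.single_le_sum (f := fun t : Fin (E.N + 1) =>
      ‖clockVec (n := n) (d := d) G t‖ ^ 2) (fun _ _ => by positivity) (Finset.mem_univ t)
    rw [hsum] at h1
    exact (sq_le_one_iff₀ (norm_nonneg _)).mp h1
  have hdiff : ∀ t : Fin (E.N + 1), |‖clockVec (n := n) (d := d) G 0‖ ^ 2 -
      ‖clockVec (n := n) (d := d) G t‖ ^ 2| ≤ 2 * E.N * δ := by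
    intro t
    have h1 := h.norm_near t (Nat.lt_succ_iff.mp t.2)
    have h2 : ((t : ℕ) : ℝ) ≤ E.N := by exact_mod_cast Nat.lt_succ_iff.mp t.2
    have h3 := hle t
    have h4 : ‖clockVec (n := n) (d := d) G 0‖ ≤ 1 := hle 0
    rw [sq_sub_sq, abs_mul, abs_of_nonneg (by positivity)]
    calc _ ≤ 2 * (E.N * δ) := by
          refine mul_le_mul (by linarith) (h1.trans (by gcongr)) (abs_nonneg _) (by norm_num)
      _ = _ := by ring
  have hN : (0 : ℝ) < E.N + 1 := by positivity
  -- The squared norms sum to `1`, so the deviation from the uniform value is an average of their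
  -- differences.
  have h5 : ((E.N : ℝ) + 1) * ‖clockVec (n := n) (d := d) G 0‖ ^ 2 - 1 =
      ∑ t : Fin (E.N + 1), (‖clockVec (n := n) (d := d) G 0‖ ^ 2 -
        ‖clockVec (n := n) (d := d) G t‖ ^ 2) := by
    rw [Finset.sum_sub_distrib, hsum, Finset.sum_const, Finset.card_univ, Fintype.card_fin,
      nsmul_eq_mul]
    push_cast; ring
  have h6 : |((E.N : ℝ) + 1) * ‖clockVec (n := n) (d := d) G 0‖ ^ 2 - 1| ≤
      (E.N + 1) * (2 * E.N * δ) := by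
    rw [h5]
    refine (Finset.abs_sum_le_sum_abs _ _).trans
      ((Finset.sum_le_sum fun t _ => hdiff t).trans_eq ?_)
    rw [Finset.sum_const, Finset.card_univ, Fintype.card_fin, nsmul_eq_mul]
    push_cast; ring
  have h7 : ‖clockVec (n := n) (d := d) G 0‖ ^ 2 - 1 / ((E.N : ℝ) + 1) =
      (((E.N : ℝ) + 1) * ‖clockVec (n := n) (d := d) G 0‖ ^ 2 - 1) / (E.N + 1) := by
    field_simp
  rw [h7, abs_div, abs_of_pos hN, div_le_iff₀ hN]
  linarith

end PauliGame

namespace PauliGame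

/-! ## Decoding the control register -/

section Decode

variable {n : ℕ}

/-- The control bits grouped by qubits. -/
def ctrlEquiv (n : ℕ) : Ctrl n ≃ (Fin n → Fin 2 × Fin 2) where
  toFun x u := (x (u, XZ.X), x (u, XZ.Z))
  invFun y c := match c with
    | (u, XZ.X) => (y u).1
    | (u, XZ.Z) => (y u).2
  left_inv x := by ext ⟨u, D⟩ : 1; cases D <;> rfl
  right_inv y := rfl

/-- Two families of bits combined into a family of pairs. -/
def pairEquiv (n : ℕ) : ((Fin n → Fin 2) × (Fin n → Fin 2)) ≃ (Fin n → Fin 2 × Fin 2) where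
  toFun p u := (p.1 u, p.2 u)
  invFun y := (fun u => (y u).1, fun u => (y u).2)
  left_inv _ := rfl
  right_inv _ := rfl

/-- The decoding operation on all qubits. -/
def decoderMatrix (n : ℕ) : Matrix ((Fin n → Fin 2) × (Fin n → Fin 2)) (Ctrl n) ℂ :=
  (tens fun _ => decoder).submatrix (pairEquiv n) (ctrlEquiv n)

theorem decoderMatrix_isometry : (decoderMatrix n)ᴴ * decoderMatrix n = 1 := by
  rw [decoderMatrix, Matrix.conjTranspose_submatrix, Matrix.submatrix_mul_equiv,
    tens_conjTranspose, tens_mul]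
  simp only [decoder_isometry, tens_one, Matrix.submatrix_one_equiv]

/-- The matrix of an encoded letter on the control register. -/
def encMatrix (D : XZ) (u : Fin n) : Matrix (Ctrl n) (Ctrl n) ℂ :=
  (site u (encLetter D)).submatrix (ctrlEquiv n) (ctrlEquiv n)

theorem site_apply {α : Type*} [DecidableEq α] (u : Fin n) (m : Matrix α α ℂ)
    (x y : Fin n → α) : site u m x y = if ∀ v, v ≠ u → x v = y v then m (x u) (y u) else 0 := by
  rw [site, tens, Matrix.of_apply, ← Finset.mul_prod_erase _ _ (Finset.mem_univ u), if_pos rfl]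
  split_ifs with h
  · rw [Finset.prod_eq_one, mul_one]
    intro v hv
    have hvu := Finset.ne_of_mem_erase hv
    rw [if_neg hvu, h v hvu, Matrix.one_apply_eq]
  · push Not at h
    obtain ⟨v, hvu, hv⟩ := h
    rw [Finset.prod_eq_zero (i := v) (by simp [hvu]) (by simp [hvu, hv]), mul_zero]

theorem site_kronecker_one (u : Fin n) (m : Matrix (Fin 2) (Fin 2) ℂ) :
    (site u (m ⊗ₖ (1 : Matrix (Fin 2) (Fin 2) ℂ))).submatrix (pairEquiv n) (pairEquiv n) =
      site u m ⊗ₖ (1 : Matrix (Fin n → Fin 2) (Fin n → Fin 2) ℂ) := by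
  ext ⟨y, c⟩ ⟨y', c'⟩
  have h : (site u m ⊗ₖ (1 : Matrix (Fin n → Fin 2) (Fin n → Fin 2) ℂ)) (y, c) (y', c') =
    site u m y y' * (1 : Matrix (Fin n → Fin 2) (Fin n → Fin 2) ℂ) c c' := rfl
  rw [h, Matrix.submatrix_apply, site_apply, site_apply, Matrix.one_apply,
    Matrix.kroneckerMap_apply, Matrix.one_apply]
  simp only [pairEquiv, Equiv.coe_fn_mk, Prod.mk.injEq]
  by_cases hc : c = c'
  · subst hc; simp
  · rw [if_neg hc, mul_zero]
    by_cases h1 : ∀ v, v ≠ u → y v = y' v ∧ c v = c' v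
    · have h2 : c u ≠ c' u := fun h2 => hc (funext fun v => by
        by_cases hv : v = u
        · rw [hv]; exact h2
        · exact (h1 v hv).2)
      rw [if_pos h1]
      simp [h2]
    · rw [if_neg h1]

theorem decoderMatrix_mul_encMatrix (D : XZ) (u : Fin n) :
    decoderMatrix n * encMatrix D u =
      (site u (letterMatrix (some D)) ⊗ₖ (1 : Matrix (Fin n → Fin 2) (Fin n → Fin 2) ℂ)) *
        decoderMatrix n := by
  rw [← site_kronecker_one, decoderMatrix, encMatrix, Matrix.submatrix_mul_equiv,
    Matrix.submatrix_mul_equiv, site, site, tens_mul, tens_mul]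
  congr 2; funext v
  by_cases h : v = u
  · simp [h, decoder_mul_encLetter]
  · simp [h]

theorem encMatrix_apply (D : XZ) (u : Fin n) (x y : Ctrl n) :
    encMatrix D u x y = if y = flipBit (u, D) x then
      (if D = XZ.Z ∧ x (u, XZ.X) = 1 then -1 else 1) else 0 := by
  rw [encMatrix, Matrix.submatrix_apply, site_apply]
  simp only [ctrlEquiv, Equiv.coe_fn_mk, Prod.mk.injEq]
  by_cases hy : ∀ v, v ≠ u → x (v, XZ.X) = y (v, XZ.X) ∧ x (v, XZ.Z) = y (v, XZ.Z)
  · rw [if_pos hy]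
    have h1 : y = flipBit (u, D) x ↔ y (u, D) = 1 - x (u, D) ∧
        ∀ D', D' ≠ D → y (u, D') = x (u, D') := by
      constructor
      · rintro rfl
        exact ⟨flipBit_self _ _, fun D' h => flipBit_of_ne (by simp [h]) x⟩
      · rintro ⟨h1, h2⟩
        ext ⟨v, D'⟩ : 1
        by_cases hv : v = u
        · subst hv
          by_cases hD : D' = D
          · rw [hD, flipBit_self, h1]
          · rw [flipBit_of_ne (by simp [hD]), h2 D' hD]
        · rw [flipBit_of_ne (by simp [hv])]
          cases D'
          · exact (hy v hv).1.symm
          · exact (hy v hv).2.symm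
    have h2 : (∀ D', D' ≠ D → y (u, D') = x (u, D')) ↔
        (D ≠ XZ.X → y (u, XZ.X) = x (u, XZ.X)) ∧ (D ≠ XZ.Z → y (u, XZ.Z) = x (u, XZ.Z)) := by
      constructor
      · exact fun h => ⟨fun hD => h _ hD.symm, fun hD => h _ hD.symm⟩
      · rintro ⟨h, h'⟩ D' hD'
        cases D'
        · exact h hD'.symm
        · exact h' hD'.symm
    simp only [h1, h2]
    cases D
    · generalize x (u, XZ.X) = a
      generalize x (u, XZ.Z) = b
      generalize y (u, XZ.X) = a'
      generalize y (u, XZ.Z) = b'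
      fin_cases a <;> fin_cases b <;> fin_cases a' <;> fin_cases b' <;>
        simp [encLetter, letterMatrix]
    · generalize x (u, XZ.X) = a
      generalize x (u, XZ.Z) = b
      generalize y (u, XZ.X) = a'
      generalize y (u, XZ.Z) = b'
      fin_cases a <;> fin_cases b <;> fin_cases a' <;> fin_cases b' <;>
        simp [encLetter, letterMatrix]
  · rw [if_neg hy, if_neg]
    rintro rfl
    refine hy fun v hv => ⟨?_, ?_⟩ <;> rw [flipBit_of_ne (by simp [hv])]

variable {F : Type*} [NormedAddCommGroup F] [InnerProductSpace ℂ F]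

theorem mact_encMatrix (D : XZ) (u : Fin n) (ξ : Space n F) :
    mact (encMatrix D u) ξ = enc (D, u) ξ := by
  ext x : 1
  rw [mact_apply]
  simp only [encMatrix_apply, ite_smul, zero_smul, Finset.sum_ite_eq',
    Finset.mem_univ, if_true]
  cases D
  · simp [encX_apply]
  · simp [encZ_apply]

end Decode

/-! ## The isometry of the player -/

section PlayerIsometry

variable {n d : ℕ} {κ : Type} [Fintype κ]

/-- The dimension of the auxiliary space. -/
abbrev auxDim (n d : ℕ) : ℕ := Fintype.card ((Fin n → Fin 2) × Fin d)

/-- The numbering of the basis of the auxiliary space. -/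
def auxEquiv (n d : ℕ) : Fin (auxDim n d) ≃ (Fin n → Fin 2) × Fin d :=
  (Fintype.equivFin _).symm

/-- The space of `n` qubits, the auxiliary space and the purifying system. -/
abbrev Decoded (n d : ℕ) (κ : Type) [Fintype κ] : Type :=
  PiLp 2 (fun _ : (Fin n → Fin 2) × Fin (auxDim n d) => EuclideanSpace ℂ κ)

/-- The isometry from the control register and the player to the decoded space. -/
def decode : Space n (Player d κ) →ₗᵢ[ℂ] Decoded n d κ where
  toFun ξ := WithLp.toLp 2 fun p =>
    mact (decoderMatrix n) ξ (p.1, (auxEquiv n d p.2).1) (auxEquiv n d p.2).2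
  map_add' ξ ξ' := by ext p; simp
  map_smul' c ξ := by ext p; simp
  norm_map' ξ := by
    rw [← norm_mact decoderMatrix_isometry ξ]
    refine (pow_left_inj₀ (norm_nonneg _) (norm_nonneg _) two_ne_zero).mp ?_
    rw [PiLp.norm_sq_eq_of_L2, PiLp.norm_sq_eq_of_L2]
    simp only [LinearMap.coe_mk, AddHom.coe_mk, Fintype.sum_prod_type]
    refine Finset.sum_congr rfl fun y _ => ?_
    rw [Equiv.sum_comp (auxEquiv n d) fun q => ‖(mact (decoderMatrix n) ξ (y, q.1)) q.2‖ ^ 2,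
      Fintype.sum_prod_type]
    refine Finset.sum_congr rfl fun c _ => ?_
    rw [PiLp.norm_sq_eq_of_L2]

theorem decode_apply (ξ : Space n (Player d κ)) (p : (Fin n → Fin 2) × Fin (auxDim n d)) :
    decode ξ p = mact (decoderMatrix n) ξ (p.1, (auxEquiv n d p.2).1) (auxEquiv n d p.2).2 := rfl

/-- An operator on the qubits acting on the decoded space. -/
abbrev qubitAct (A : Matrix (Fin n → Fin 2) (Fin n → Fin 2) ℂ) (v : Decoded n d κ) :
    Decoded n d κ := mact (A ⊗ₖ (1 : Matrix (Fin (auxDim n d)) (Fin (auxDim n d)) ℂ)) v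

theorem qubitAct_mul (A B : Matrix (Fin n → Fin 2) (Fin n → Fin 2) ℂ) (v : Decoded n d κ) :
    qubitAct (A * B) v = qubitAct A (qubitAct B v) := by
  rw [qubitAct, qubitAct, qubitAct, ← mact_mul, ← Matrix.mul_kronecker_mul, one_mul]

theorem qubitAct_one (v : Decoded n d κ) : qubitAct 1 v = v := by
  rw [qubitAct, Matrix.one_kronecker_one, mact_one]

theorem qubitAct_apply (A : Matrix (Fin n → Fin 2) (Fin n → Fin 2) ℂ) (v : Decoded n d κ)
    (p : (Fin n → Fin 2) × Fin (auxDim n d)) :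
    qubitAct A v p = ∑ y, A p.1 y • v (y, p.2) := by
  simp [qubitAct, mact_apply, Fintype.sum_prod_type, Matrix.one_apply]

/-- The decoder turns an encoded letter into a letter on the first bit of the qubit's pair. The
second bits join the player in the auxiliary space, on which the letter acts trivially. -/
theorem qubitAct_letter (D : XZ) (u : Fin n) (ξ : Space n (Player d κ)) :
    qubitAct (site u (letterMatrix (some D))) (decode ξ) = decode (enc (D, u) ξ) := by
  ext p : 1
  rw [qubitAct_apply, decode_apply, ← mact_encMatrix, ← mact_mul, decoderMatrix_mul_encMatrix,
    mact_mul, mact_apply]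
  simp only [decode_apply, Fintype.sum_prod_type, Matrix.kroneckerMap_apply, Matrix.one_apply,
    mul_ite, mul_one, mul_zero, ite_smul, zero_smul, Finset.sum_ite_eq, Finset.mem_univ, if_true,
    WithLp.ofLp_sum, WithLp.ofLp_smul, Finset.sum_apply, Pi.smul_apply]

theorem qubitAct_pauli {k : ℕ} [NeZero k] (P : Pauli n k) (ξ : Space n (Player d κ)) :
    qubitAct (pauliMatrix P.1) (decode ξ) = decode (encWord (letters P) ξ) := by
  rw [← prod_letters]
  induction letters P with
  | nil => simp [qubitAct_one]
  | cons a l ih =>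
    rw [List.map_cons, List.prod_cons, qubitAct_mul, ih, qubitAct_letter, encWord_cons]
    rfl

theorem qubitAct_jointProj {k : ℕ} [NeZero k] (Q : MultiPauli n k) (b : Q.1 → Fin 2)
    (ξ : Space n (Player d κ)) : qubitAct (jointProj Q b) (decode ξ) =
      decode ((Q.1.attach.toList.map fun P => eigenProj (encWord (letters P.1)) (b P)).prod ξ) := by
  rw [jointProj]
  induction Q.1.attach.toList with
  | nil => simp [qubitAct_one]
  | cons P l ih =>
    rw [List.map_cons, List.prod_cons, qubitAct_mul, ih, List.map_cons, List.prod_cons,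
      Module.End.mul_apply, eigenProj_apply, map_smul, map_add, map_smul, ← qubitAct_pauli]
    rw [qubitAct, reflProj, Matrix.smul_kronecker, Matrix.add_kronecker, Matrix.smul_kronecker,
      mact_smul, mact_add, mact_smul, Matrix.one_kronecker_one, mact_one]

end PlayerIsometry

/-! ### The isometry of the player as an explicit matrix -/

namespace Strategy

variable {n k : ℕ} [NeZero k] {E : Listing n k} {d : ℕ} (S : Strategy E d)

/-- The player's part of the controlled reflections for fixed control bits. -/
def lamMatrix : List (Fin n) → Ctrl n → Matrix (Fin d) (Fin d) ℂ
  | [], _ => 1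
  | u :: L, x => (if x (u, XZ.Z) = 1 then S.refl (weightOne u XZ.Z) else 1) *
      ((if x (u, XZ.X) = 1 then S.refl (weightOne u XZ.X) else 1) * lamMatrix L x)

/-- The matrix of the isometry of the player. -/
def isometryMatrix : Matrix ((Fin n → Fin 2) × Fin (auxDim n d)) (Fin d) ℂ :=
  Matrix.of fun p s => ∑ x, decoderMatrix n (p.1, (auxEquiv n d p.2).1) x *
    (((√(Fintype.card (Ctrl n) : ℝ) : ℝ) : ℂ)⁻¹ *
      S.lamMatrix (List.finRange n).reverse x (auxEquiv n d p.2).2 s)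

variable {κ : Type} [Fintype κ]

theorem lam_uniform_apply (L : List (Fin n)) (φ : Player d κ) (x : Ctrl n) :
    (S.reflections κ).lam L (uniform φ) x =
      ((√(Fintype.card (Ctrl n) : ℝ) : ℝ) : ℂ)⁻¹ • mact (S.lamMatrix L x) φ := by
  induction L with
  | nil => simp [Reflections.lam, uniform_apply, lamMatrix, mact_one]
  | cons u L ih =>
    rw [Reflections.lam_cons, Reflections.ctl_apply, Reflections.ctl_apply, ih, lamMatrix,
      mact_mul, mact_mul]
    split_ifs <;> simp [mact_one, reflections]

/-- The matrix depends only on the player's reflections. It implements decoding after `spread` for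
every purifying system, so estimates made on a purification concern one fixed `V`. -/
theorem mact_isometryMatrix (φ : Player d κ) :
    mact S.isometryMatrix φ = decode ((S.reflections κ).spread φ) := by
  ext p : 1
  have h (x : Ctrl n) : (S.reflections κ).spread φ x =
      ((√(Fintype.card (Ctrl n) : ℝ) : ℝ) : ℂ)⁻¹ •
        mact (S.lamMatrix (List.finRange n).reverse x) φ := S.lam_uniform_apply _ φ x
  rw [decode_apply, mact_apply, mact_apply]
  simp only [WithLp.ofLp_sum, WithLp.ofLp_smul, Finset.sum_apply, Pi.smul_apply, h]
  simp only [mact_apply, isometryMatrix, Matrix.of_apply, Finset.smul_sum, smul_smul,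
    Finset.sum_smul]
  rw [Finset.sum_comm]

/-- With a one-dimensional purifying system the action is that of the matrix on `ℂ^d`, where it is a
composition of isometries. -/
theorem isometryMatrix_isometry : (S.isometryMatrix)ᴴ * S.isometryMatrix = 1 := by
  have h1 : ∀ v w : Player d Unit,
      inner ℂ v (mact ((S.isometryMatrix)ᴴ * S.isometryMatrix) w) = (inner ℂ v w : ℂ) := by
    intro v w
    rw [mact_mul, ← inner_mact, mact_isometryMatrix, mact_isometryMatrix,
      LinearIsometry.inner_map_map, LinearIsometry.inner_map_map]
  have h2 : ∀ w : Player d Unit, mact ((S.isometryMatrix)ᴴ * S.isometryMatrix) w = w :=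
    fun w => ext_inner_left ℂ fun v => h1 v w
  ext r s
  have h3 := congrArg (fun v : Player d Unit => v r ())
    (h2 (WithLp.toLp 2 (Pi.single s (WithLp.toLp 2 fun _ => 1))))
  simp only [mact_apply] at h3
  rw [Finset.sum_eq_single s (fun t _ ht => by simp [Pi.single_eq_of_ne ht]) (by simp)] at h3
  rw [Matrix.one_apply]
  by_cases hrs : r = s
  · subst hrs; simpa using h3
  · simpa [hrs] using h3

end Strategy

end PauliGame

namespace PauliGame

/-! ## Joint spectral projections of commuting reflections -/

section JointProjections

variable {X : Type*} [Fintype X] [DecidableEq X]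

theorem mul_reflProj {A : Matrix X X ℂ} (h : A * A = 1) (a : Fin 2) :
    A * reflProj A a = (-1 : ℂ) ^ (a : ℕ) • reflProj A a := by
  rw [reflProj, Matrix.mul_smul, Matrix.mul_add, Matrix.mul_smul, h, Matrix.mul_one]
  fin_cases a <;> simp <;> module

theorem reflProj_mul_self {A : Matrix X X ℂ} (h : A * A = 1) (a : Fin 2) :
    reflProj A a * reflProj A a = reflProj A a := by
  nth_rewrite 1 [reflProj]
  rw [Matrix.smul_mul, Matrix.add_mul, Matrix.smul_mul, Matrix.one_mul, mul_reflProj h,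
    smul_smul, sign_mul_self, one_smul]
  module

theorem reflProj_isHermitian {A : Matrix X X ℂ} (h : A.IsHermitian) (a : Fin 2) :
    (reflProj A a).IsHermitian := by
  simp [reflProj, Matrix.IsHermitian, Matrix.conjTranspose_smul, h.eq]

theorem commute_reflProj {A B : Matrix X X ℂ} (h : Commute A B) (a : Fin 2) :
    Commute A (reflProj B a) :=
  ((Commute.one_right A).add_right (h.smul_right _)).smul_right _

variable {ι : Type*} {A : ι → Matrix X X ℂ} {b : ι → Fin 2}

theorem commute_prod_reflProj {T : Matrix X X ℂ} {l : List ι} (h : ∀ i ∈ l, Commute T (A i)) :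
    Commute T (l.map fun i => reflProj (A i) (b i)).prod := by
  refine Commute.list_prod_right _ _ fun M hM => ?_
  obtain ⟨i, hi, rfl⟩ := List.mem_map.mp hM
  exact commute_reflProj (h i hi) _

variable (comm : ∀ i j, Commute (A i) (A j))
include comm

theorem prod_reflProj_isHermitian (herm : ∀ i, (A i).IsHermitian) (l : List ι) :
    (l.map fun i => reflProj (A i) (b i)).prod.IsHermitian := by
  induction l with
  | nil => simp
  | cons i l ih =>
    rw [List.map_cons, List.prod_cons, Matrix.IsHermitian, Matrix.conjTranspose_mul, ih.eq,
      (reflProj_isHermitian (herm i) _).eq]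
    exact (commute_prod_reflProj fun j _ => (commute_reflProj (comm j i) _).symm).symm

theorem prod_reflProj_mul_self (sq : ∀ i, A i * A i = 1) (l : List ι) :
    (l.map fun i => reflProj (A i) (b i)).prod * (l.map fun i => reflProj (A i) (b i)).prod =
      (l.map fun i => reflProj (A i) (b i)).prod := by
  induction l with
  | nil => simp
  | cons i l ih =>
    rw [List.map_cons, List.prod_cons, Commute.mul_mul_mul_comm, ih, reflProj_mul_self (sq i)]
    exact (commute_prod_reflProj fun j _ => (commute_reflProj (comm j i) _).symm).symm

theorem mul_prod_reflProj (sq : ∀ i, A i * A i = 1) {l : List ι} {i : ι} (hi : i ∈ l) :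
    A i * (l.map fun i => reflProj (A i) (b i)).prod =
      (-1 : ℂ) ^ (b i : ℕ) • (l.map fun i => reflProj (A i) (b i)).prod := by
  induction l with
  | nil => simp at hi
  | cons j l ih =>
    rw [List.map_cons, List.prod_cons]
    rcases List.mem_cons.mp hi with rfl | hi
    · rw [← Matrix.mul_assoc, mul_reflProj (sq i), Matrix.smul_mul]
    · rw [← Matrix.mul_assoc, (commute_reflProj (comm i j) _).eq, Matrix.mul_assoc, ih hi,
        Matrix.mul_smul]

omit comm

variable [Fintype ι] [DecidableEq ι]

/-- Bits outside `l` are free and each contributes a factor `2`; for a list of all indices the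
scalar is `1`. -/
theorem sum_prod_reflProj {l : List ι} (hl : l.Nodup) :
    ∑ b : ι → Fin 2, (l.map fun i => reflProj (A i) (b i)).prod =
      ((1 / 2 : ℂ) ^ l.length * 2 ^ Fintype.card ι) • 1 := by
  induction l with
  | nil => simp [Algebra.smul_def, map_ofNat (algebraMap ℂ (Matrix X X ℂ)) 2]
  | cons j l ih =>
    obtain ⟨hj, hl⟩ := List.nodup_cons.mp hl
    -- Pairing `b` with its flip at `j` adds up the two complementary projections of `A j`. The
    -- other factors do not see bit `j`, because `j ∉ l`.
    let flip : (ι → Fin 2) ≃ (ι → Fin 2) :=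
      Function.Involutive.toPerm (fun b => Function.update b j (1 - b j)) fun b => by
        ext i : 1
        by_cases h : i = j <;> simp [h]
    have h1 : ∑ b : ι → Fin 2, ((j :: l).map fun i => reflProj (A i) (b i)).prod =
        ∑ b : ι → Fin 2, reflProj (A j) (1 - b j) *
          (l.map fun i => reflProj (A i) (b i)).prod := by
      rw [← flip.sum_comp]
      refine Finset.sum_congr rfl fun b _ => ?_
      have hb : ∀ i ∈ l, flip b i = b i := fun i hi =>
        Function.update_of_ne (fun h => hj (by rwa [← h])) _ _
      rw [List.map_cons, List.prod_cons, show flip b j = 1 - b j from Function.update_self _ _ _,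
        List.map_congr_left fun i hi => by rw [hb i hi]]
    have h2 : ∀ a : Fin 2, reflProj (A j) a + reflProj (A j) (1 - a) = 1 := by
      intro a
      fin_cases a <;> simp [reflProj] <;> module
    have h3 : (2 : ℂ) • ∑ b : ι → Fin 2, ((j :: l).map fun i => reflProj (A i) (b i)).prod =
        ∑ b : ι → Fin 2, (l.map fun i => reflProj (A i) (b i)).prod := by
      rw [two_smul]
      nth_rewrite 2 [h1]
      rw [← Finset.sum_add_distrib]
      refine Finset.sum_congr rfl fun b _ => ?_
      rw [List.map_cons, List.prod_cons, ← Matrix.add_mul, h2, Matrix.one_mul]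
    rw [ih hl] at h3
    have h4 := congrArg (fun M => (1 / 2 : ℂ) • M) h3
    simp only [smul_smul] at h4
    rw [show (1 / 2 : ℂ) * 2 = 1 by norm_num, one_smul] at h4
    rw [h4, List.length_cons, pow_succ]
    congr 1
    ring

/-- A projective measurement with several binary outcomes is the product of the spectral
projections of the reflections that record the single outcomes. -/
theorem prod_reflProj_obs {p : (ι → Fin 2) → Matrix X X ℂ} (herm : ∀ b, (p b).IsHermitian)
    (idem : ∀ b, p b * p b = p b) (sum : ∑ b, p b = 1) (b : ι → Fin 2) {l : List ι}
    (hl : ∀ i, i ∈ l) :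
    (l.map fun i => reflProj (obs p fun b => b i) (b i)).prod = p b := by
  have h1 : ∀ i b', reflProj (obs p fun b => b i) (b i) * p b' = if b i = b' i then p b' else 0 := by
    intro i b'
    rw [reflProj, Matrix.smul_mul, Matrix.add_mul, Matrix.smul_mul, obs_mul herm idem sum,
      Matrix.one_mul]
    generalize b i = s
    generalize b' i = t
    fin_cases s <;> fin_cases t <;> simp <;> module
  have h2 : ∀ (l : List ι) b', (l.map fun i => reflProj (obs p fun b => b i) (b i)).prod * p b' =
      if ∀ i ∈ l, b i = b' i then p b' else 0 := by
    intro l b'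
    induction l with
    | nil => simp
    | cons i l ih =>
      rw [List.map_cons, List.prod_cons, Matrix.mul_assoc, ih]
      by_cases h : ∀ i ∈ l, b i = b' i
      · rw [if_pos h, h1]
        simp only [List.forall_mem_cons, and_iff_left h]
      · rw [if_neg h, if_neg (fun h' => h fun j hj => h' j (by simp [hj])), Matrix.mul_zero]
  -- Each factor keeps those outcomes whose bit agrees with `b`. Inserting `∑ p b' = 1`, only `b' =
  -- b` survives, because `l` contains every index.
  rw [← Matrix.mul_one (List.prod _), ← sum, Finset.mul_sum, Finset.sum_eq_single b]
  · rw [h2, if_pos fun _ _ => rfl]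
  · intro b' _ hb'
    rw [h2, if_neg]
    exact fun h => hb' (funext fun i => (h i (hl i)).symm)
  · simp

end JointProjections

section JointProj

variable {n k : ℕ} (Q : MultiPauli n k)

theorem commute_members (P P' : Q.1) : Commute (pauliMatrix P.1.1) (pauliMatrix P'.1.1) :=
  Q.2.2.1 _ P.2 _ P'.2

theorem jointProj_isHermitian (b : Q.1 → Fin 2) : (jointProj Q b).IsHermitian :=
  prod_reflProj_isHermitian (A := fun P : Q.1 => pauliMatrix P.1.1) (commute_members Q)
    (fun _ => pauliMatrix_herm _) _

theorem jointProj_mul_self (b : Q.1 → Fin 2) : jointProj Q b * jointProj Q b = jointProj Q b :=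
  prod_reflProj_mul_self (A := fun P : Q.1 => pauliMatrix P.1.1) (commute_members Q)
    (fun _ => pauliMatrix_sq _) _

theorem sum_jointProj : ∑ b, jointProj Q b = 1 := by
  have h := sum_prod_reflProj (A := fun P : Q.1 => pauliMatrix P.1.1)
    (Finset.nodup_toList Q.1.attach)
  rw [Finset.length_toList, Finset.card_attach, Fintype.card_coe, ← mul_pow] at h
  simpa [jointProj] using h

/-- On the range of a joint projection `P` acts by its recorded eigenvalue, and the joint
projections sum to `1`. So the honest measurement realizes `P|Q` as `P`. -/
theorem obs_jointProj (P : Q.1) : obs (jointProj Q) (fun b => b P) = pauliMatrix P.1.1 := by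
  rw [← Matrix.mul_one (pauliMatrix P.1.1), ← sum_jointProj Q, Finset.mul_sum, obs]
  refine Finset.sum_congr rfl fun b _ => ?_
  exact (mul_prod_reflProj (A := fun P : Q.1 => pauliMatrix P.1.1) (commute_members Q)
    (fun _ => pauliMatrix_sq _) (by simp)).symm

end JointProj

end PauliGame

namespace PauliGame

/-! ## The honest strategy -/

/-- The position of a copy of `𝔙` in the sequence. -/
theorem Listing.exists_copy {n k : ℕ} [NeZero k] {E : Listing n k} {l i : ℕ}
    (hl : l < E.seqs.length) (hi : i < 2 * n) :
    ∃ pre post, E.seqU = pre ++ (E.seqV ++ post) ∧ pre.length = E.vertex l i 0 := by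
  have hm : i / 2 < (List.finRange n).length := by rw [List.length_finRange]; omega
  have hsplit : List.finRange n = (List.finRange n).take (i / 2) ++
      (List.finRange n)[i / 2] :: (List.finRange n).drop (i / 2 + 1) := by
    rw [← List.drop_eq_getElem_cons hm, List.take_append_drop]
  have : NeZero n := ⟨by omega⟩
  obtain ⟨pre, post, hU, hlen⟩ := Listing.exists_position (E := E) hl hsplit
  have htake : ((List.finRange n).take (i / 2)).length = i / 2 := by
    rw [List.length_take]; exact min_eq_left hm.le
  rw [htake] at hlen
  rw [Listing.qubitBlock] at hU
  rcases Nat.mod_two_eq_zero_or_one i with h | h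
  · refine ⟨pre, _, by rw [hU]; simp only [List.append_assoc]; rfl, ?_⟩
    rw [hlen]; congr 1; omega
  · refine ⟨pre ++ (E.seqV ++ [_]), _, by
      rw [hU]; simp only [List.append_assoc]; rfl, ?_⟩
    rw [List.length_append, hlen, E.vertex_eq hl, E.vertex_eq hl]
    simp only [List.length_append, List.length_cons, List.length_nil]
    have hi2 : i * (E.seqV.length + 1) = (2 * (i / 2) + 1) * (E.seqV.length + 1) := by
      congr 1; omega
    rw [hi2]
    ring

section Honest

variable {n k : ℕ}

/-- The Pauli operator of a label. -/
def labelMatrix : Label n k → Matrix (Fin n → Fin 2) (Fin n → Fin 2) ℂ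
  | Label.single P => pauliMatrix P.1
  | Label.derived _ P => pauliMatrix P.1.1
  | Label.controlled _ _ => 1

/-- The Pauli operators satisfy the constraints. -/
theorem prod_labelMatrix [NeZero k] {c : Constraint n k} (h : IsConstraint c) :
    (c.word.map labelMatrix).prod = (-1 : ℂ) ^ (c.sign : ℕ) • 1 := by
  have hone : ∀ (D : XZ) (u : Fin n), labelMatrix (one (k := k) D u) =
      site u (letterMatrix (some D)) := fun D u => pauliMatrix_weightOne u D
  have hsq : ∀ (D : XZ) (u : Fin n),
      site u (letterMatrix (some D)) * site u (letterMatrix (some D)) = 1 := by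
    intro D u
    rw [site_mul_site, letterMatrix_sq, site_one]
  have hanti : ∀ u : Fin n, site u (letterMatrix (some XZ.X)) * (site u (letterMatrix (some XZ.Z)) *
      (site u (letterMatrix (some XZ.X)) * site u (letterMatrix (some XZ.Z)))) = -1 := by
    intro u
    have h : site u (letterMatrix (some XZ.X)) * site u (letterMatrix (some XZ.Z)) =
        -(site u (letterMatrix (some XZ.Z)) * site u (letterMatrix (some XZ.X))) := by
      rw [site_mul_site, letterMatrix_anticomm, site_neg, ← site_mul_site]
    rw [← Matrix.mul_assoc]
    nth_rewrite 1 [h]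
    rw [Matrix.neg_mul, Matrix.mul_assoc, ← Matrix.mul_assoc (site u (letterMatrix (some XZ.X))),
      hsq, Matrix.one_mul, hsq]
  cases h with
  | commute u v huv D E =>
    simp only [List.map_cons, List.map_nil, List.prod_cons, List.prod_nil, hone, Matrix.mul_one]
    rw [← Matrix.mul_assoc (site v _), site_comm huv.symm, Matrix.mul_assoc (site u _), hsq,
      Matrix.mul_one, hsq]
    simp
  | anticommute u =>
    simp only [List.map_cons, List.map_nil, List.prod_cons, List.prod_nil, hone, Matrix.mul_one,
      hanti]
    simp
  | conjugate u v E =>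
    simp only [List.map_cons, List.map_nil, List.prod_cons, List.prod_nil, hone, Matrix.mul_one]
    have h := congrArg (fun M => site v (letterMatrix (some E)) *
      (M * site v (letterMatrix (some E)))) (hanti u)
    simp only [Matrix.mul_assoc] at h
    rw [h, Matrix.neg_mul, Matrix.one_mul, Matrix.mul_neg, hsq]
    simp
  | product P =>
    simp only [List.map_cons, List.prod_cons, factors_eq, List.map_map]
    have h : labelMatrix ∘ (fun a : XZ × Fin n => one (k := k) a.1 a.2) =
        fun a => site a.2 (letterMatrix (some a.1)) := funext fun a => hone a.1 a.2
    rw [h, prod_letters]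
    simp [labelMatrix, pauliMatrix_sq]
  | consistent Q P => simp [labelMatrix, pauliMatrix_sq]

/-- Operators on `n` qubits as matrices of the format used for strategies. -/
def qubitEquiv (n : ℕ) : Matrix (Fin n → Fin 2) (Fin n → Fin 2) ℂ ≃ₐ[ℂ]
    Matrix (Fin (Fintype.card (Fin n → Fin 2))) (Fin (Fintype.card (Fin n → Fin 2))) ℂ :=
  Matrix.reindexAlgEquiv ℂ ℂ (Fintype.equivFin _)

theorem qubitEquiv_isHermitian {M : Matrix (Fin n → Fin 2) (Fin n → Fin 2) ℂ}
    (h : M.IsHermitian) : (qubitEquiv n M).IsHermitian := by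
  rw [qubitEquiv, Matrix.coe_reindexAlgEquiv, Matrix.IsHermitian, Matrix.conjTranspose_reindex,
    h.eq]

theorem qubitEquiv_pauli_sq (P : PauliString n) :
    qubitEquiv n (pauliMatrix P) * qubitEquiv n (pauliMatrix P) = 1 := by
  rw [← map_mul, pauliMatrix_sq, map_one]

theorem qubitEquiv_pauli_herm (P : PauliString n) :
    (qubitEquiv n (pauliMatrix P))ᴴ = qubitEquiv n (pauliMatrix P) :=
  qubitEquiv_isHermitian (pauliMatrix_herm P)

/-- The space of the honest player. -/
abbrev Honest (n : ℕ) : Type := Player (Fintype.card (Fin n → Fin 2)) Unit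

/-- The Pauli operators as reflections on the space of the honest player. -/
def honestReflections (n k : ℕ) : Reflections n k (Honest n) where
  single P := isom (qubitEquiv n (pauliMatrix P.1)) (by
    rw [qubitEquiv_pauli_herm, qubitEquiv_pauli_sq])
  derived Q P := isom (qubitEquiv n (pauliMatrix P.1.1)) (by
    rw [qubitEquiv_pauli_herm, qubitEquiv_pauli_sq])
  single_sq P := by
    ext v : 1
    rw [LinearIsometry.coe_mul, Function.comp_apply, isom_apply, isom_apply, ← mact_mul,
      qubitEquiv_pauli_sq, mact_one]
    rfl
  derived_sq Q P := by
    ext v : 1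
    rw [LinearIsometry.coe_mul, Function.comp_apply, isom_apply, isom_apply, ← mact_mul,
      qubitEquiv_pauli_sq, mact_one]
    rfl

theorem honestReflections_loc (a : Label n k) (v : Honest n) :
    (honestReflections n k).loc a v = mact (qubitEquiv n (labelMatrix a)) v := by
  cases a with
  | single P => rfl
  | derived Q P => rfl
  | controlled c P => rw [labelMatrix, map_one, mact_one]; rfl

theorem honestReflections_locWord (w : List (Label n k)) (v : Honest n) :
    (honestReflections n k).locWord w v = mact (qubitEquiv n (w.map labelMatrix).prod) v := by
  induction w with
  | nil => simp [mact_one]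
  | cons a w ih =>
    rw [Reflections.locWord_cons, LinearIsometry.coe_mul, Function.comp_apply, ih,
      honestReflections_loc, List.map_cons, List.prod_cons, map_mul, mact_mul]

theorem honestReflections_word [NeZero k] {c : Constraint n k} (h : IsConstraint c)
    (χ : Space n (Honest n)) :
    (honestReflections n k).word c.word χ = (-1 : ℂ) ^ (c.sign : ℕ) • χ := by
  rw [Reflections.word_of_isLocal _ (Reflections.isLocal_of_isConstraint h)]
  ext x : 1
  rw [diag_apply, honestReflections_locWord, prod_labelMatrix h, map_smul, map_one, mact_smul,
    mact_one]
  rfl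

variable [NeZero k] (E : Listing n k)

/-- The clock blocks of the honest state. -/
def honestVec (φ : Honest n) (t : ℕ) : Space n (Honest n) :=
  (honestReflections n k).word (E.seqU.take t).reverse (uniform φ)

theorem honestVec_prop (φ : Honest n) {i : ℕ} (h : i < E.seqU.length) :
    honestVec E φ i = (honestReflections n k).act E.seqU[i] (honestVec E φ (i + 1)) := by
  rw [honestVec, honestVec, List.take_succ_eq_append_getElem h, List.reverse_append,
    List.reverse_singleton, List.singleton_append, Reflections.word_cons,
    ← Function.comp_apply (f := (honestReflections n k).act _), ← LinearIsometry.coe_mul,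
    ← mul_assoc, Reflections.act_sq, one_mul]

theorem honestVec_init (φ : Honest n) (c : Fin n × XZ) :
    permute (flipBit c) (honestVec E φ 0) = honestVec E φ 0 := by
  rw [honestVec, List.take_zero, List.reverse_nil, Reflections.word_nil]
  exact permute_uniform _ _

/-- Propagation holds with error `0`, so the two blocks differ by the constraint word, which acts
exactly as its sign on every vector. -/
theorem honestVec_cons (φ : Honest n) {i l j : ℕ} (hi : i < 2 * n) (hl : l < E.seqs.length)
    (hj : j < E.constraints.length) : honestVec E φ (E.vertex l i j) =
      (-1 : ℂ) ^ (E.constraints[j].sign : ℕ) • honestVec E φ (E.vertex l i (j + 1)) := by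
  obtain ⟨pre, post, hU, hlen⟩ := Listing.exists_copy hl hi
  have hpos : (pre ++ E.firstWords j).length = E.vertex l i j := by
    rw [List.length_append, hlen, E.vertex_eq hl, E.vertex_eq hl, E.firstWords_zero]; simp
  have hpos' : (pre ++ E.firstWords j).length + E.constraints[j].word.length =
      E.vertex l i (j + 1) := by
    rw [hpos, E.vertex_eq hl, E.vertex_eq hl, E.firstWords_succ hj, List.length_append]; ring
  have h := norm_sub_word_le (R := honestReflections n k) (δ := 0) (Ψ := honestVec E φ)
    (fun i hi => by rw [← honestVec_prop E φ hi, sub_self, norm_zero])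
    E.constraints[j].word (pre ++ E.firstWords j)
    ((E.constraints.drop (j + 1)).flatMap Constraint.word ++ post)
    (by conv_lhs => rw [hU, E.seqV_split hj]
        simp)
  rw [hpos', hpos, mul_zero, honestReflections_word
    ((E.mem_constraints _).mp (List.getElem_mem hj))] at h
  exact sub_eq_zero.mp (norm_le_zero_iff.mp h)

theorem norm_honestVec (φ : Honest n) (t : ℕ) : ‖honestVec E φ t‖ = ‖φ‖ := by
  rw [honestVec, LinearIsometry.norm_map, LinearIsometry.norm_map]

/-- The honest state, as a matrix with one column. -/
def honestColumn (φ : Honest n) :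
    Matrix (Fin (E.N + 1) × Ctrl n × Fin (Fintype.card (Fin n → Fin 2))) Unit ℂ :=
  Matrix.of fun p _ => honestVec E φ p.1 p.2.1 p.2.2 ()

theorem clockVec_honestColumn (φ : Honest n) {t : ℕ} (ht : t ≤ E.N) :
    clockVec (honestColumn E φ) t = honestVec E φ t := by
  rw [clockVec_of_lt _ (Nat.lt_succ_of_le ht)]
  rfl

theorem trace_honestColumn (φ : Honest n) (hφ : ‖φ‖ ^ 2 = ((E.N : ℝ) + 1)⁻¹) :
    (honestColumn E φ * (honestColumn E φ)ᴴ).trace = 1 := by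
  have h1 : ∀ t : Fin (E.N + 1), ∑ x, ∑ r, honestVec E φ t x r () *
      star (honestVec E φ t x r ()) = (((E.N : ℝ) + 1)⁻¹ : ℝ) := by
    intro t
    rw [← hφ, ← norm_honestVec E φ t, PiLp.norm_sq_eq_of_L2]
    simp only [PiLp.norm_sq_eq_of_L2, Complex.ofReal_sum, Finset.univ_unique,
      Finset.sum_singleton, PUnit.default_eq_unit]
    refine Finset.sum_congr rfl fun x _ => Finset.sum_congr rfl fun r _ => ?_
    rw [Complex.star_def, Complex.mul_conj, Complex.normSq_eq_norm_sq]
  simp only [Matrix.trace, Matrix.diag, Matrix.mul_apply, Fintype.sum_prod_type,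
    Matrix.conjTranspose_apply, Finset.univ_unique, Finset.sum_singleton, honestColumn,
    Matrix.of_apply, PUnit.default_eq_unit]
  rw [Finset.sum_congr rfl fun t _ => h1 t, Finset.sum_const, Finset.card_univ, Fintype.card_fin,
    nsmul_eq_mul, ← Complex.ofReal_natCast, ← Complex.ofReal_mul]
  push_cast
  exact mul_inv_cancel₀ (by exact_mod_cast Nat.succ_ne_zero E.N)

/-- The honest strategy. -/
def honestStrategy (φ : Honest n) (hφ : ‖φ‖ ^ 2 = ((E.N : ℝ) + 1)⁻¹) :
    Strategy E (Fintype.card (Fin n → Fin 2)) where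
  ρ := honestColumn E φ * (honestColumn E φ)ᴴ
  ρ_pos := Matrix.posSemidef_self_mul_conjTranspose _
  ρ_trace := trace_honestColumn E φ hφ
  refl P := qubitEquiv n (pauliMatrix P.1)
  refl_herm P := qubitEquiv_pauli_herm _
  refl_sq P := qubitEquiv_pauli_sq _
  meas Q b := qubitEquiv n (jointProj Q b)
  meas_herm Q b := qubitEquiv_isHermitian (jointProj_isHermitian Q b)
  meas_idem Q b := by rw [← map_mul, jointProj_mul_self]
  meas_sum Q := by rw [← map_sum, sum_jointProj, map_one]

theorem honestStrategy_act (φ : Honest n) (hφ : ‖φ‖ ^ 2 = ((E.N : ℝ) + 1)⁻¹) (a : Label n k) :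
    ((honestStrategy E φ hφ).reflections Unit).act a = (honestReflections n k).act a := by
  have hs : ∀ (P : Pauli n k) (v : Honest n),
      ((honestStrategy E φ hφ).reflections Unit).single P v =
        mact (qubitEquiv n (pauliMatrix P.1)) v := fun P v => by
    rw [Strategy.reflections, isom_apply]
    rfl
  cases a with
  | single P =>
    ext v x : 2
    rw [Reflections.act, Reflections.act, diag_apply, diag_apply, hs, honestReflections,
      isom_apply]
  | controlled c P =>
    ext v x : 2
    rw [Reflections.act, Reflections.act, diag_apply, diag_apply]
    split_ifs
    · rw [hs, honestReflections, isom_apply]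
    · rfl
  | derived Q P =>
    have h : obs ((honestStrategy E φ hφ).meas Q) (fun b => b P) =
        qubitEquiv n (pauliMatrix P.1.1) := by
      rw [← obs_jointProj, obs, obs, map_sum]
      refine Finset.sum_congr rfl fun b _ => ?_
      rw [map_smul]
      rfl
    ext v x : 2
    rw [Strategy.act_derived, Strategy.tact_one_left, h, Reflections.act, diag_apply,
      honestReflections, isom_apply]

theorem honestStrategy_value [NeZero n] (φ : Honest n) (hφ : ‖φ‖ ^ 2 = ((E.N : ℝ) + 1)⁻¹) :
    (honestStrategy E φ hφ).value = 1 := by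
  have hG : (honestStrategy E φ hφ).ρ = honestColumn E φ * (honestColumn E φ)ᴴ := rfl
  have h1 : (honestStrategy E φ hφ).propLoss (honestColumn E φ) = 0 := by
    rw [Strategy.propLoss, Finset.sum_eq_zero, mul_zero]
    intro i _
    rw [honestStrategy_act, clockVec_honestColumn E φ i.2.le, clockVec_honestColumn E φ i.2]
    have h := honestVec_prop E φ i.2
    rw [show (honestReflections n k).act (E.seqU.get i) (honestVec E φ (i + 1)) =
      honestVec E φ i from h.symm]
    simp
  have h2 : Strategy.initLoss (E := E) (d := Fintype.card (Fin n → Fin 2)) (honestColumn E φ) =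
      0 := by
    rw [Strategy.initLoss, Finset.sum_eq_zero, mul_zero]
    intro c _
    rw [clockVec_honestColumn E φ (Nat.zero_le _), honestVec_init]
    simp
  have h3 : Strategy.consLoss (E := E) (d := Fintype.card (Fin n → Fin 2)) (honestColumn E φ) =
      0 := by
    rw [Strategy.consLoss, Finset.sum_eq_zero, mul_zero]
    refine fun i _ => Finset.sum_eq_zero fun l _ => Finset.sum_eq_zero fun j _ => ?_
    rw [clockVec_honestColumn E φ (E.vertex_le_N l.2 i.2),
      clockVec_honestColumn E φ (E.vertex_le_N l.2 i.2), List.get_eq_getElem,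
      ← honestVec_cons E φ i.2 l.2 j.2]
    simp
  rw [Strategy.value_eq _ hG, h1, h2, h3]
  norm_num

/-- The game has value `1`. -/
theorem isLUB_value [NeZero n] :
    IsLUB {w : ℝ | ∃ (d : ℕ) (S : Strategy E d), S.value = w} 1 := by
  refine ⟨?_, fun w hw => hw ?_⟩
  · rintro w ⟨d, S, rfl⟩
    exact S.value_le_one
  · have hpos : 0 < Fintype.card (Fin n → Fin 2) := Fintype.card_pos
    obtain ⟨φ, hφ⟩ : ∃ φ : Honest n, ‖φ‖ ^ 2 = ((E.N : ℝ) + 1)⁻¹ := by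
      -- This makes the player's space nontrivial, so that it contains a vector of the required
      -- norm.
      have : Nonempty (Fin (Fintype.card (Fin n → Fin 2))) := ⟨⟨0, hpos⟩⟩
      obtain ⟨φ, hφ⟩ := exists_norm_eq (Honest n) (Real.sqrt_nonneg ((E.N : ℝ) + 1)⁻¹)
      exact ⟨φ, by rw [hφ, Real.sq_sqrt (by positivity)]⟩
    exact ⟨_, honestStrategy E φ hφ, honestStrategy_value E φ hφ⟩

end Honest

end PauliGame

namespace PauliGame

/-! ## The distances in terms of state vectors -/

section Distances

variable {n d : ℕ} {κ : Type} [Fintype κ]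

/-- A defect is a difference of two contractions, so it has norm at most `2`. Replacing `Φ` by
`uniform ψ` therefore costs `2 η`, and on a uniform state the defect is seen on `ψ` alone. -/
theorem sum_norm_mact_sq_le {Y : Type*} [Fintype Y] {D : Matrix Y (Fin d) ℂ}
    (hD : ∀ w : Player d κ, ‖mact D w‖ ≤ 2 * ‖w‖) {Φ : Space n (Player d κ)} {ψ : Player d κ}
    {η b : ℝ} (hη : ‖Φ - uniform ψ‖ ≤ η) (hb : ‖mact D ψ‖ ≤ b) :
    ∑ x, ‖mact D (Φ x)‖ ^ 2 ≤ (2 * η + b) ^ 2 := by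
  let lift : Space n (Player d κ) →
      PiLp 2 (fun _ : Ctrl n => PiLp 2 (fun _ : Y => EuclideanSpace ℂ κ)) :=
    fun v => WithLp.toLp 2 fun x => mact D (v x)
  have h1 : ∀ v, ‖lift v‖ ^ 2 = ∑ x, ‖mact D (v x)‖ ^ 2 := fun v => PiLp.norm_sq_eq_of_L2 _ _
  have h2 : ∀ v, ‖lift v‖ ≤ 2 * ‖v‖ := by
    intro v
    refine (pow_le_pow_iff_left₀ (norm_nonneg _) (by positivity) two_ne_zero).mp ?_
    rw [h1, mul_pow, PiLp.norm_sq_eq_of_L2, Finset.mul_sum]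
    refine Finset.sum_le_sum fun x _ => ?_
    rw [← mul_pow]
    exact pow_le_pow_left₀ (norm_nonneg _) (hD _) 2
  have h3 : lift Φ = lift (Φ - uniform ψ) + uniform (mact D ψ) := by
    ext x : 1
    change mact D (Φ x) = mact D ((Φ - uniform ψ : Space n (Player d κ)) x) + uniform (mact D ψ) x
    rw [PiLp.sub_apply, map_sub, uniform_apply, uniform_apply, map_smul]
    abel
  rw [← h1]
  refine pow_le_pow_left₀ (norm_nonneg _) ?_ 2
  rw [h3]
  refine (norm_add_le _ _).trans (add_le_add ((h2 _).trans ?_) ?_)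
  · gcongr
  · rwa [LinearIsometry.norm_map]

theorem norm_mact_le_of_idem {Y : Type*} [Fintype Y] [DecidableEq Y] {p : Matrix Y Y ℂ}
    (herm : p.IsHermitian) (idem : p * p = p) {K : Type*} [NormedAddCommGroup K]
    [InnerProductSpace ℂ K] (v : PiLp 2 (fun _ : Y => K)) : ‖mact p v‖ ≤ ‖v‖ := by
  have h := norm_mact_sq p v
  rw [herm.eq, idem] at h
  have h1 : (inner ℂ v (mact p v)).re ≤ ‖v‖ * ‖mact p v‖ :=
    (Complex.re_le_norm _).trans (norm_inner_le_norm _ _)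
  rcases (norm_nonneg (mact p v)).eq_or_lt with h0 | h0
  · rw [← h0]; exact norm_nonneg _
  · nlinarith

end Distances

/-! ### Defects behind the isometry and the two distances -/

namespace Strategy

variable {n k : ℕ} [NeZero k] [NeZero n] {E : Listing n k} {d : ℕ} (S : Strategy E d)
  {κ : Type} [Fintype κ] {G : Matrix (Fin (E.N + 1) × Ctrl n × Fin d) κ ℂ}

theorem re_trace_mul_ρ₀ (hG : S.ρ = G * Gᴴ) (M : Matrix (Fin d) (Fin d) ℂ) :
    (M * S.ρ₀).trace.re =
      (S.p₀)⁻¹ * ∑ x, (inner ℂ (clockVec (n := n) G 0 x) (mact M (clockVec (n := n) G 0 x))).re := by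
  rw [ρ₀, Matrix.mul_smul, Matrix.trace_smul, smul_eq_mul, ← Complex.ofReal_inv,
    Complex.re_ofReal_mul, S.trace_mul_zeroBlock hG, Complex.re_sum]

variable {d' : ℕ} {V : Matrix ((Fin n → Fin 2) × Fin d') (Fin d) ℂ}

/-- The defect of a Pauli operator behind the isometry `V`. -/
def reflDefect (V : Matrix ((Fin n → Fin 2) × Fin d') (Fin d) ℂ) (P : Pauli n k) :
    Matrix ((Fin n → Fin 2) × Fin d') (Fin d) ℂ :=
  V * S.refl P - (pauliMatrix P.1 ⊗ₖ (1 : Matrix (Fin d') (Fin d') ℂ)) * V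

/-- The defect of a joint measurement behind the isometry `V`. -/
def measDefect (V : Matrix ((Fin n → Fin 2) × Fin d') (Fin d) ℂ) (Q : MultiPauli n k)
    (b : Q.1 → Fin 2) : Matrix ((Fin n → Fin 2) × Fin d') (Fin d) ℂ :=
  V * S.meas Q b - (jointProj Q b ⊗ₖ (1 : Matrix (Fin d') (Fin d') ℂ)) * V

theorem kronecker_one_isHermitian {A : Matrix (Fin n → Fin 2) (Fin n → Fin 2) ℂ}
    (h : A.IsHermitian) : (A ⊗ₖ (1 : Matrix (Fin d') (Fin d') ℂ)).IsHermitian := by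
  rw [Matrix.IsHermitian, Matrix.conjTranspose_kronecker, h.eq, Matrix.conjTranspose_one]

theorem kronecker_one_mul (A B : Matrix (Fin n → Fin 2) (Fin n → Fin 2) ℂ) :
    (A ⊗ₖ (1 : Matrix (Fin d') (Fin d') ℂ)) * (B ⊗ₖ (1 : Matrix (Fin d') (Fin d') ℂ)) =
      (A * B) ⊗ₖ (1 : Matrix (Fin d') (Fin d') ℂ) := by
  rw [← Matrix.mul_kronecker_mul, one_mul]

theorem pauli_kronecker_isometry (P : PauliString n) :
    (pauliMatrix P ⊗ₖ (1 : Matrix (Fin d') (Fin d') ℂ))ᴴ *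
      (pauliMatrix P ⊗ₖ (1 : Matrix (Fin d') (Fin d') ℂ)) = 1 := by
  rw [(kronecker_one_isHermitian (pauliMatrix_herm P)).eq, kronecker_one_mul, pauliMatrix_sq,
    Matrix.one_kronecker_one]

theorem refl_isometry (P : Pauli n k) : (S.refl P)ᴴ * S.refl P = 1 := by
  rw [(S.refl_herm P).eq, S.refl_sq]

theorem norm_reflDefect_le (hV : Vᴴ * V = 1) (P : Pauli n k) (w : Player d κ) :
    ‖mact (S.reflDefect V P) w‖ ≤ 2 * ‖w‖ := by
  rw [reflDefect, mact_sub, mact_mul, mact_mul, two_mul]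
  refine (norm_sub_le _ _).trans_eq ?_
  rw [norm_mact hV, norm_mact (S.refl_isometry P), norm_mact (pauli_kronecker_isometry P.1),
    norm_mact hV]

theorem norm_measDefect_le (hV : Vᴴ * V = 1) (Q : MultiPauli n k) (b : Q.1 → Fin 2)
    (w : Player d κ) : ‖mact (S.measDefect V Q b) w‖ ≤ 2 * ‖w‖ := by
  rw [measDefect, mact_sub, mact_mul, mact_mul, two_mul]
  refine (norm_sub_le _ _).trans (add_le_add ?_ ?_)
  · rw [norm_mact hV]
    exact norm_mact_le_of_idem (S.meas_herm Q b) (S.meas_idem Q b) w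
  · refine (norm_mact_le_of_idem (kronecker_one_isHermitian (jointProj_isHermitian Q b)) ?_
      _).trans_eq (norm_mact hV w)
    rw [kronecker_one_mul, jointProj_mul_self]

/-- Both terms of the defect preserve the norm, so only the cross term remains, and it is the
correlation of `P̂` with the pulled back Pauli operator. -/
theorem norm_reflDefect_sq (hV : Vᴴ * V = 1) (P : Pauli n k) (w : Player d κ) :
    ‖mact (S.reflDefect V P) w‖ ^ 2 = 2 * ‖w‖ ^ 2 -
      2 * (inner ℂ w (mact (S.refl P * pullback V (pauliMatrix P.1)) w)).re := by
  rw [reflDefect, mact_sub, mact_mul, mact_mul, norm_sub_sq (𝕜 := ℂ), norm_mact hV,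
    norm_mact (S.refl_isometry P), norm_mact (pauli_kronecker_isometry P.1), norm_mact hV,
    inner_mact, inner_mact, (S.refl_herm P).eq, pullback, mact_mul, mact_mul, mact_mul]
  change _ - 2 * Complex.re _ + _ = _
  ring

theorem reflDist_eq (hG : S.ρ = G * Gᴴ) (h0 : 0 < S.p₀) (hV : Vᴴ * V = 1) (P : Pauli n k) :
    reflDist S.ρ₀ (S.refl P) (pullback V (pauliMatrix P.1)) =
      √((S.p₀)⁻¹ * ((1 / 2) * ∑ x, ‖mact (S.reflDefect V P) (clockVec (n := n) G 0 x)‖ ^ 2)) := by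
  rw [reflDist, S.re_trace_mul_ρ₀ hG]
  congr 1
  simp only [S.norm_reflDefect_sq hV, Finset.sum_sub_distrib, ← Finset.mul_sum]
  rw [← PiLp.norm_sq_eq_of_L2, ← S.p₀_eq hG, mul_sub, mul_sub, ← mul_assoc (1 / 2 : ℝ),
    ← mul_assoc (1 / 2 : ℝ)]
  norm_num
  rw [inv_mul_cancel₀ h0.ne']

/-- The measurement operators `V Q̂^b` and `(Π_b ⊗ I) V` are admissible in the infimum: `V` is an
isometry and `Q̂^b`, `Π_b` are projections. Their difference is the defect. -/
theorem povmDist_le (hG : S.ρ = G * Gᴴ) (hV : Vᴴ * V = 1) (Q : MultiPauli n k) :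
    povmDist S.ρ₀ (S.meas Q) (fun b => pullback V (jointProj Q b)) ≤
      √(∑ b, (S.p₀)⁻¹ * ∑ x, ‖mact (S.measDefect V Q b) (clockVec (n := n) G 0 x)‖ ^ 2) := by
  let f := (Fintype.equivFin ((Fin n → Fin 2) × Fin d')).symm
  refine csInf_le ⟨0, ?_⟩ ⟨_, fun b => (V * S.meas Q b).submatrix f id,
    fun b => ((jointProj Q b ⊗ₖ (1 : Matrix (Fin d') (Fin d') ℂ)) * V).submatrix f id, ?_, ?_, ?_⟩
  · rintro r ⟨m, N₀, N₁, -, -, rfl⟩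
    exact Real.sqrt_nonneg _
  · intro b
    rw [Matrix.conjTranspose_submatrix, Matrix.submatrix_mul_equiv, Matrix.submatrix_id_id,
      Matrix.conjTranspose_mul, Matrix.mul_assoc, ← Matrix.mul_assoc Vᴴ, hV, Matrix.one_mul,
      (S.meas_herm Q b).eq, S.meas_idem]
  · intro b
    change _ = pullback V (jointProj Q b)
    rw [Matrix.conjTranspose_submatrix, Matrix.submatrix_mul_equiv, Matrix.submatrix_id_id,
      Matrix.conjTranspose_mul, (kronecker_one_isHermitian (jointProj_isHermitian Q b)).eq,
      Matrix.mul_assoc, ← Matrix.mul_assoc (_ ⊗ₖ _), kronecker_one_mul, jointProj_mul_self,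
      pullback, Matrix.mul_assoc]
  · congr 1
    refine Finset.sum_congr rfl fun b _ => ?_
    have h : (V * S.meas Q b).submatrix f id -
        ((jointProj Q b ⊗ₖ (1 : Matrix (Fin d') (Fin d') ℂ)) * V).submatrix f id =
        (S.measDefect V Q b).submatrix f id := rfl
    beta_reduce
    rw [h, Matrix.conjTranspose_submatrix,
      Matrix.submatrix_mul_equiv, Matrix.submatrix_id_id, S.re_trace_mul_ρ₀ hG]
    simp only [norm_mact_sq]

/-- Both distances are controlled by the defects on a vector near the state at clock value `0`. -/
theorem dist_le (hG : S.ρ = G * Gᴴ) (h0 : 0 < S.p₀) (hV : Vᴴ * V = 1) {ψ : Player d κ} {η b : ℝ}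
    (hη : ‖clockVec (n := n) G 0 - uniform ψ‖ ≤ η)
    (hrefl : ∀ P, ‖mact (S.reflDefect V P) ψ‖ ≤ b)
    (hmeas : ∀ Q c, ‖mact (S.measDefect V Q c) ψ‖ ≤ b) :
    (∀ P, reflDist S.ρ₀ (S.refl P) (pullback V (pauliMatrix P.1)) ≤
      √(2 ^ k * ((S.p₀)⁻¹ * (2 * η + b) ^ 2))) ∧
    ∀ Q, povmDist S.ρ₀ (S.meas Q) (fun b => pullback V (jointProj Q b)) ≤
      √(2 ^ k * ((S.p₀)⁻¹ * (2 * η + b) ^ 2)) := by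
  have hp : 0 ≤ (S.p₀)⁻¹ := (inv_pos.mpr h0).le
  refine ⟨fun P => ?_, fun Q => (S.povmDist_le hG hV Q).trans (Real.sqrt_le_sqrt ?_)⟩
  · rw [S.reflDist_eq hG h0 hV]
    refine Real.sqrt_le_sqrt ?_
    have h1 := sum_norm_mact_sq_le (S.norm_reflDefect_le hV P) hη (hrefl P)
    have h2 : (1 : ℝ) ≤ 2 ^ k := one_le_pow₀ (by norm_num)
    have h3 : 0 ≤ (S.p₀)⁻¹ * (2 * η + b) ^ 2 := by positivity
    calc _ ≤ (S.p₀)⁻¹ * (1 * (2 * η + b) ^ 2) := by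
          gcongr
          norm_num
      _ ≤ _ := by rw [one_mul]; exact le_mul_of_one_le_left h3 h2
  · refine (Finset.sum_le_sum fun c _ => mul_le_mul_of_nonneg_left
      (sum_norm_mact_sq_le (S.norm_measDefect_le hV Q c) hη (hmeas Q c)) hp).trans_eq ?_
    -- A set `Q` has `k` elements, hence `2 ^ k` outcomes.
    rw [Finset.sum_const, Finset.card_univ, Fintype.card_pi, Finset.prod_const, Finset.card_univ,
      Fintype.card_coe, Q.2.1, Fintype.card_fin, nsmul_eq_mul]
    push_cast
    rfl

theorem norm_reflDefect_isometryMatrix {e : ℝ} {ψ : Player d κ}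
    (h : AllLegit (S.reflections κ) e ψ) (P : Pauli n k) :
    ‖mact (S.reflDefect S.isometryMatrix P) ψ‖ ≤ (k + 1) * e := by
  rw [reflDefect, mact_sub, mact_mul, mact_mul, mact_isometryMatrix, mact_isometryMatrix]
  change ‖_ - qubitAct _ _‖ ≤ _
  rw [qubitAct_pauli, ← map_sub, LinearIsometry.norm_map]
  exact h.spread_single P

theorem norm_measDefect_isometryMatrix {e : ℝ} {ψ : Player d κ}
    (h : AllLegit (S.reflections κ) e ψ) (Q : MultiPauli n k) (b : Q.1 → Fin 2) :
    ‖mact (S.measDefect S.isometryMatrix Q b) ψ‖ ≤ k * ((6 * k ^ 2 + 7 * k + 2) * e) := by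
  rw [measDefect, mact_sub, mact_mul, mact_mul, mact_isometryMatrix, mact_isometryMatrix]
  change ‖_ - qubitAct _ _‖ ≤ _
  rw [qubitAct_jointProj, ← map_sub, LinearIsometry.norm_map]
  have h1 := h.spread_prod_eigenProj Q b Q.1.attach.toList
  rw [Finset.length_toList, Finset.card_attach, Q.2.1] at h1
  -- By `prod_reflProj_obs` the projection `Q̂^b` is the product of the spectral projections of the
  -- reflections `P|Q`, to which the word estimate applies.
  have h2 : mact (S.meas Q b) ψ =
      (Q.1.attach.toList.map fun P => eigenProj ((S.reflections κ).derived Q P) (b P)).prod ψ := by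
    rw [← prod_reflProj_obs (S.meas_herm Q) (S.meas_idem Q) (S.meas_sum Q) b
      (l := Q.1.attach.toList) (by simp)]
    induction Q.1.attach.toList with
    | nil => simp [mact_one]
    | cons P l ih =>
      rw [List.map_cons, List.prod_cons, mact_mul, ih, List.map_cons, List.prod_cons,
        Module.End.mul_apply, eigenProj_apply, reflProj, mact_smul, mact_add, mact_smul, mact_one]
      rfl
  rwa [h2]

end Strategy

end PauliGame

namespace PauliGame

/-! ## The final estimates -/

/-- If the error is not small then the bound of the theorem exceeds any given constant. -/
theorem one_le_of_large {N δ y : ℝ} (hN : 1 ≤ N) (hy : 0 ≤ y) (hδ : δ ^ 2 = 12 * N ^ 3 * y ^ 4)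
    (hδ0 : 0 ≤ δ) (h : 1 / (2 * (N + 1)) < 2 * N * δ) : 1 ≤ 6 * (N ^ 4 * y) := by
  have h1 : 1 < 8 * N ^ 2 * δ := by
    rw [div_lt_iff₀ (by linarith)] at h
    nlinarith [mul_nonneg (mul_nonneg (by linarith : 0 ≤ N) hδ0) (by linarith : 0 ≤ N - 1)]
  have h2 : 1 < (8 * N ^ 2 * δ) ^ 2 := one_lt_pow₀ h1 two_ne_zero
  -- The constant `6` is chosen so that `6 ^ 4` exceeds `768`.
  have h3 : (8 * N ^ 2 * δ) ^ 2 = 768 * (N ^ 7 * y ^ 4) := by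
    rw [mul_pow, hδ]; ring
  have h4 : N ^ 7 * y ^ 4 ≤ (N ^ 4 * y) ^ 4 := by
    rw [mul_pow, ← pow_mul]
    gcongr
    norm_num
  by_contra hlt
  push Not at hlt
  have h5 : (6 * (N ^ 4 * y)) ^ 4 < 1 := pow_lt_one₀ (by positivity) hlt (by norm_num)
  rw [mul_pow] at h5
  linarith

theorem small_error {N δ y : ℝ} (hN : 1 ≤ N) (hδ : δ ^ 2 = 12 * N ^ 3 * y ^ 4)
    (hδ0 : 0 ≤ δ) (h : 2 * N * δ ≤ 1 / (2 * (N + 1))) : y ≤ 1 := by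
  have h1 : 2 * N * δ ≤ 1 := by
    refine h.trans ?_
    rw [div_le_one (by linarith)]
    linarith
  have h2 : δ ≤ 1 := by nlinarith
  have h3 : δ ^ 2 ≤ 1 := pow_le_one₀ hδ0 h2
  have h4 : 1 ≤ N ^ 3 := one_le_pow₀ hN
  by_contra hlt
  push Not at hlt
  have h5 : 1 < y ^ 4 := one_lt_pow₀ hlt (by norm_num)
  nlinarith

/-- As `p⁻¹ ≤ 4 N` and `δ ^ 2` is of order `N ^ 3 ε`, the radicand is of order `N ^ 8 ε`. The root
`N ^ 4 √ε` is weakened to `N ^ 4 y` with `y = ε ^ (1/4)`, using `y ≤ 1`. -/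
theorem small_bound {N δ y p K T : ℝ} (hN : 1 ≤ N) (hy : 0 ≤ y) (hδ : δ ^ 2 = 12 * N ^ 3 * y ^ 4)
    (hy1 : y ≤ 1) (hp : 1 / (2 * (N + 1)) ≤ p) (hK : 0 ≤ K) (hT : 1 ≤ T) :
    √(T * (p⁻¹ * (K * N ^ 2 * δ) ^ 2)) ≤ 12 * T * K * (N ^ 4 * y) := by
  refine Real.sqrt_le_iff.mpr ⟨by positivity, ?_⟩
  have hp' : p⁻¹ ≤ 4 * N := by
    rw [inv_le_comm₀ (lt_of_lt_of_le (by positivity) hp) (by linarith)]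
    refine le_trans ?_ hp
    rw [inv_eq_one_div]
    exact one_div_le_one_div_of_le (by linarith) (by linarith)
  have h1 : y ^ 4 ≤ y ^ 2 := pow_le_pow_of_le_one hy hy1 (by norm_num)
  calc T * (p⁻¹ * (K * N ^ 2 * δ) ^ 2) ≤ T * (4 * N * (K * N ^ 2 * δ) ^ 2) := by gcongr
    _ = 48 * (T * 1) * K ^ 2 * N ^ 8 * y ^ 4 := by rw [mul_pow, hδ]; ring
    _ ≤ 144 * (T * T) * K ^ 2 * N ^ 8 * y ^ 2 := by gcongr; norm_num
    _ = _ := by ring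

theorem small_deviation {N δ y : ℝ} (hN : 1 ≤ N) (hy : 0 ≤ y) (hδ : δ ^ 2 = 12 * N ^ 3 * y ^ 4)
    (hy1 : y ≤ 1) : 2 * N * δ ≤ 7 * (N ^ 4 * y) := by
  refine le_of_sq_le_sq ?_ (by positivity)
  have h1 : y ^ 4 ≤ y ^ 2 := pow_le_pow_of_le_one hy hy1 (by norm_num)
  calc (2 * N * δ) ^ 2 = 48 * N ^ 5 * y ^ 4 := by rw [mul_pow, hδ]; ring
    _ ≤ 49 * N ^ 8 * y ^ 2 := by gcongr <;> norm_num
    _ = _ := by ring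

/-- The constant of the theorem that belongs to the defects. -/
def defectConst (k : ℕ) : ℝ := 2 + 16 * (k + 1 + k * (6 * k ^ 2 + 7 * k + 2))

namespace Strategy

variable {n k : ℕ} [NeZero k] [NeZero n] {E : Listing n k} {d : ℕ} (S : Strategy E d)

theorem p₀_mem_Icc : 0 ≤ S.p₀ ∧ S.p₀ ≤ 1 := by
  obtain ⟨G, hG⟩ := S.exists_factor
  rw [S.p₀_eq hG]
  refine ⟨by positivity, ?_⟩
  have h1 : ∀ t : Fin (E.N + 1), ‖clockVec (n := n) (d := d) G t‖ ^ 2 ≤ 1 := by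
    intro t
    rw [← S.norm_clockVec_sq_sum hG]
    exact Finset.single_le_sum (f := fun t : Fin (E.N + 1) =>
      ‖clockVec (n := n) (d := d) G t‖ ^ 2) (fun _ _ => by positivity) (Finset.mem_univ t)
  exact h1 ⟨0, Nat.succ_pos _⟩

/-- A vector near the state at clock value `0` on which all defects are small. -/
theorem exists_small_defects {κ : Type} [Fintype κ]
    {G : Matrix (Fin (E.N + 1) × Ctrl n × Fin d) κ ℂ} {δ : ℝ}
    (h : ApproxClock (S.reflections κ) E δ (clockVec G)) : ∃ (ψ : Player d κ) (η b : ℝ),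
      ‖clockVec (n := n) G 0 - uniform ψ‖ ≤ η ∧
      (∀ P, ‖mact (S.reflDefect S.isometryMatrix P) ψ‖ ≤ b) ∧
      (∀ Q c, ‖mact (S.measDefect S.isometryMatrix Q c) ψ‖ ≤ b) ∧
      0 ≤ 2 * η + b ∧ 2 * η + b ≤ defectConst k * E.N ^ 2 * δ := by
  obtain ⟨ψ, hψ, hgood⟩ := h.exists_good
  have hδ := h.nonneg
  have hleg : AllLegit (S.reflections κ) (2 * n * (8 * E.N * δ)) ψ := by
    intro w hw
    have h1 := (hgood _ hw).legit
    rwa [List.reverse_reverse] at h1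
  have hN : (1 : ℝ) ≤ E.N := by exact_mod_cast E.N_pos
  have hnN : (2 * n : ℝ) ≤ E.N := by exact_mod_cast E.two_mul_le_N
  have hk : (0 : ℝ) ≤ k := by positivity
  set e : ℝ := 2 * n * (8 * E.N * δ) with he_def
  have he : 0 ≤ e := by positivity
  have heN : e ≤ 8 * E.N ^ 2 * δ := by
    calc e ≤ E.N * (8 * E.N * δ) := by rw [he_def]; gcongr
      _ = _ := by ring
  -- This `b` is the sum of the constants for reflections and for measurements, so that it dominates
  -- both.
  refine ⟨ψ, E.N * δ, (k + 1 + k * (6 * k ^ 2 + 7 * k + 2)) * e, hψ, fun P => ?_, fun Q c => ?_,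
    by positivity, ?_⟩
  · refine (S.norm_reflDefect_isometryMatrix hleg P).trans (mul_le_mul_of_nonneg_right ?_ he)
    exact le_add_of_nonneg_right (by positivity)
  · refine (S.norm_measDefect_isometryMatrix hleg Q c).trans ?_
    rw [← mul_assoc]
    refine mul_le_mul_of_nonneg_right ?_ he
    exact le_add_of_nonneg_left (by positivity)
  · have h1 : (E.N : ℝ) * δ ≤ E.N ^ 2 * δ := by
      gcongr
      exact le_self_pow₀ hN two_ne_zero
    have h2 : (k + 1 + k * (6 * k ^ 2 + 7 * k + 2)) * e ≤
        (k + 1 + k * (6 * k ^ 2 + 7 * k + 2)) * (16 * (E.N ^ 2 * δ)) := by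
      gcongr
      have : 0 ≤ (E.N : ℝ) ^ 2 * δ := by positivity
      linarith
    rw [defectConst]
    linarith

/-- The estimates of the theorem. -/
theorem estimates {y : ℝ} (hy : 0 ≤ y) (hv : 1 - y ^ 4 ≤ S.value) :
    (0 < S.p₀ →
      (∀ P : Pauli n k, reflDist S.ρ₀ (S.refl P) (pullback S.isometryMatrix (pauliMatrix P.1)) ≤
        12 * 2 ^ k * defectConst k * (E.N ^ 4 * y)) ∧
      ∀ Q : MultiPauli n k, povmDist S.ρ₀ (S.meas Q)
          (fun b => pullback S.isometryMatrix (jointProj Q b)) ≤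
        12 * 2 ^ k * defectConst k * (E.N ^ 4 * y)) ∧
    |S.p₀ - 1 / ((E.N : ℝ) + 1)| ≤ 12 * 2 ^ k * defectConst k * (E.N ^ 4 * y) := by
  obtain ⟨G, hG⟩ := S.exists_factor
  have hclock := S.approxClock hG (by positivity) hv
  set δ := √(12 * E.N ^ 3 * y ^ 4) with hδ_def
  have hδ0 : 0 ≤ δ := Real.sqrt_nonneg _
  have hδ : δ ^ 2 = 12 * (E.N : ℝ) ^ 3 * y ^ 4 := Real.sq_sqrt (by positivity)
  have hN : (1 : ℝ) ≤ E.N := by exact_mod_cast E.N_pos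
  have hp₀ := S.abs_p₀_sub_le hG hδ0 hclock
  have hK : 2 ≤ defectConst k := by
    rw [defectConst]
    exact le_add_of_nonneg_right (by positivity)
  have hT : (1 : ℝ) ≤ 2 ^ k := one_le_pow₀ (by norm_num)
  have hTK : (2 : ℝ) ≤ 2 ^ k * defectConst k := by nlinarith
  have hM : 0 ≤ (E.N : ℝ) ^ 4 * y := by positivity
  rcases le_or_gt (2 * E.N * δ) (1 / (2 * ((E.N : ℝ) + 1))) with hsmall | hlarge
  -- The deviation of `p₀` is at most half of `1 / (N + 1)`, which keeps `p₀` above the other half.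
  · have hy1 := small_error hN hδ hδ0 hsmall
    have hp : 1 / (2 * ((E.N : ℝ) + 1)) ≤ S.p₀ := by
      have h1 := (abs_le.mp hp₀).1
      have h2 : 1 / ((E.N : ℝ) + 1) = 1 / (2 * ((E.N : ℝ) + 1)) + 1 / (2 * ((E.N : ℝ) + 1)) := by
        field_simp; norm_num
      linarith
    refine ⟨fun h0 => ?_, ?_⟩
    · obtain ⟨ψ, η, b, hη, hr, hm, hnn, hle⟩ := S.exists_small_defects hclock
      obtain ⟨hR, hP⟩ := S.dist_le hG h0 S.isometryMatrix_isometry hη hr hm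
      have hb : √(2 ^ k * ((S.p₀)⁻¹ * (2 * η + b) ^ 2)) ≤
          12 * 2 ^ k * defectConst k * (E.N ^ 4 * y) := by
        refine le_trans (Real.sqrt_le_sqrt ?_)
          (small_bound hN hy hδ hy1 hp (by linarith : 0 ≤ defectConst k) hT)
        have := (inv_pos.mpr h0).le
        gcongr
      exact ⟨fun P => (hR P).trans hb, fun Q => (hP Q).trans hb⟩
    · refine hp₀.trans ((small_deviation hN hy hδ hy1).trans ?_)
      gcongr
      linarith
  -- Here the right-hand side is at least a constant of order `2 ^ k`, so trivial bounds suffice.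
  · have h1 := one_le_of_large hN hy hδ hδ0 hlarge
    refine ⟨fun h0 => ?_, ?_⟩
    -- Taking `ψ = 0` yields the trivial bound: `η ^ 2 = ‖Ψ 0‖ ^ 2 = p₀` cancels the normalization.
    · obtain ⟨hR, hP⟩ := S.dist_le hG h0 S.isometryMatrix_isometry (ψ := 0)
        (η := ‖clockVec (n := n) (d := d) G 0‖) (b := 0) (by simp) (by simp) (by simp)
      have hb : √(2 ^ k * ((S.p₀)⁻¹ * (2 * ‖clockVec (n := n) (d := d) G 0‖ + 0) ^ 2)) ≤
          12 * 2 ^ k * defectConst k * (E.N ^ 4 * y) := by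
        rw [add_zero, mul_pow, ← S.p₀_eq hG, mul_left_comm _ ((2 : ℝ) ^ 2), inv_mul_cancel₀ h0.ne',
          mul_one]
        refine Real.sqrt_le_iff.mpr ⟨by positivity, ?_⟩
        have h2 : 2 * (2 : ℝ) ^ k ≤ 12 * 2 ^ k * defectConst k * (E.N ^ 4 * y) := by
          nlinarith
        nlinarith
      exact ⟨fun P => (hR P).trans hb, fun Q => (hP Q).trans hb⟩
    · have h2 : |S.p₀ - 1 / ((E.N : ℝ) + 1)| ≤ 1 := by
        obtain ⟨h3, h4⟩ := S.p₀_mem_Icc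
        have h5 : 0 ≤ 1 / ((E.N : ℝ) + 1) := by positivity
        have h6 : 1 / ((E.N : ℝ) + 1) ≤ 1 := by
          rw [div_le_one (by linarith)]; linarith
        exact abs_le.mpr ⟨by linarith, by linarith⟩
      refine h2.trans (h1.trans ?_)
      gcongr
      linarith

end Strategy

end PauliGame
end

theorem mainTheorem8 (k : ℕ) [NeZero k] :
    ∃ κ C : ℝ, 0 < κ ∧ 0 < C ∧
      ∀ (n : ℕ) [NeZero n] (E : PauliGame.Listing n k),
        IsLUB {w : ℝ | ∃ (d : ℕ) (S : PauliGame.Strategy E d), S.value = w} 1 ∧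
        ∀ (ε : ℝ), 0 ≤ ε → ∀ (d : ℕ) (S : PauliGame.Strategy E d), 1 - ε ≤ S.value →
          (∃ (d' : ℕ) (V : Matrix ((Fin n → Fin 2) × Fin d') (Fin d) ℂ),
            Vᴴ * V = 1 ∧
            (0 < S.p₀ →
              (∀ P : PauliGame.Pauli n k,
                PauliGame.reflDist S.ρ₀ (S.refl P)
                    (PauliGame.pullback V (PauliGame.pauliMatrix P.1))
                  ≤ C * (E.N : ℝ) ^ κ * ε ^ (1 / κ)) ∧
              (∀ Q : PauliGame.MultiPauli n k,
                PauliGame.povmDist S.ρ₀ (S.meas Q)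
                    (fun b => PauliGame.pullback V (PauliGame.jointProj Q b))
                  ≤ C * (E.N : ℝ) ^ κ * ε ^ (1 / κ)))) ∧
          |S.p₀ - 1 / ((E.N : ℝ) + 1)| ≤ C * (E.N : ℝ) ^ κ * ε ^ (1 / κ) := by
  have hC : (0 : ℝ) < 12 * 2 ^ k * PauliGame.defectConst k := by
    rw [PauliGame.defectConst]; positivity
  -- The power `N ^ 4` forces `κ ≥ 4`, since the same `κ` governs both exponents. The estimates are
  -- run with `y = ε ^ (1/4)`, so that `ε = y ^ 4`.
  refine ⟨4, 12 * 2 ^ k * PauliGame.defectConst k, by norm_num, hC, ?_⟩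
  intro n _ E
  refine ⟨PauliGame.isLUB_value E, fun ε hε d S hv => ?_⟩
  have hy : 0 ≤ ε ^ (1 / 4 : ℝ) := Real.rpow_nonneg hε _
  have hy4 : (ε ^ (1 / 4 : ℝ)) ^ 4 = ε := by
    rw [← Real.rpow_natCast, ← Real.rpow_mul hε]; norm_num
  have h := S.estimates hy (by rwa [hy4])
  have hN : (E.N : ℝ) ^ (4 : ℝ) = (E.N : ℝ) ^ 4 := by exact_mod_cast Real.rpow_natCast (E.N : ℝ) 4
  rw [hN, mul_assoc]
  exact ⟨⟨_, S.isometryMatrix, S.isometryMatrix_isometry, h.1⟩, h.2⟩
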